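/- Let $k$ be an algebraically closed field of characteristic $0$. Let $f : X \to Y$ be a finite flat morphism of projective varieties (integral projective schemes) over $k$, and let $\mathcal{O}_Y(1)$ be a very ample line bundle on $Y$ such that $\mathcal{O}_X(1) := f^*\mathcal{O}_Y(1)$ is very ample. Put $R = \bigoplus_{i \ge 0} H^0(Y, \mathcal{O}_Y(i))$ and $S = \bigoplus_{i \ge 0} H^0(X, \mathcal{O}_X(i))$, and assume that $R$ is normal. Let $I_X$ be the kernel of the natural homomorphism of $k$-algebras $R \otimes_k \mathrm{Sym}^\bullet H^0(X, \mathcal{O}_X(1)) \to S$, graded by total degree. Then $I_X$ is generated by homogeneous elements of bounded degree; let $n_X$ be the least integer $d \geq 0$ such that $I_X$ is generated by homogeneous elements of degree at most $d$. Let $\mathcal{E} = \bigoplus_{j=1}^{t} \mathcal{O}_Y(-a_j)$ with $a_1, \dots, a_t \in \mathbb{Z}$, and put $$\underline{n} = \max\{2, n_X\} + \max_{i,j}(a_i - a_j),$$ a positive integer (if the twists are normalized so that $a_t \ge \dots \ge a_1 = 0$, this is $\max\{2, n_X\} + a_t$; if $t = 0$, the second term is $0$). Let $Z \subset Y$ be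 any closed subscheme which is $\underline{n}$-separating, that is, $H^0(Y, \mathcal{I}_{Z|Y}(i)) = 0$ for $0 \le i \le \underline{n}$. Write $X_Z = X \times_Y Z$, with projection $f_Z : X_Z \to Z$, and suppose that (i) $\mathcal{E}|_Z$ lifts to $X_Z$: there are a coherent sheaf $\mathcal{F}$ on $X_Z$ and an isomorphism $(f_Z)_*\mathcal{F} \cong \mathcal{E}|_Z$; (ii) the associated morphism $(f_Z)_*\mathcal{O}_{X_Z} \otimes_{\mathcal{O}_Z} \mathcal{E}|_Z \to \mathcal{E}|_Z$, which endows $\mathcal{E}|_Z$ with the structure of an $(f_Z)_*\mathcal{O}_{X_Z}$-module, is the restriction to $Z$ of an $\mathcal{O}_Y$-linear morphism $f_*\mathcal{O}_X \otimes_{\mathcal{O}_Y} \mathcal{E} \to \mathcal{E}$. Then $\mathcal{E}$ lifts to $X$: there is a coherent sheaf $\mathcal{G}$ on $X$ with $f_*\mathcal{G} \cong \mathcal{E}$. -/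

import Mathlib

open CategoryTheory AlgebraicGeometry Opposite TopologicalSpace
open scoped TensorProduct

universe u

noncomputable section

namespace FiniteFlatLift

/-! ### Projective space and its coordinate functions -/

/-- The standard grading of the polynomial ring `k[x₀, …, x_N]`. -/
abbrev grading (k : Type u) [Field k] (N : ℕ) : ℕ → Submodule k (MvPolynomial (Fin (N + 1)) k) :=
  MvPolynomial.homogeneousSubmodule (Fin (N + 1)) k

instance (k : Type u) [Field k] (N : ℕ) : GradedAlgebra (grading k N) :=
  MvPolynomial.gradedAlgebra

/-- The projective space `ℙ^N` over `k`, as `Proj k[x₀, …, x_N]`. -/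
abbrev PSpace (k : Type u) [Field k] (N : ℕ) : Scheme.{u} := Proj (grading k N)

/-- The structure morphism `ℙ^N ⟶ Spec k`. -/
def PSpace.toSpec (k : Type u) [Field k] (N : ℕ) : PSpace k N ⟶ Spec (.of k) :=
  Proj.toSpecZero (grading k N) ≫ Spec.map (CommRingCat.ofHom (algebraMap k (grading k N 0)))

/-- The standard chart `D₊(x_a)` of `ℙ^N`. -/
def chart (k : Type u) [Field k] (N : ℕ) (a : Fin (N + 1)) : (PSpace k N).Opens :=
  Proj.basicOpen (grading k N) (MvPolynomial.X a)

/-- The regular function `x_b / x_a` on the chart `D₊(x_a)`. -/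
def ratio (k : Type u) [Field k] (N : ℕ) (a b : Fin (N + 1)) : Γ(PSpace k N, chart k N a) :=
  (Proj.awayToSection (grading k N) (MvPolynomial.X a)).hom
    (HomogeneousLocalization.Away.mk (grading k N) (MvPolynomial.isHomogeneous_X k a) 1
      (MvPolynomial.X b) (by simpa using MvPolynomial.isHomogeneous_X k b))

/-! ### The line bundles `g^* 𝒪(n)` -/

/-- Restriction of functions. -/
def res {X : Scheme.{u}} {U V : X.Opens} (h : V ≤ U) : Γ(X, U) →+* Γ(X, V) :=
  (X.presheaf.map (homOfLE h).op).hom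

lemma res_res {X : Scheme.{u}} {U V W : X.Opens} (h : V ≤ U) (h' : W ≤ V) (s : Γ(X, U)) :
    res h' (res h s) = res (h'.trans h) s := by
  simp only [res]
  rw [← CommRingCat.comp_apply, ← Functor.map_comp]
  rfl

lemma res_self {X : Scheme.{u}} {U : X.Opens} (h : U ≤ U) (s : Γ(X, U)) : res h s = s := by
  simp [res]

section Twist

variable {k : Type u} [Field k] {N : ℕ} {X : Scheme.{u}} (g : X ⟶ PSpace k N)

/-- The preimage of the chart `D₊(x_a)` under `g : X ⟶ ℙ^N`. -/
def dom (a : Fin (N + 1)) : X.Opens := g ⁻¹ᵁ chart k N a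

/-- The pullback of the function `x_b / x_a` under `g : X ⟶ ℙ^N`. -/
def transFun (a b : Fin (N + 1)) : Γ(X, dom g a) := (g.app (chart k N a)).hom (ratio k N a b)

/-- Families of functions, one on each `V ∩ g⁻¹ D₊(x_a)`. -/
abbrev ChartFun (V : X.Opens) : Type u := ∀ a : Fin (N + 1), Γ(X, V ⊓ dom g a)

instance (V : X.Opens) : Algebra Γ(X, V) (ChartFun g V) :=
  (RingHom.pi fun _ => res inf_le_left).toAlgebra

lemma smul_chartFun {V : X.Opens} (r : Γ(X, V)) (s : ChartFun g V) (a : Fin (N + 1)) :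
    (r • s) a = res inf_le_left r * s a := by
  rw [Algebra.smul_def]
  rfl

lemma overlap_le_left (V : X.Opens) (a b : Fin (N + 1)) :
    V ⊓ (dom g a ⊓ dom g b) ≤ V ⊓ dom g a := inf_le_inf_left _ inf_le_left

lemma overlap_le_right (V : X.Opens) (a b : Fin (N + 1)) :
    V ⊓ (dom g a ⊓ dom g b) ≤ V ⊓ dom g b := inf_le_inf_left _ inf_le_right

lemma overlap_le_dom (V : X.Opens) (a b : Fin (N + 1)) :
    V ⊓ (dom g a ⊓ dom g b) ≤ dom g a := inf_le_right.trans inf_le_left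

/-- The sections over `V` of the line bundle `𝒪_X(n) = g^* 𝒪(n)`, in terms of the trivialisations
`𝒪(n) = x_a ^ n 𝒪` on `D₊(x_a)`: the families `(s_a)` for which the `s_a x_a ^ n` agree, that is
`s_a = (x_b / x_a) ^ n s_b` on `V ∩ g⁻¹ D₊(x_a x_b)` for all `a` and `b`. As `n` may be negative,
and `x_b / x_a` is a unit there, the negative power is moved to the left-hand side. -/
def twistSections (n : ℤ) (V : X.Opens) : Submodule Γ(X, V) (ChartFun g V) where
  carrier := {s | ∀ a b : Fin (N + 1),
    res (overlap_le_dom g V a b) (transFun g a b) ^ (-n).toNat * res (overlap_le_left g V a b) (s a) =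
      res (overlap_le_dom g V a b) (transFun g a b) ^ n.toNat * res (overlap_le_right g V a b) (s b)}
  add_mem' hs ht a b := by
    simp only [Pi.add_apply, map_add, mul_add, hs a b, ht a b]
  zero_mem' a b := by simp
  smul_mem' r s hs a b := by
    simp only [smul_chartFun, map_mul, res_res]
    rw [mul_left_comm, hs a b, mul_left_comm]

/-- Restriction of families of functions. -/
def resFun {U V : X.Opens} (h : V ≤ U) : ChartFun g U →+* ChartFun g V :=
  RingHom.pi fun a => (res (inf_le_inf_right _ h)).comp (Pi.evalRingHom _ a)

lemma resFun_apply {U V : X.Opens} (h : V ≤ U) (s : ChartFun g U) (a : Fin (N + 1)) :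
    resFun g h s a = res (inf_le_inf_right _ h) (s a) := rfl

lemma resFun_mem (n : ℤ) {U V : X.Opens} (h : V ≤ U) {s : ChartFun g U}
    (hs : s ∈ twistSections g n U) : resFun g h s ∈ twistSections g n V := by
  intro a b
  have := congrArg (res (inf_le_inf_right (dom g a ⊓ dom g b) h)) (hs a b)
  simpa only [map_mul, map_pow, res_res, resFun_apply] using this

/-- The presheaf of abelian groups underlying `𝒪_X(n)`. -/
def twistPresheaf (n : ℤ) : X.Opensᵒᵖ ⥤ Ab.{u} where
  obj V := AddCommGrpCat.of (twistSections g n V.unop)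
  map i := AddCommGrpCat.ofHom
    { toFun s := ⟨resFun g i.unop.le s.1, resFun_mem g n i.unop.le s.2⟩
      map_zero' := Subtype.ext (map_zero _)
      map_add' s t := Subtype.ext (map_add _ s.1 t.1) }
  map_id V := by
    ext s a
    exact res_self _ _
  map_comp i j := by
    ext s a
    exact (res_res _ _ _).symm

lemma twistPresheaf_isSheaf (n : ℤ) : TopCat.Presheaf.IsSheaf (X := X.toTopCat) (twistPresheaf g n) := by
  rw [TopCat.Presheaf.isSheaf_iff_isSheaf_comp (forget Ab)]
  apply TopCat.Presheaf.isSheaf_of_isSheafUniqueGluing_types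
  intro ι W sf hsf
  have hle (i : ι) (a : Fin (N + 1)) : W i ⊓ dom g a ≤ iSup W ⊓ dom g a :=
    inf_le_inf_right _ (le_iSup W i)
  have hcov (U : X.Opens) : iSup W ⊓ U ≤ ⨆ i, W i ⊓ U := by rw [iSup_inf_eq]
  have hglue (a : Fin (N + 1)) : ∃! s : Γ(X, iSup W ⊓ dom g a),
      ∀ i, res (hle i a) s = (sf i).1 a := by
    refine X.sheaf.existsUnique_gluing' (fun i => W i ⊓ dom g a) (iSup W ⊓ dom g a)
      (fun i => homOfLE (hle i a)) (hcov _) (fun i => (sf i).1 a) ?_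
    intro i j
    have h := congrArg (fun s => s.1 a) (hsf i j)
    have h1 : (W i ⊓ dom g a) ⊓ (W j ⊓ dom g a) ≤ (W i ⊓ W j) ⊓ dom g a :=
      le_inf (inf_le_inf inf_le_left inf_le_left) (inf_le_left.trans inf_le_right)
    replace h := congrArg (res h1) h
    change res h1 (res _ ((sf i).1 a)) = res h1 (res _ ((sf j).1 a)) at h
    rw [res_res, res_res] at h
    exact h
  choose s hs hs' using hglue
  have hmem : (s : ChartFun g (iSup W)) ∈ twistSections g n (iSup W) := by
    intro a b
    refine X.sheaf.eq_of_locally_eq' (fun i => W i ⊓ (dom g a ⊓ dom g b)) _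
      (fun i => homOfLE (inf_le_inf_right _ (le_iSup W i))) (hcov _) _ _ fun i => ?_
    have h := (sf i).2 a b
    rw [← hs a i, ← hs b i, res_res, res_res] at h
    change res (inf_le_inf_right _ (le_iSup W i)) _ = res (inf_le_inf_right _ (le_iSup W i)) _
    simp only [map_mul, map_pow, res_res]
    exact h
  refine ⟨⟨s, hmem⟩, fun i => ?_, fun t ht => ?_⟩
  · exact Subtype.ext (funext fun a => hs a i)
  · refine Subtype.ext (funext fun a => hs' a _ fun i => ?_)
    exact congrArg (fun s => s.1 a) (ht i)

/-- The line bundle `𝒪_X(n) = g^* 𝒪(n)` for a morphism `g : X ⟶ ℙ^N`. -/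
def twist (n : ℤ) : X.Modules where
  val :=
    letI (V : X.Opensᵒᵖ) : Module (X.ringCatSheaf.obj.obj V) ((twistPresheaf g n).obj V) :=
      inferInstanceAs (Module Γ(X, V.unop) (twistSections g n V.unop))
    .ofPresheaf (twistPresheaf g n) fun U V i r s => by
      refine Subtype.ext (funext fun a => ?_)
      change res _ (((show Γ(X, U.unop) from r) • s.1) a) =
        ((show Γ(X, V.unop) from X.presheaf.map i r) • resFun g i.unop.le s.1) a
      rw [smul_chartFun, smul_chartFun, map_mul, resFun_apply, res_res]
      congr 1
      exact (res_res _ _ _).symm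
  isSheaf := twistPresheaf_isSheaf g n

/-! ### Section rings -/

/-- The ring homomorphism from `k` to the functions on an open subset of `X`, for the structure
morphism of `X` over `Spec k` which is induced by `g : X ⟶ ℙ^N`. -/
def scalar (V : X.Opens) : k →+* Γ(X, V) :=
  (res le_top).comp
    ((g ≫ PSpace.toSpec k N).appTop.hom.comp (Scheme.ΓSpecIso (.of k)).inv.hom)

lemma res_scalar {U V : X.Opens} (h : V ≤ U) (c : k) : res h (scalar g U c) = scalar g V c :=
  res_res _ _ _

instance (V : X.Opens) : Algebra k (ChartFun g V) :=
  (RingHom.pi fun _ => scalar g _).toAlgebra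

/-- The `k`-vector space `H⁰(X, 𝒪_X(i))`. -/
def sections (i : ℕ) : Submodule k (ChartFun g ⊤) where
  __ := (twistSections g i ⊤).toAddSubmonoid
  smul_mem' c s hs := by
    have : c • s = scalar g ⊤ c • s := by
      funext a
      rw [smul_chartFun, res_scalar, Algebra.smul_def]
      rfl
    rw [this]
    exact (twistSections g i ⊤).smul_mem _ hs

lemma mem_sections {i : ℕ} {s : ChartFun g ⊤} : s ∈ sections g i ↔ ∀ a b : Fin (N + 1),
    res (overlap_le_left g ⊤ a b) (s a) =
      res (overlap_le_dom g ⊤ a b) (transFun g a b) ^ i * res (overlap_le_right g ⊤ a b) (s b) := by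
  refine forall₂_congr fun a b => ?_
  simp

instance : SetLike.GradedMonoid (sections g) where
  one_mem := by
    rw [mem_sections]
    intro a b
    simp
  mul_mem i j s t hs ht := by
    rw [mem_sections] at *
    intro a b
    simp only [Pi.mul_apply, map_mul, hs a b, ht a b]
    ring

/-- The section ring `⊕_{i ≥ 0} H⁰(X, 𝒪_X(i))`, a graded `k`-algebra under multiplication of
sections. -/
abbrev SectionRing : Type u := DirectSum ℕ fun i => sections g i

end Twist

section Relations

variable {k : Type u} [Field k] {N : ℕ} {X Y : Scheme.{u}} (f : X ⟶ Y) (g : Y ⟶ PSpace k N)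

lemma preimage_overlap_le (a : Fin (N + 1)) :
    (⊤ : X.Opens) ⊓ dom (f ≫ g) a ≤ f ⁻¹ᵁ (⊤ ⊓ dom g a) := by
  intro x hx
  exact ⟨trivial, hx.2⟩

/-- Pullback of functions. -/
def pull {U : Y.Opens} {V : X.Opens} (h : V ≤ f ⁻¹ᵁ U) : Γ(Y, U) →+* Γ(X, V) := (f.appLE U V h).hom

lemma pull_res {U U' : Y.Opens} {V : X.Opens} (h : U' ≤ U) (h' : V ≤ f ⁻¹ᵁ U') (s : Γ(Y, U)) :
    pull f h' (res h s) = pull f (h'.trans (f.preimage_mono h)) s := by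
  simp only [pull, res]
  rw [← CommRingCat.comp_apply, Scheme.Hom.map_appLE]

lemma res_pull {U : Y.Opens} {V V' : X.Opens} (h : V ≤ f ⁻¹ᵁ U) (h' : V' ≤ V) (s : Γ(Y, U)) :
    res h' (pull f h s) = pull f (h'.trans h) s := by
  simp only [pull, res]
  rw [← CommRingCat.comp_apply, Scheme.Hom.appLE_map]

lemma pull_scalar {U : Y.Opens} {V : X.Opens} (h : V ≤ f ⁻¹ᵁ U) (c : k) :
    pull f h (scalar g U c) = scalar (f ≫ g) V c := by
  have h1 : ((f ≫ g) ≫ PSpace.toSpec k N).appTop = (g ≫ PSpace.toSpec k N).appTop ≫ f.appTop := by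
    rw [Category.assoc, Scheme.Hom.comp_appTop]
  simp only [scalar, RingHom.comp_apply, pull_res, h1, CommRingCat.hom_comp]
  simp only [pull, res, Scheme.Hom.appLE]
  rfl

lemma pull_transFun (a b : Fin (N + 1)) :
    pull f (le_refl (f ⁻¹ᵁ dom g a)) (transFun g a b) = transFun (f ≫ g) a b := by
  simp only [pull, transFun, ← Scheme.Hom.app_eq_appLE]
  rfl

/-- Pullback of families of functions along `f`. -/
def pullFun : ChartFun g ⊤ →ₐ[k] ChartFun (f ≫ g) ⊤ where
  __ : ChartFun g ⊤ →+* ChartFun (f ≫ g) ⊤ := RingHom.pi fun a =>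
    (pull f (preimage_overlap_le f g a)).comp (Pi.evalRingHom _ a)
  commutes' c := funext fun a => pull_scalar f g (preimage_overlap_le f g a) c

/-- Pullback of sections `H⁰(Y, 𝒪_Y(i)) → H⁰(X, 𝒪_X(i))` along `f`, where
`𝒪_X(i) = f^* 𝒪_Y(i)`. -/
def pullSections (i : ℕ) : sections g i →ₗ[k] sections (f ≫ g) i :=
  (pullFun f g).toLinearMap.restrict fun s hs => by
    rw [mem_sections] at *
    intro a b
    have h : (⊤ : X.Opens) ⊓ (dom (f ≫ g) a ⊓ dom (f ≫ g) b) ≤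
      f ⁻¹ᵁ (⊤ ⊓ (dom g a ⊓ dom g b)) := fun x hx => ⟨trivial, hx.2⟩
    have := congrArg (pull f h) (hs a b)
    rw [map_mul, map_pow, pull_res, pull_res, pull_res] at this
    refine (res_pull f _ (overlap_le_left (f ≫ g) ⊤ a b) (s a)).trans (this.trans ?_)
    refine congrArg₂ (· * ·) (congrArg (· ^ i) ?_)
      (res_pull f _ (overlap_le_right (f ≫ g) ⊤ a b) (s b)).symm
    rw [← pull_transFun f g a b]
    exact (res_pull f _ (overlap_le_dom (f ≫ g) ⊤ a b) (transFun g a b)).symm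

/-- The homomorphism of section rings `⊕ H⁰(Y, 𝒪_Y(i)) → ⊕ H⁰(X, 𝒪_X(i))` induced by `f`. -/
def pullRing : SectionRing g →ₐ[k] SectionRing (f ≫ g) :=
  DirectSum.toAlgebra k _ (fun i => DirectSum.lof k ℕ (fun i => sections (f ≫ g) i) i ∘ₗ
    pullSections f g i)
    (by
      refine (congrArg (DirectSum.of (fun i => sections (f ≫ g) i) 0) ?_).trans rfl
      exact Subtype.ext (map_one (pullFun f g)))
    (by
      intro i j s t
      refine Eq.trans ?_ (DirectSum.of_mul_of (A := fun i => sections (f ≫ g) i) _ _).symm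
      refine congrArg (DirectSum.of (fun i => sections (f ≫ g) i) (i + j)) ?_
      exact Subtype.ext (map_mul (pullFun f g) s.1 t.1))

/-- The algebra `R ⊗_k Sym H⁰(X, 𝒪_X(1))`, where `R` is the section ring of `Y`. -/
abbrev BigRing : Type u := SectionRing g ⊗[k] SymmetricAlgebra k (sections (f ≫ g) 1)

/-- The natural homomorphism from `R ⊗_k Sym H⁰(X, 𝒪_X(1))` to the section ring of `X`. -/
def bigMap : BigRing f g →ₐ[k] SectionRing (f ≫ g) :=
  Algebra.TensorProduct.productMap (pullRing f g)
    (SymmetricAlgebra.lift (DirectSum.lof k ℕ (fun i => sections (f ≫ g) i) 1))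

/-- The part of total degree `d` of `R ⊗_k Sym H⁰(X, 𝒪_X(1))`. -/
def bigPart (d : ℕ) : Submodule k (BigRing f g) :=
  ⨆ p ∈ Finset.HasAntidiagonal.antidiagonal d,
    Submodule.map₂ (TensorProduct.mk k (SectionRing g) (SymmetricAlgebra k (sections (f ≫ g) 1)))
      (LinearMap.range (DirectSum.lof k ℕ (fun i => sections g i) p.1))
      (LinearMap.range (SymmetricAlgebra.ι k (sections (f ≫ g) 1)) ^ p.2)

/-- The ideal `I_X`, the kernel of `R ⊗_k Sym H⁰(X, 𝒪_X(1)) → S`. -/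
def relationIdeal : Ideal (BigRing f g) := RingHom.ker (bigMap f g)

/-- The ideal `I_X` is generated by its homogeneous elements of degree at most `n`. -/
def GeneratedInDegreeLE (n : ℕ) : Prop :=
  Ideal.span {r | r ∈ relationIdeal f g ∧ ∃ d ≤ n, r ∈ bigPart f g d} = relationIdeal f g

end Relations

/-! ### Very ampleness and separating subschemes -/

section Geometry

variable {k : Type u} [Field k] {N : ℕ} {X Y Z : Scheme.{u}}

/-- For `X` projective over `k` with structure morphism `p`, the `𝒪_X`-module `L` is a very ample
line bundle: it is the pullback of `𝒪(1)` under a closed immersion of `X` into some `ℙ^M`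
over `k`. -/
def IsVeryAmple (p : X ⟶ Spec (.of k)) (L : X.Modules) : Prop :=
  ∃ (M : ℕ) (j : X ⟶ PSpace k M), IsClosedImmersion j ∧ j ≫ PSpace.toSpec k M = p ∧
    Nonempty (twist j 1 ≅ L)

/-- The space `H⁰(Y, 𝓘_{Z|Y}(i))` for a closed subscheme `ι : Z ⟶ Y`: the sections of `𝒪_Y(i)`
which lie in the ideal `𝓘_{Z|Y} = ker (𝒪_Y → ι_* 𝒪_Z)` in every chart. -/
def idealSections (g : Y ⟶ PSpace k N) (ι : Z ⟶ Y) (i : ℕ) : Set (ChartFun g ⊤) :=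
  {s | s ∈ sections g i ∧ ∀ a, (ι.app _).hom (s a) = 0}

/-- The closed subscheme `ι : Z ⟶ Y` is `m`-separating: `H⁰(Y, 𝓘_{Z|Y}(i)) = 0` for
`0 ≤ i ≤ m`. -/
def IsSeparating (g : Y ⟶ PSpace k N) (ι : Z ⟶ Y) (m : ℕ) : Prop :=
  ∀ i ≤ m, idealSections g ι i = {0}

end Geometry

/-! ### Sheaves of modules -/

section Modules

variable {X Y Z : Scheme.{u}}

/-- The structure sheaf as an `𝒪_X`-module. -/
def structureModule (X : Scheme.{u}) : X.Modules := SheafOfModules.unit X.ringCatSheaf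

/-- Coherent sheaves. As all schemes below are Noetherian, these are the `𝒪_X`-modules which
locally have a finite presentation. -/
def IsCoherent (F : X.Modules) : Prop := SheafOfModules.IsFinitePresentation.{u} F

/-- The presheaf tensor product `U ↦ M(U) ⊗ N(U)`. -/
def tensorPresheaf (M N : X.Modules) : X.PresheafOfModules :=
  PresheafOfModules.Monoidal.tensorObj (R := X.presheaf) M.val N.val

/-- The tensor product `M ⊗ N` of `𝒪_X`-modules, the sheaf associated to `U ↦ M(U) ⊗ N(U)`. -/
def tensor (M N : X.Modules) : X.Modules :=
  (PresheafOfModules.sheafification (𝟙 X.ringCatSheaf.obj)).obj (tensorPresheaf M N)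

/-- The section `m ⊗ n` of `M ⊗ N`. -/
def tmul {M N : X.Modules} {U : X.Opens} (m : Γ(M, U)) (n : Γ(N, U)) : Γ(tensor M N, U) :=
  (((PresheafOfModules.sheafificationAdjunction (𝟙 X.ringCatSheaf.obj)).unit.app
    (tensorPresheaf M N)).app (op U)).hom
      (TensorProduct.tmul Γ(X, U) (M := Γ(M, U)) (N := Γ(N, U)) m n)

/-- `E` lifts to `X` via `f : X ⟶ Y`: it is the direct image of a coherent sheaf on `X`. -/
def Lifts (f : X ⟶ Y) (E : Y.Modules) : Prop :=
  ∃ F : X.Modules, IsCoherent F ∧ Nonempty ((Scheme.Modules.pushforward f).obj F ≅ E)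

/-- Restriction of a section of `E` to a section of `E|_Z = ι^* E`. -/
def restrictSection (ι : Z ⟶ Y) (E : Y.Modules) (U : Y.Opens) :
    Γ(E, U) → Γ((Scheme.Modules.pullback ι).obj E, ι ⁻¹ᵁ U) :=
  ((Scheme.Modules.pullbackPushforwardAdjunction ι).unit.app E).app U

/-- For an `𝒪_X`-module `F` with `φ : f_* F ≅ E`, the associated module structure
`f_* 𝒪_X × E → E` over the open subset `U`. -/
def action (f : X ⟶ Y) {F : X.Modules} {E : Y.Modules}
    (φ : (Scheme.Modules.pushforward f).obj F ≅ E) (U : Y.Opens)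
    (s : Γ(X, f ⁻¹ᵁ U)) (e : Γ(E, U)) : Γ(E, U) :=
  φ.hom.app U
    (show Γ((Scheme.Modules.pushforward f).obj F, U) from
      s • (show Γ(F, f ⁻¹ᵁ U) from φ.inv.app U e))

lemma preimage_fst_snd (f : X ⟶ Y) (ι : Z ⟶ Y) (U : Y.Opens) :
    Limits.pullback.snd f ι ⁻¹ᵁ ι ⁻¹ᵁ U ≤ Limits.pullback.fst f ι ⁻¹ᵁ f ⁻¹ᵁ U := by
  rw [← Scheme.Hom.comp_preimage, ← Scheme.Hom.comp_preimage, Limits.pullback.condition]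

/-- Write `X_Z = X ×_Y Z` and `f_Z : X_Z ⟶ Z`. For an `𝒪`-module `F` on `X_Z` with
`φ : (f_Z)_* F ≅ E|_Z`, the associated morphism `(f_Z)_* 𝒪_{X_Z} ⊗ E|_Z → E|_Z` is the restriction
to `Z` of `α : f_* 𝒪_X ⊗ E → E`. Since `(f_Z)_* 𝒪_{X_Z}` and `E|_Z` are locally generated over
`𝒪_Z` by restrictions of sections of `f_* 𝒪_X` and `E`, this is tested on such sections. -/
def IsRestrictionOf (f : X ⟶ Y) (ι : Z ⟶ Y) (E : Y.Modules)
    {F : (Limits.pullback f ι).Modules}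
    (φ : (Scheme.Modules.pushforward (Limits.pullback.snd f ι)).obj F ≅
      (Scheme.Modules.pullback ι).obj E)
    (α : tensor ((Scheme.Modules.pushforward f).obj (structureModule X)) E ⟶ E) : Prop :=
  ∀ (U : Y.Opens) (s : Γ(X, f ⁻¹ᵁ U)) (e : Γ(E, U)),
    action (Limits.pullback.snd f ι) φ (ι ⁻¹ᵁ U)
        (pull (Limits.pullback.fst f ι) (preimage_fst_snd f ι U) s) (restrictSection ι E U e) =
      restrictSection ι E U
        (α.app U (tmul (M := (Scheme.Modules.pushforward f).obj (structureModule X)) s e))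

/-- Condition on a closed subscheme `ι : Z ⟶ Y`: the restriction `E|_Z` lifts to `X_Z = X ×_Y Z`,
in such a way that the associated `(f_Z)_* 𝒪_{X_Z}`-module structure on `E|_Z` is the restriction
to `Z` of an `𝒪_Y`-linear morphism `f_* 𝒪_X ⊗ E → E`. -/
def RestrictionLifts (f : X ⟶ Y) (ι : Z ⟶ Y) (E : Y.Modules) : Prop :=
  ∃ (F : (Limits.pullback f ι).Modules)
    (φ : (Scheme.Modules.pushforward (Limits.pullback.snd f ι)).obj F ≅
      (Scheme.Modules.pullback ι).obj E)
    (α : tensor ((Scheme.Modules.pushforward f).obj (structureModule X)) E ⟶ E),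
    IsCoherent F ∧ IsRestrictionOf f ι E φ α

end Modules

instance (Y : Scheme.{u}) : Limits.HasFiniteBiproducts Y.Modules :=
  Limits.HasFiniteBiproducts.of_hasFiniteProducts

/-- The dissocié sheaf `⊕_j 𝒪_Y(-a_j)`. -/
def dissocie {k : Type u} [Field k] {N : ℕ} {Y : Scheme.{u}} (g : Y ⟶ PSpace k N) {t : ℕ}
    (a : Fin t → ℤ) : Y.Modules :=
  ⨁ fun j => twist g (-a j)

/-- The natural number `max_{i, j} (a_i - a_j) = max_j a_j - min_j a_j`. -/
def spread {t : ℕ} (a : Fin t → ℤ) : ℕ :=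
  Finset.univ.sup fun p : Fin t × Fin t => (a p.1 - a p.2).toNat

end FiniteFlatLift

end

open FiniteFlatLift

noncomputable section

namespace FiniteFlatLift

/-! ### Charts and coordinate ratios of projective space. -/

variable (k : Type u) [Field k] (N : ℕ)

/-! All sheaves are turned into lattices in vector spaces over the function field K(Y). Fix a
homogeneous coordinate x_o that does not vanish at the generic point of Y. Dividing by powers of x_o
identifies sections of E = ⊕ 𝒪_Y(-a_j) with vectors in K(Y)^t (`coord`). The morphism α then
attaches to each section v of 𝒪_X(1) an endomorphism B_v of K(Y)^t (`sectionOp`), which maps E to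
E(1) and induces multiplication by v on E|_Z. Nothing says that α is associative on Y; on Z its
restriction is, because there it comes from a sheaf on X_Z.

Separation carries identities from Z to Y. If an operator maps E to E(d) and induces zero on E|_Z,
its (i, j) entry is a section of 𝓘_Z(d + a_j - a_i), hence vanishes as soon as d + max(a_i - a_j) is
at most the separation bound (`LiftsMul.eq_zero`). For d = 2 this applies to commutators, so the B_v
commute (`sectionOp_mul_comm`) and R ⊗ Sym H⁰(X, 𝒪_X(1)) acts on K(Y)^t. For d ≤ n_X it applies to
the generators of I_X, so this action factors through the image in S. By very ampleness the
quotients v / x_o generate K(X) over K(Y), and the action extends to K(X) (`exists_fieldAction`).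

It remains to see that f_* 𝒪_X preserves the lattice E. Over a chart the stabilizer of E is a
subring that contains the functions on Y and the values of all v, and over which every function is
integral; very ampleness forces it to be everything (`subring_eq_top`, `stabilizer_eq_top`). The
lift consists of the vectors which, near each point x of X, enter E after multiplication by a
function that is nonzero at x (`liftModule`). Lying over shows that its direct image is E
(`isSection_of_isNear`, `isIso_toLift`), and clearing denominators shows that it is coherent
(`isCoherent_liftModule`).

The existence of n_X is a separate matter: R ⊗ Sym is Noetherian because R is finitely generated and
H⁰(X, 𝒪_X(1)) is finite-dimensional. Both follow from `exists_finset_span_sectionRing`: the section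
ring embeds in the function field of the cone, valuations show that it is integral over k[x_0, …,
x_N], and in characteristic zero the integral closure is a finite module. -/

lemma X_mem_grading (a : Fin (N + 1)) : MvPolynomial.X a ∈ grading k N 1 :=
  MvPolynomial.isHomogeneous_X k a

lemma X_mem_grading' (a : Fin (N + 1)) : MvPolynomial.X a ∈ grading k N (1 • 1) :=
  MvPolynomial.isHomogeneous_X k a

lemma adjoin_X_grading : Algebra.adjoin (grading k N 0)
    (Set.range (MvPolynomial.X : Fin (N + 1) → MvPolynomial (Fin (N + 1)) k)) = ⊤ := by
  rw [eq_top_iff]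
  intro p _
  induction p using MvPolynomial.induction_on with
  | C c =>
    exact Subalgebra.algebraMap_mem (A := MvPolynomial (Fin (N + 1)) k) _
      (⟨MvPolynomial.C c, MvPolynomial.isHomogeneous_C _ c⟩ : grading k N 0)
  | add p q hp hq => exact add_mem (hp trivial) (hq trivial)
  | mul_X p a hp => exact mul_mem (hp trivial) (Algebra.subset_adjoin ⟨a, rfl⟩)

lemma surjective_algebraMap_grading_zero :
    Function.Surjective (algebraMap k (grading k N 0)) := by
  rintro ⟨p, hp⟩
  refine ⟨p.coeff 0, Subtype.ext ?_⟩
  exact (MvPolynomial.totalDegree_eq_zero_iff_eq_C.mp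
    (MvPolynomial.IsHomogeneous.totalDegree_le hp |> Nat.le_zero.mp)).symm

lemma iSup_chart : ⨆ a, chart k N a = ⊤ :=
  Proj.iSup_basicOpen_eq_top' (grading k N) _
    (fun a => ⟨1, X_mem_grading k N a⟩) (adjoin_X_grading k N)

lemma isAffineOpen_chart (a : Fin (N + 1)) : IsAffineOpen (chart k N a) :=
  Proj.isAffineOpen_basicOpen (grading k N) (MvPolynomial.X a) (X_mem_grading k N a) one_pos

/-- Functions on Proj are families of elements of homogeneous localisations, so identities between
ratios are checked one prime at a time with this value. -/
lemma ratio_val (a b : Fin (N + 1)) (p : ProjectiveSpectrum (grading k N))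
    (hp : MvPolynomial.X a ∈ p.asHomogeneousIdeal.toIdeal.primeCompl) :
    ((ratio k N a b).val ⟨p, hp⟩).val =
      Localization.mk (MvPolynomial.X b) (⟨MvPolynomial.X a, hp⟩ :
        p.asHomogeneousIdeal.toIdeal.primeCompl) := by
  refine (ProjectiveSpectrum.Proj.awayToSection_apply (𝒜 := grading k N) (MvPolynomial.X a)
    (HomogeneousLocalization.Away.mk (grading k N) (X_mem_grading k N a) 1
      (MvPolynomial.X b) (by simpa using X_mem_grading k N b))
    (⟨p, hp⟩ : ProjectiveSpectrum.basicOpen (grading k N) (MvPolynomial.X a))).trans ?_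
  refine (congrArg _ (HomogeneousLocalization.Away.val_mk (𝒜 := grading k N) 1
    (X_mem_grading k N a) (MvPolynomial.X b)
    (by simpa using X_mem_grading k N b))).trans ?_
  rw [Localization.mk_eq_mk', IsLocalization.map_mk', ← Localization.mk_eq_mk']
  congr 1
  exact Subtype.ext (pow_one _)

lemma ratio_self (a : Fin (N + 1)) : ratio k N a a = 1 := by
  apply Subtype.ext
  funext p
  apply HomogeneousLocalization.val_injective
  obtain ⟨p, hp⟩ : { p : ProjectiveSpectrum (grading k N) //
    MvPolynomial.X a ∈ p.asHomogeneousIdeal.toIdeal.primeCompl } := p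
  refine (ratio_val k N a a p hp).trans ((Localization.mk_self
    (⟨MvPolynomial.X a, hp⟩ : p.asHomogeneousIdeal.toIdeal.primeCompl)).trans ?_)
  exact HomogeneousLocalization.val_one.symm

lemma ratio_cocycle (a b c : Fin (N + 1)) :
    res (inf_le_left : chart k N a ⊓ chart k N b ≤ _) (ratio k N a b) *
      res inf_le_right (ratio k N b c) = res inf_le_left (ratio k N a c) := by
  apply Subtype.ext
  funext p
  apply HomogeneousLocalization.val_injective
  have h1 : p.1 ∈ chart k N a := p.2.1
  have h2 : p.1 ∈ chart k N b := p.2.2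
  refine (HomogeneousLocalization.val_mul _ _).trans ?_
  change ((ratio k N a b).val ⟨p.1, h1⟩).val * ((ratio k N b c).val ⟨p.1, h2⟩).val =
    ((ratio k N a c).val ⟨p.1, h1⟩).val
  rw [ratio_val k N a b p.1 h1, ratio_val k N b c p.1 h2, ratio_val k N a c p.1 h1,
    Localization.mk_mul, Localization.mk_eq_mk_iff, Localization.r_iff_exists]
  refine ⟨1, ?_⟩
  simp
  ring

lemma isUnit_res_ratio (a b : Fin (N + 1)) :
    IsUnit (res (inf_le_left : chart k N a ⊓ chart k N b ≤ _) (ratio k N a b)) := by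
  refine IsUnit.of_mul_eq_one (res inf_le_right (ratio k N b a)) ?_
  rw [ratio_cocycle, ratio_self, map_one]

lemma basicOpen_ratio (a b : Fin (N + 1)) :
    (PSpace k N).basicOpen (ratio k N a b) = chart k N a ⊓ chart k N b := by
  refine le_antisymm ?_ ?_
  · intro (x : ProjectiveSpectrum (grading k N)) hx
    have hxa : x ∈ chart k N a := (PSpace k N).basicOpen_le _ hx
    refine ⟨hxa, fun hb => ?_⟩
    obtain ⟨t, ht⟩ := (RingedSpace.isUnit_res_basicOpen (PSpace k N).toRingedSpace
      (ratio k N a b)).exists_right_inv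
    have h := congrArg HomogeneousLocalization.val (congrFun (congrArg Subtype.val ht) ⟨x, hx⟩)
    replace h := (HomogeneousLocalization.val_mul _ _).symm.trans (h.trans HomogeneousLocalization.val_one)
    change ((ratio k N a b).val ⟨x, hxa⟩).val * _ = 1 at h
    rw [ratio_val k N a b x hxa] at h
    have h3 := IsUnit.of_mul_eq_one _ h
    rw [Localization.mk_eq_mk', IsLocalization.AtPrime.isUnit_mk'_iff _ x.asHomogeneousIdeal.toIdeal] at h3
    exact h3 hb
  · intro x hx
    have h2 := (PSpace k N).basicOpen_of_isUnit (isUnit_res_ratio k N a b)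
    have := (PSpace k N).basicOpen_res (ratio k N a b) (homOfLE (inf_le_left : chart k N a ⊓ chart k N b ≤ _)).op
    rw [show (PSpace k N).basicOpen (res (inf_le_left : chart k N a ⊓ chart k N b ≤ _) (ratio k N a b)) = _ from this] at h2
    rw [← h2] at hx
    exact hx.2

lemma Proj.ι_toSpecZero {σ A : Type u} [CommRing A] [SetLike σ A] [AddSubgroupClass σ A]
    (𝒜 : ℕ → σ) [GradedRing 𝒜] {f : A} (hf : f ∈ 𝒜 1) :
    (Proj.basicOpen 𝒜 f).ι ≫ Proj.toSpecZero 𝒜 = Proj.basicOpenToSpec 𝒜 f ≫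
      Spec.map (CommRingCat.ofHom (HomogeneousLocalization.fromZeroRingHom 𝒜 _)) := by
  rw [← Proj.awayι_toSpecZero 𝒜 f hf one_pos, ← Proj.basicOpenIsoSpec_inv_ι,
    ← Proj.basicOpenIsoSpec_hom 𝒜 f hf one_pos, Category.assoc, Iso.hom_inv_id_assoc]

lemma Proj.ι_toSpec_app {σ A : Type u} [CommRing A] [SetLike σ A] [AddSubgroupClass σ A]
    (𝒜 : ℕ → σ) [GradedRing 𝒜] {f : A} (hf : f ∈ 𝒜 1) {k : Type u} [CommRing k] (φ : k →+* 𝒜 0) :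
    (Scheme.ΓSpecIso (.of k)).inv ≫
      (Proj.toSpecZero 𝒜 ≫ Spec.map (CommRingCat.ofHom φ)).appTop ≫
        (Proj.basicOpen 𝒜 f).ι.appTop ≫ (Proj.basicOpen 𝒜 f).topIso.hom =
      CommRingCat.ofHom φ ≫ CommRingCat.ofHom (HomogeneousLocalization.fromZeroRingHom 𝒜 _) ≫
        Proj.awayToSection 𝒜 f := by
  have h4 : (Proj.basicOpenToSpec 𝒜 f).appTop = _ := Proj.basicOpenToSpec_app_top 𝒜 f
  rw [← Scheme.Hom.comp_appTop_assoc, ← Category.assoc (Proj.basicOpen 𝒜 f).ι,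
    Proj.ι_toSpecZero 𝒜 hf]
  simp only [Scheme.Hom.comp_appTop, Category.assoc, h4, Iso.inv_hom_id, Category.comp_id]
  rw [← Scheme.ΓSpecIso_inv_naturality_assoc, ← Scheme.ΓSpecIso_inv_naturality_assoc,
    Iso.inv_hom_id_assoc]

/-- Constants are defined through the structure morphism to Spec k. They have to be matched with the
constants of the degree-zero localisation before `closure_chart` can use the algebraic generators of
the latter. -/
lemma scalar_id_chart (a : Fin (N + 1)) (c : k) : scalar (𝟙 (PSpace k N)) (chart k N a) c =
    (Proj.awayToSection (grading k N) (MvPolynomial.X a)).hom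
      (HomogeneousLocalization.fromZeroRingHom (grading k N) _ (algebraMap k (grading k N 0) c)) := by
  refine Eq.trans ?_ (congrArg (fun φ => φ.hom c) (Proj.ι_toSpec_app (grading k N)
    (X_mem_grading k N a) (algebraMap k (grading k N 0))))
  have h : (chart k N a).ι.appTop ≫ (chart k N a).topIso.hom =
      (PSpace k N).presheaf.map (homOfLE le_top).op := by
    rw [Scheme.Opens.ι_appTop, Scheme.Opens.topIso_hom]
    exact ((PSpace k N).presheaf.map_comp _ _).symm
  have h' : (chart k N a).topIso.hom.hom ((chart k N a).ι.appTop.hom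
      ((PSpace.toSpec k N).appTop.hom ((Scheme.ΓSpecIso (.of k)).inv.hom c))) = res le_top
      ((PSpace.toSpec k N).appTop.hom ((Scheme.ΓSpecIso (.of k)).inv.hom c)) :=
    congrArg (fun φ => φ.hom ((PSpace.toSpec k N).appTop.hom ((Scheme.ΓSpecIso (.of k)).inv.hom c))) h
  refine Eq.trans ?_ h'.symm
  simp only [scalar, Category.id_comp, RingHom.comp_apply]

lemma Away_mk_prod (a : Fin (N + 1)) (n : ℕ) (m : Fin (N + 1) → ℕ) (hm : ∑ i, m i = n)
    (h : ∏ i, MvPolynomial.X i ^ m i ∈ grading k N (n • 1)) :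
    HomogeneousLocalization.Away.mk (grading k N) (X_mem_grading k N a) n
        (∏ i, MvPolynomial.X i ^ m i) h =
      ∏ i, HomogeneousLocalization.Away.mk (grading k N) (X_mem_grading k N a) 1
          (MvPolynomial.X i) (X_mem_grading' k N i) ^ m i := by
  apply HomogeneousLocalization.val_injective
  rw [HomogeneousLocalization.Away.val_mk, ← HomogeneousLocalization.algebraMap_apply, map_prod]
  simp only [map_pow, HomogeneousLocalization.algebraMap_apply,
    HomogeneousLocalization.Away.val_mk, Localization.mk_pow, Localization.mk_prod]
  congr 1
  apply Subtype.ext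
  simp [Finset.prod_pow_eq_pow_sum, hm]

/-- The degree-zero part of k[x] localised at x_a is generated over its constants by monomials
divided by powers of x_a, and these are products of the ratios x_b / x_a. -/
lemma closure_chart (a : Fin (N + 1)) :
    Subring.closure (Set.range (scalar (𝟙 (PSpace k N)) (chart k N a)) ∪ Set.range (ratio k N a)) = ⊤ := by
  rw [eq_top_iff]
  intro s _
  have hiso : Function.Surjective (Proj.awayToSection (grading k N) (MvPolynomial.X a)).hom := by
    have : IsIso (Proj.awayToSection (grading k N) (MvPolynomial.X a)) := by
      rw [← Proj.basicOpenIsoAway_hom (grading k N) (MvPolynomial.X a) (X_mem_grading k N a) one_pos]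
      infer_instance
    exact (ConcreteCategory.bijective_of_isIso (Proj.awayToSection (grading k N) (MvPolynomial.X a))).2
  obtain ⟨z, rfl⟩ := hiso s
  have hz := HomogeneousLocalization.Away.adjoin_mk_prod_pow_eq_top (𝒜 := grading k N)
    (X_mem_grading k N a) (Fin (N + 1)) MvPolynomial.X (adjoin_X_grading k N)
    (fun _ => 1) (fun b => X_mem_grading k N b)
  replace hz := hz.ge (Algebra.mem_top (x := z))
  induction hz using Algebra.adjoin_induction with
  | mem x hx =>
    obtain ⟨n, m, hm, _, rfl⟩ := hx
    rw [Away_mk_prod k N a n m (by simpa using hm), map_prod]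
    refine prod_mem fun i _ => ?_
    rw [map_pow]
    have hi : ratio k N a i ∈ Subring.closure (Set.range (scalar (𝟙 (PSpace k N)) (chart k N a)) ∪
        Set.range (ratio k N a)) := Subring.subset_closure (Or.inr ⟨i, rfl⟩)
    exact pow_mem hi _
  | algebraMap r =>
    obtain ⟨c, hc⟩ := surjective_algebraMap_grading_zero k N r
    refine Subring.subset_closure (Or.inl ⟨c, ?_⟩)
    rw [scalar_id_chart, hc]
    rfl
  | add x y _ _ hx hy => rw [map_add]; exact add_mem (hx trivial) (hy trivial)
  | mul x y _ _ hx hy => rw [map_mul]; exact mul_mem (hx trivial) (hy trivial)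
-- Charts and ratios pulled back to a scheme over projective space.
section Pullback

variable {k N} {Y : Scheme.{u}} (g : Y ⟶ PSpace k N)

lemma iSup_dom : ⨆ a, dom g a = ⊤ := by
  have := congrArg (fun U => g ⁻¹ᵁ U) (iSup_chart k N)
  rwa [Scheme.Hom.preimage_iSup] at this

lemma exists_mem_dom (y : Y) : ∃ a, y ∈ dom g a := by
  have : y ∈ (⨆ a, dom g a) := by rw [iSup_dom]; trivial
  simpa using this

lemma isAffineOpen_dom [IsAffineHom g] (a : Fin (N + 1)) : IsAffineOpen (dom g a) :=
  (isAffineOpen_chart k N a).preimage g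

lemma transFun_self (a : Fin (N + 1)) : transFun g a a = 1 := by
  rw [transFun, ratio_self]
  exact map_one _

lemma res_app {U V : (PSpace k N).Opens} (h : V ≤ U) (s : Γ(PSpace k N, U)) :
    res (g.preimage_mono h) ((g.app U).hom s) = (g.app V).hom (res h s) := by
  simp only [res, ← CommRingCat.comp_apply]
  rw [g.naturality]
  rfl

lemma transFun_cocycle {U : Y.Opens} (a b c : Fin (N + 1)) (ha : U ≤ dom g a) (hb : U ≤ dom g b) :
    res ha (transFun g a b) * res hb (transFun g b c) = res ha (transFun g a c) := by
  have hU : U ≤ g ⁻¹ᵁ (chart k N a ⊓ chart k N b) := le_inf ha hb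
  have h := congrArg (fun s => res hU ((g.app _).hom s)) (ratio_cocycle k N a b c)
  rw [map_mul, map_mul, ← res_app, ← res_app, ← res_app, res_res, res_res, res_res] at h
  exact h

lemma basicOpen_transFun (a b : Fin (N + 1)) :
    Y.basicOpen (transFun g a b) = dom g a ⊓ dom g b := by
  have := g.preimage_basicOpen (ratio k N a b)
  rw [basicOpen_ratio] at this
  exact this.symm

lemma app_scalar (U : (PSpace k N).Opens) (c : k) :
    (g.app U).hom (scalar (𝟙 (PSpace k N)) U c) = scalar g (g ⁻¹ᵁ U) c := by
  have := pull_scalar g (𝟙 (PSpace k N)) (le_refl (g ⁻¹ᵁ U)) c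
  rw [Category.comp_id] at this
  simpa only [pull, ← Scheme.Hom.app_eq_appLE] using this

/-- A closed immersion is surjective on functions over an affine open, so generators of the chart
ring of projective space restrict to generators. -/
lemma closure_dom [IsClosedImmersion g] (a : Fin (N + 1)) :
    Subring.closure (Set.range (scalar g (dom g a)) ∪ Set.range (transFun g a)) = ⊤ := by
  have hsurj : Function.Surjective (g.app (chart k N a)).hom :=
    g.app_surjective _ (isAffineOpen_chart k N a)
  have h := congrArg (Subring.map (g.app (chart k N a)).hom) (closure_chart k N a)
  rw [RingHom.map_closure, ← RingHom.range_eq_map, RingHom.range_eq_top.mpr hsurj] at h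
  rw [Set.image_union, ← Set.range_comp, ← Set.range_comp] at h
  have h1 : (g.app (chart k N a)).hom ∘ (scalar (𝟙 (PSpace k N)) (chart k N a)) =
    scalar g (g ⁻¹ᵁ chart k N a) := funext (app_scalar g _)
  rw [h1] at h
  exact h

end Pullback

/-! ### Germs at the generic point -/

section Generic

variable {X : Scheme.{u}}

lemma mem_inf {U V : X.Opens} {x : X} (hU : x ∈ U) (hV : x ∈ V) : x ∈ U ⊓ V := ⟨hU, hV⟩

variable [IsIntegral X]

/-- The germ of a function at the generic point. -/
def gen (U : X.Opens) (hU : genericPoint X ∈ U) : Γ(X, U) →+* X.functionField :=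
  (X.presheaf.germ U _ hU).hom

lemma genericPoint_mem {U : X.Opens} {x : X} (hx : x ∈ U) : genericPoint X ∈ U :=
  ((genericPoint_spec X).mem_open_set_iff U.isOpen).mpr ⟨x, trivial, hx⟩

lemma gen_res {U V : X.Opens} (h : V ≤ U) (hV : genericPoint X ∈ V) (s : Γ(X, U)) :
    gen V hV (res h s) = gen U (h hV) s :=
  X.presheaf.germ_res_apply (homOfLE h) _ hV s

lemma gen_injective {U : X.Opens} (hU : genericPoint X ∈ U) : Function.Injective (gen U hU) :=
  germ_injective_of_isIntegral _ _ _

lemma subsingleton_sections {U : X.Opens} (hU : genericPoint X ∉ U) : Subsingleton Γ(X, U) := by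
  have : U = ⊥ := by
    ext x
    simp only [Opens.coe_bot, Set.mem_empty_iff_false, iff_false]
    exact fun hx => hU (genericPoint_mem hx)
  subst this
  infer_instance

/-- An open subset without the generic point is empty and has the zero ring of functions.
Quantifying over the membership proof therefore covers empty overlaps without a separate case. -/
lemma eq_of_gen {U : X.Opens} {s t : Γ(X, U)} (h : ∀ hU, gen U hU s = gen U hU t) : s = t := by
  by_cases hU : genericPoint X ∈ U
  · exact gen_injective hU (h hU)
  · have := subsingleton_sections hU
    exact Subsingleton.elim _ _

lemma isFractionRing_gen {U : X.Opens} (hU : IsAffineOpen U) (h : genericPoint X ∈ U) :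
    letI := (gen U h).toAlgebra
    IsFractionRing Γ(X, U) X.functionField := by
  have : Nonempty U := ⟨⟨_, h⟩⟩
  exact functionField_isFractionRing_of_isAffineOpen X U hU

lemma exists_gen_div {U : X.Opens} (hU : IsAffineOpen U) (h : genericPoint X ∈ U)
    (x : X.functionField) : ∃ s t : Γ(X, U), gen U h t ≠ 0 ∧ x * gen U h t = gen U h s := by
  have : Nonempty U := ⟨⟨_, h⟩⟩
  let := (gen U h).toAlgebra
  have := isFractionRing_gen hU h
  obtain ⟨⟨s, t⟩, hst⟩ := IsLocalization.surj (nonZeroDivisors Γ(X, U)) x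
  refine ⟨s, t, ?_, hst⟩
  exact IsFractionRing.to_map_ne_zero_of_mem_nonZeroDivisors (K := X.functionField) t.2

end Generic

/-! ### Sections of 𝒪(n) as rational functions. -/

section Coordinates

variable {k : Type u} [Field k] {N : ℕ} {X : Scheme.{u}} [IsIntegral X] (g : X ⟶ PSpace k N)

/-- The rational function `x_a / x_o` on `X`. -/
def tau {o : Fin (N + 1)} (ho : genericPoint X ∈ dom g o) (a : Fin (N + 1)) : X.functionField :=
  gen (dom g o) ho (transFun g o a)

variable {o : Fin (N + 1)} (ho : genericPoint X ∈ dom g o)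

lemma tau_self : tau g ho o = 1 := by rw [tau, transFun_self, map_one]

lemma tau_mul_gen {a : Fin (N + 1)} (ha : genericPoint X ∈ dom g a) (b : Fin (N + 1)) :
    tau g ho a * gen (dom g a) ha (transFun g a b) = tau g ho b := by
  have h : genericPoint X ∈ dom g o ⊓ dom g a := mem_inf ho ha
  have := congrArg (gen _ h) (transFun_cocycle g o a b inf_le_left inf_le_right)
  rwa [map_mul, gen_res, gen_res, gen_res] at this

lemma tau_ne_zero {a : Fin (N + 1)} (ha : genericPoint X ∈ dom g a) : tau g ho a ≠ 0 := by
  intro h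
  have := tau_mul_gen g ho ha o
  rw [h, zero_mul, tau_self] at this
  exact zero_ne_one this

lemma tau_eq_zero {a : Fin (N + 1)} (ha : genericPoint X ∉ dom g a) : tau g ho a = 0 := by
  by_contra h
  have h1 : IsUnit (gen _ ho (transFun g o a)) := isUnit_iff_ne_zero.mpr h
  have h2 : genericPoint X ∈ X.basicOpen (transFun g o a) :=
    (X.mem_basicOpen (transFun g o a) _ ho).mpr h1
  rw [basicOpen_transFun] at h2
  exact ha h2.2

lemma exists_genericPoint_mem_dom : ∃ o, genericPoint X ∈ dom g o := exists_mem_dom g _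

/-- The rational function `s / x_o ^ n` attached to a section `s` of `𝒪_X(n)`. -/
def rat {U : X.Opens} (hU : genericPoint X ∈ U) (s : ChartFun g U) : X.functionField :=
  gen (U ⊓ dom g o) (mem_inf hU ho) (s o)

section rat

variable {U : X.Opens} (hU : genericPoint X ∈ U)

lemma rat_add (s t : ChartFun g U) : rat g ho hU (s + t) = rat g ho hU s + rat g ho hU t :=
  map_add _ _ _

lemma rat_mul (s t : ChartFun g U) : rat g ho hU (s * t) = rat g ho hU s * rat g ho hU t :=
  map_mul _ _ _

lemma rat_zero : rat g ho hU 0 = 0 := map_zero _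

lemma rat_one : rat g ho hU 1 = 1 := map_one _

lemma rat_smul (r : Γ(X, U)) (s : ChartFun g U) :
    rat g ho hU (r • s) = gen U hU r * rat g ho hU s := by
  rw [rat, smul_chartFun, map_mul, gen_res, rat]

lemma rat_resFun {V : X.Opens} (h : V ≤ U) (hV : genericPoint X ∈ V) (s : ChartFun g U) :
    rat g ho hV (resFun g h s) = rat g ho (h hV) s := by
  rw [rat, resFun_apply, gen_res, rat]

/-- This is the change of trivialisation from x_o to x_a, read at the generic point. -/
lemma rat_eq {n : ℤ} {s : ChartFun g U} (hs : s ∈ twistSections g n U) {a : Fin (N + 1)}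
    (ha : genericPoint X ∈ dom g a) :
    rat g ho hU s = tau g ho a ^ n * gen (U ⊓ dom g a) (mem_inf hU ha) (s a) := by
  have h : genericPoint X ∈ U ⊓ (dom g o ⊓ dom g a) := mem_inf hU (mem_inf ho ha)
  have := congrArg (gen _ h) (hs o a)
  simp only [map_mul, map_pow, gen_res] at this
  have h0 := tau_ne_zero g ho ha
  change tau g ho a ^ _ * rat g ho hU s = tau g ho a ^ _ * _ at this
  -- The gluing condition splits the exponent n into its positive and negative parts; in the
  -- function field they recombine.
  have h1 : tau g ho a ^ n = (tau g ho a ^ (-n).toNat)⁻¹ * tau g ho a ^ n.toNat := by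
    rw [← zpow_natCast, ← zpow_natCast, ← zpow_neg, ← zpow_add₀ h0]
    congr 1
    omega
  rw [h1, mul_assoc, ← this, inv_mul_cancel_left₀ (pow_ne_zero _ h0)]

/-- The converse of `rat_eq`: local functions that all describe one rational function κ in their
trivialisations glue automatically. Charts that miss the generic point impose nothing. -/
lemma mem_twistSections_of_rat {n : ℤ} {s : ChartFun g U} {κ : X.functionField}
    (h : ∀ a (ha : genericPoint X ∈ dom g a) (hU : genericPoint X ∈ U),
      κ = tau g ho a ^ n * gen (U ⊓ dom g a) (mem_inf hU ha) (s a)) : s ∈ twistSections g n U := by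
  intro a b
  refine eq_of_gen fun hη => ?_
  simp only [map_mul, map_pow, gen_res]
  have h1 := h a hη.2.1 hη.1
  have h2 := h b hη.2.2 hη.1
  have ha0 := tau_ne_zero g ho hη.2.1
  have hb0 := tau_ne_zero g ho hη.2.2
  have h3 : gen (dom g a) hη.2.1 (transFun g a b) = tau g ho b * (tau g ho a)⁻¹ := by
    rw [← tau_mul_gen g ho hη.2.1 b, mul_comm, inv_mul_cancel_left₀ ha0]
  rw [h3]
  have h4 : gen (U ⊓ dom g a) (mem_inf hη.1 hη.2.1) (s a) = tau g ho a ^ (-n) * κ := by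
    rw [h1, ← mul_assoc, ← zpow_add₀ ha0, neg_add_cancel, zpow_zero, one_mul]
  have h5 : gen (U ⊓ dom g b) (mem_inf hη.1 hη.2.2) (s b) = tau g ho b ^ (-n) * κ := by
    rw [h2, ← mul_assoc, ← zpow_add₀ hb0, neg_add_cancel, zpow_zero, one_mul]
  rw [h4, h5, ← mul_assoc, ← mul_assoc]
  congr 1
  have h6 : (n.toNat : ℤ) = n + (-n).toNat := by omega
  have h7 : (tau g ho b * (tau g ho a)⁻¹) ^ n.toNat =
      (tau g ho b * (tau g ho a)⁻¹) ^ n * (tau g ho b * (tau g ho a)⁻¹) ^ (-n).toNat := by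
    rw [← zpow_natCast, h6, zpow_add₀ (mul_ne_zero hb0 (inv_ne_zero ha0)), zpow_natCast]
  rw [h7, mul_zpow, inv_zpow, ← zpow_neg, zpow_neg (tau g ho b)]
  field_simp

lemma twistSections_ext {n : ℤ} {s t : ChartFun g U} (hs : s ∈ twistSections g n U)
    (ht : t ∈ twistSections g n U) (h : ∀ hU, rat g ho hU s = rat g ho hU t) : s = t := by
  funext a
  refine eq_of_gen fun hη => ?_
  have := h hη.1
  rw [rat_eq g ho hη.1 hs hη.2, rat_eq g ho hη.1 ht hη.2] at this
  exact mul_left_cancel₀ (zpow_ne_zero _ (tau_ne_zero g ho hη.2)) this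

end rat

end Coordinates

section Sections

variable {k : Type u} [Field k] {N : ℕ} {X : Scheme.{u}} (g : X ⟶ PSpace k N)

/-- The section `x_b` of `𝒪_X(1)`. -/
def coordSection (b : Fin (N + 1)) : sections g 1 :=
  ⟨fun a => res inf_le_right (transFun g a b), by
    rw [mem_sections]
    intro a c
    rw [pow_one, res_res, res_res, transFun_cocycle]⟩

lemma twistSections_of_sections {i : ℕ} {s : ChartFun g ⊤} (hs : s ∈ sections g i) :
    s ∈ twistSections g i ⊤ := hs

variable [IsIntegral X] {o : Fin (N + 1)} (ho : genericPoint X ∈ dom g o)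

lemma rat_coordSection (b : Fin (N + 1)) :
    rat g ho (Opens.mem_top _) (coordSection g b).1 = tau g ho b := by
  rw [rat, coordSection, gen_res, tau]

end Sections

/-! ### Finiteness of the section ring over the homogeneous coordinate ring. -/

/-- In characteristic zero the integral closure of a finitely generated `k`-algebra in a finitely
generated algebraic field extension is a finite module. -/
lemma finite_integralClosure_of_adjoin {k A Ω : Type*} [Field k] [CharZero k] [CommRing A]
    [Algebra k A] [Algebra.FiniteType k A] [Field Ω] [Algebra k Ω] [Algebra A Ω]
    [IsScalarTower k A Ω] (G : Set Ω) (hG : G.Finite) (hGa : ∀ x ∈ G, IsAlgebraic (algebraMap A Ω).range x)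
    (htop : Subfield.closure (Set.range (algebraMap A Ω) ∪ G) = ⊤) :
    (Subalgebra.toSubmodule (integralClosure A Ω)).FG := by
  let R := (IsScalarTower.toAlgHom k A Ω).range
  have hR : Algebra.FiniteType k R := Algebra.FiniteType.of_surjective
    (IsScalarTower.toAlgHom k A Ω).rangeRestrict (AlgHom.rangeRestrict_surjective _)
  -- Noether normalisation of the image R of A: the polynomial ring P is integrally closed, which R
  -- need not be.
  obtain ⟨m, φ, hφ, hφi⟩ := exists_integral_inj_algHom_of_fg k R
  let P := MvPolynomial (Fin m) k
  let ψ : P →+* Ω := (algebraMap R Ω).comp φ.toRingHom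
  have hψ : Function.Injective ψ := Subtype.val_injective.comp hφ
  let : Algebra P R := φ.toRingHom.toAlgebra
  let : Algebra P Ω := ψ.toAlgebra
  have : IsScalarTower P R Ω := IsScalarTower.of_algebraMap_eq fun _ => rfl
  have : Algebra.IsIntegral P R := ⟨hφi⟩
  let Q := FractionRing P
  have : FaithfulSMul P Ω := (faithfulSMul_iff_algebraMap_injective _ _).mpr hψ
  let : Algebra Q Ω := FractionRing.liftAlgebra P Ω
  have : IsScalarTower P Q Ω := inferInstance
  have : Algebra.IsAlgebraic P R := inferInstance
  -- Ω is generated over Q = Frac P by finitely many algebraic elements, namely generators of R and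
  -- the elements of G.
  have hfin : FiniteDimensional Q Ω := by
    obtain ⟨S, hS⟩ := hR
    let E : IntermediateField Q Ω := IntermediateField.adjoin Q ((algebraMap R Ω '' S) ∪ G)
    have hE : E = ⊤ := by
      have hk : ∀ c : k, algebraMap k Ω c ∈ E := by
        intro c
        have : algebraMap k Ω c = algebraMap Q Ω (algebraMap P Q (algebraMap k P c)) := by
          rw [← IsScalarTower.algebraMap_apply P Q Ω]
          change _ = algebraMap R Ω (φ _)
          rw [φ.commutes]
          rfl
        rw [this]
        exact E.algebraMap_mem _
      have hRE : ∀ r : R, (r : Ω) ∈ E := by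
        intro r
        have : r ∈ Algebra.adjoin k (S : Set R) := hS ▸ Algebra.mem_top
        induction this using Algebra.adjoin_induction with
        | mem x hx => exact IntermediateField.subset_adjoin _ _ (Or.inl ⟨x, hx, rfl⟩)
        | algebraMap c => exact hk c
        | add x y _ _ hx hy => exact add_mem hx hy
        | mul x y _ _ hx hy => exact mul_mem hx hy
      have : (⊤ : Subfield Ω) ≤ E.toSubfield := by
        rw [← htop, Subfield.closure_le]
        rintro x (⟨a, rfl⟩ | hx)
        · exact hRE ⟨_, a, rfl⟩
        · exact IntermediateField.subset_adjoin _ _ (Or.inr hx)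
      rw [eq_top_iff]
      exact fun x hx => this trivial
    have hfin : FiniteDimensional Q E := by
      have : Finite ↥((algebraMap R Ω '' S) ∪ G) := ((S.finite_toSet.image _).union hG).to_subtype
      refine IntermediateField.finiteDimensional_adjoin ?_
      rintro x (⟨r, _, rfl⟩ | hx)
      · exact ((Algebra.IsIntegral.isIntegral (R := P) r).algebraMap (B := Ω)).tower_top
      · have h1 : IsAlgebraic R x := hGa x hx
        have h2 : IsAlgebraic P x := h1.restrictScalars P
        exact (h2.extendScalars (IsFractionRing.injective P Q)).isIntegral
    rw [hE] at hfin
    exact IntermediateField.topEquiv.toLinearEquiv.finiteDimensional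
  have : CharZero P := inferInstance
  have : CharZero Q := charZero_of_injective_algebraMap (IsFractionRing.injective P Q)
  -- Here characteristic zero enters: Ω is separable over Q, so the trace form makes the integral
  -- closure of P finite.
  have hPfin : Module.Finite P (integralClosure P Ω) := IsIntegralClosure.finite P Q Ω _
  have hPfg : (Subalgebra.toSubmodule (integralClosure P Ω)).FG := Module.Finite.iff_fg.mp hPfin
  obtain ⟨B, hB⟩ := hPfg
  -- R is a quotient of A and integral over P, so A, R and P have the same integral closure in Ω.
  have hPR : ∀ x : Ω, IsIntegral A x ↔ IsIntegral P x := by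
    intro x
    have h1 : IsIntegral R x ↔ IsIntegral P x := ⟨fun h => isIntegral_trans x h, fun h => h.tower_top⟩
    rw [← h1]
    let : Algebra A R := (IsScalarTower.toAlgHom k A Ω).rangeRestrict.toRingHom.toAlgebra
    have : IsScalarTower A R Ω := IsScalarTower.of_algebraMap_eq fun _ => rfl
    have : Algebra.IsIntegral A R := Algebra.isIntegral_of_surjective (AlgHom.rangeRestrict_surjective _)
    exact ⟨fun h => h.tower_top, fun h => isIntegral_trans x h⟩
  refine ⟨B, le_antisymm ?_ ?_⟩
  · rw [Submodule.span_le]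
    intro x hx
    have : x ∈ Subalgebra.toSubmodule (integralClosure P Ω) := hB ▸ Submodule.subset_span hx
    exact (hPR x).mpr this
  · intro x hx
    have : x ∈ Submodule.span P (B : Set Ω) := by
      rw [hB]
      exact (hPR x).mp hx
    clear hx
    induction this using Submodule.span_induction with
    | mem x hx => exact Submodule.subset_span hx
    | zero => exact zero_mem _
    | add x y _ _ h1 h2 => exact add_mem h1 h2
    | smul p x _ h1 =>
      -- P acts on Ω through R, the image of A, so a P-linear combination is also an A-linear one.
      obtain ⟨a, ha⟩ := (φ p).2
      have h2 : p • x = a • x := by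
        rw [Algebra.smul_def, Algebra.smul_def]
        exact congrArg (· * x) ha.symm
      rw [h2]
      exact Submodule.smul_mem _ _ h1

section

variable {k : Type u} [Field k] {N : ℕ} {X : Scheme.{u}} (h : X ⟶ PSpace k N)

/-- The homomorphism from the homogeneous coordinate ring of projective space to the section ring. -/
def coordMap : MvPolynomial (Fin (N + 1)) k →ₐ[k] SectionRing h :=
  MvPolynomial.aeval fun b => DirectSum.of (fun i => sections h i) 1 (coordSection h b)

variable [IsIntegral X] {o : Fin (N + 1)} (ho : genericPoint X ∈ dom h o)

/-- The embedding of the section ring into a polynomial ring over the function field. -/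
def ratPoly : SectionRing h →+* Polynomial X.functionField :=
  DirectSum.toSemiring (fun i =>
    { toFun s := Polynomial.monomial i (rat h ho (Opens.mem_top _) s.1)
      map_zero' := by simp [rat_zero]
      map_add' s t := by simp [rat_add] })
    (by
      change Polynomial.monomial 0 (rat h ho (Opens.mem_top _) 1) = 1
      rw [rat_one]; rfl)
    (fun s t => by
      change Polynomial.monomial _ (rat h ho (Opens.mem_top _) (s.1 * t.1)) = _
      rw [rat_mul]
      exact (Polynomial.monomial_mul_monomial _ _ _ _).symm)

lemma ratPoly_of (i : ℕ) (s : sections h i) : ratPoly h ho (DirectSum.of (fun i => sections h i) i s) =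
    Polynomial.monomial i (rat h ho (Opens.mem_top _) s.1) :=
  DirectSum.toSemiring_of _ _ _ _ _

lemma coeff_ratPoly (s : SectionRing h) (i : ℕ) :
    (ratPoly h ho s).coeff i = rat h ho (Opens.mem_top _) (s i).1 := by
  classical
  induction s using DirectSum.induction_on with
  | zero => simp [rat_zero]
  | of j s =>
    rw [ratPoly_of, Polynomial.coeff_monomial]
    split_ifs with hij
    · subst hij
      rw [DirectSum.of_eq_same]
    · rw [DirectSum.of_eq_of_ne _ _ _ (Ne.symm hij)]
      exact (rat_zero h ho _).symm
  | add s t hs ht =>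
    rw [map_add, Polynomial.coeff_add, hs, ht, DirectSum.add_apply, Submodule.coe_add, rat_add]

lemma ratPoly_injective : Function.Injective (ratPoly h ho) := by
  intro s t hst
  refine DFinsupp.ext fun i => Subtype.ext ?_
  refine twistSections_ext h ho (n := i) (s i).2 (t i).2 fun _ => ?_
  have := congrArg (fun p => Polynomial.coeff p i) hst
  simpa only [coeff_ratPoly] using this

end

/-- The comparison of functions on a chart of projective space with rational functions. -/
def chartGen {k : Type u} [Field k] {N : ℕ} {X : Scheme.{u}} (h : X ⟶ PSpace k N) [IsIntegral X]
    {a : Fin (N + 1)} (ha : genericPoint X ∈ dom h a) : Γ(PSpace k N, chart k N a) →+* X.functionField :=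
  (gen (dom h a) ha).comp (h.app (chart k N a)).hom

section

variable {k : Type u} [Field k] {N : ℕ} {X : Scheme.{u}} (h : X ⟶ PSpace k N) [IsIntegral X]

lemma chartGen_mem {a : Fin (N + 1)} (ha : genericPoint X ∈ dom h a) {Ω : Type*} [Field Ω]
    (ι : X.functionField →+* Ω) (F : Subring Ω)
    (hk : ∀ c, ι (gen (dom h a) ha (scalar h _ c)) ∈ F)
    (hr : ∀ b, ι (gen (dom h a) ha (transFun h a b)) ∈ F) (c : Γ(PSpace k N, chart k N a)) :
    ι (chartGen h ha c) ∈ F := by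
  have : (⊤ : Subring Γ(PSpace k N, chart k N a)) ≤ F.comap (ι.comp (chartGen h ha)) := by
    rw [← closure_chart k N a, Subring.closure_le]
    rintro _ (⟨c, rfl⟩ | ⟨b, rfl⟩)
    · have := hk c
      rw [show scalar h (dom h a) c = _ from (app_scalar h _ c).symm] at this
      exact this
    · exact hr b
  exact this trivial

section

variable [IsFinite h]

lemma isIntegralElem_chartGen {a : Fin (N + 1)} (ha : genericPoint X ∈ dom h a) (c : Γ(X, dom h a)) :
    (chartGen h ha).IsIntegralElem (gen (dom h a) ha c) :=
  (h.isIntegral_app (chart k N a) (isAffineOpen_chart k N a) c).map (gen (dom h a) ha)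

/-- Functions on a chart of X are integral over the chart ring of projective space, because X is
finite over it. An integrally closed subring therefore contains them once it contains the constants
and the ratios. This is applied to valuation rings and to a relative algebraic closure. -/
lemma gen_mem_of_integrallyClosed {a : Fin (N + 1)} (ha : genericPoint X ∈ dom h a) {Ω : Type*}
    [Field Ω] (ι : X.functionField →+* Ω) (F : Subring Ω)
    (hk : ∀ c, ι (gen (dom h a) ha (scalar h _ c)) ∈ F)
    (hr : ∀ b, ι (gen (dom h a) ha (transFun h a b)) ∈ F)
    (hF : ∀ x, F.subtype.IsIntegralElem x → x ∈ F) (c : Γ(X, dom h a)) :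
    ι (gen (dom h a) ha c) ∈ F := by
  refine hF _ ?_
  have := (isIntegralElem_chartGen h ha c).map ι
  exact RingHom.IsIntegralElem.of_comp
    (f := (ι.comp (chartGen h ha)).codRestrict F (chartGen_mem h ha ι F hk hr)) this

omit [IsIntegral X] in
lemma exists_finset_span_dom (a : Fin (N + 1)) : ∃ G : Finset Γ(X, dom h a),
    ∀ c : Γ(X, dom h a), ∃ r : G → Γ(PSpace k N, chart k N a),
      c = ∑ x, (show Γ(X, dom h a) from (h.app (chart k N a)).hom (r x)) * x.1 := by
  have hf : (h.app (chart k N a)).hom.Finite := IsFinite.finite_app h _ (isAffineOpen_chart k N a)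
  let : Algebra Γ(PSpace k N, chart k N a) Γ(X, dom h a) := (h.app (chart k N a)).hom.toAlgebra
  have : Module.Finite Γ(PSpace k N, chart k N a) Γ(X, dom h a) := hf
  obtain ⟨G, hG⟩ := this.fg_top
  refine ⟨G, fun c => ?_⟩
  have hc : c ∈ Submodule.span Γ(PSpace k N, chart k N a) (G : Set Γ(X, dom h a)) := hG ▸ trivial
  obtain ⟨r, hr⟩ := Submodule.mem_span_finset'.mp hc
  exact ⟨r, hr.symm⟩

end

variable {o : Fin (N + 1)} (ho : genericPoint X ∈ dom h o)

/-- The embedding of the section ring into the field of rational functions on the cone. -/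
def ratCone : SectionRing h →+* FractionRing (Polynomial X.functionField) :=
  (algebraMap (Polynomial X.functionField) _).comp (ratPoly h ho)

lemma ratCone_injective : Function.Injective (ratCone h ho) :=
  (IsFractionRing.injective _ _).comp (ratPoly_injective h ho)

/-- Rational functions on `X` as rational functions on the cone. -/
def toCone : X.functionField →+* FractionRing (Polynomial X.functionField) :=
  (algebraMap (Polynomial X.functionField) _).comp Polynomial.C

/-- The coordinate on the cone which restricts to `x_o`. -/
def coneVar : FractionRing (Polynomial X.functionField) :=
  algebraMap (Polynomial X.functionField) _ Polynomial.X

lemma ratCone_of (i : ℕ) (s : sections h i) :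
    ratCone h ho (DirectSum.of (fun i => sections h i) i s) =
      toCone (rat h ho (Opens.mem_top _) s.1) * coneVar ^ i := by
  rw [ratCone, RingHom.comp_apply, ratPoly_of, ← Polynomial.C_mul_X_pow_eq_monomial, map_mul, map_pow]
  rfl

lemma ratCone_algebraMap (c : k) :
    ratCone h ho (algebraMap k _ c) = toCone (gen (dom h o) ho (scalar h _ c)) := by
  have := ratCone_of h ho 0 (algebraMap k (SetLike.GradeZero.subalgebra (sections h)) c)
  refine Eq.trans ?_ (this.trans ?_)
  · rfl
  · rw [pow_zero, mul_one, rat]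
    congr 1
    change gen _ _ (scalar h _ c) = _
    rw [← res_scalar h (inf_le_right : ⊤ ⊓ dom h o ≤ dom h o), gen_res]

lemma ratCone_coordMap_X (b : Fin (N + 1)) :
    ratCone h ho (coordMap h (MvPolynomial.X b)) = toCone (tau h ho b) * coneVar := by
  rw [coordMap, MvPolynomial.aeval_X, ratCone_of, rat_coordSection, pow_one]

lemma coneVar_ne_zero : (coneVar : FractionRing (Polynomial X.functionField)) ≠ 0 :=
  (map_ne_zero_iff _ (IsFractionRing.injective _ _)).mpr Polynomial.X_ne_zero

lemma scalar_eq_of_mem {a : Fin (N + 1)} (ha : genericPoint X ∈ dom h a) (c : k) :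
    gen (dom h a) ha (scalar h _ c) = gen (dom h o) ho (scalar h _ c) := by
  rw [← res_scalar h (le_top : dom h a ≤ ⊤), ← res_scalar h (le_top : dom h o ≤ ⊤), gen_res, gen_res]

variable [IsFinite h]

/-- Among the coordinates choose x_a of largest value. All ratios x_b / x_a then lie in V, hence so
do all functions on the chart D₊(x_a), because V is integrally closed. A section of degree i is x_a
^ i times such a function. -/
lemma ratCone_mem_of_valuation (V : ValuationSubring (FractionRing (Polynomial X.functionField)))
    (hV : ∀ p, ratCone h ho (coordMap h p) ∈ V) {i : ℕ} (s : sections h i) :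
    ratCone h ho (DirectSum.of (fun i => sections h i) i s) ∈ V := by
  let ξ (b : Fin (N + 1)) := toCone (tau h ho b) * (coneVar : FractionRing (Polynomial X.functionField))
  have hξ (b) : ξ b ∈ V := by
    have := hV (MvPolynomial.X b)
    rwa [ratCone_coordMap_X] at this
  -- The maximal value is nonzero because ξ o is the cone coordinate itself; this also puts the
  -- generic point in the chart of a.
  obtain ⟨a, hmax⟩ := Finite.exists_max fun b => V.valuation (ξ b)
  have hξo : ξ o ≠ 0 := by
    simp only [ξ, tau_self, map_one, one_mul]
    exact coneVar_ne_zero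
  have hξa : ξ a ≠ 0 := by
    intro h0
    have := hmax o
    rw [h0, map_zero, le_zero_iff, map_eq_zero] at this
    exact hξo this
  have ha : genericPoint X ∈ dom h a := by
    by_contra ha
    refine hξa ?_
    simp only [ξ, tau_eq_zero h ho ha, map_zero, zero_mul]
  have hsa : toCone (gen (dom h a) ha (res (le_inf le_top le_rfl) (s.1 a))) ∈ V.toSubring := by
    refine gen_mem_of_integrallyClosed h ha toCone V.toSubring ?_ ?_ ?_ _
    · intro c
      rw [scalar_eq_of_mem h ho ha, ← ratCone_algebraMap]
      have := hV (algebraMap k _ c)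
      rwa [AlgHom.commutes] at this
    · intro b
      have h1 : toCone (gen (dom h a) ha (transFun h a b)) * ξ a = ξ b := by
        simp only [ξ]
        rw [← tau_mul_gen h ho ha b, map_mul]
        ring
      change _ ∈ V
      rw [← V.valuation_le_one_iff]
      have h2 : V.valuation (ξ a) ≠ 0 := (map_ne_zero _).mpr hξa
      have h3 := hmax b
      rw [← h1, map_mul] at h3
      exact (mul_le_iff_le_one_left (zero_lt_iff.mpr h2)).mp h3
    · intro x hx
      obtain ⟨y, hy⟩ := (IsIntegrallyClosed.isIntegral_iff (R := V)).mp (show IsIntegral V x from hx)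
      rw [← hy]
      exact y.2
  have : ratCone h ho (DirectSum.of (fun i => sections h i) i s) =
      ξ a ^ i * toCone (gen (dom h a) ha (res (le_inf le_top le_rfl) (s.1 a))) := by
    rw [ratCone_of, rat_eq h ho (Opens.mem_top _) (twistSections_of_sections h s.2) ha, gen_res]
    simp only [ξ, map_mul, map_pow, zpow_natCast]
    ring
  rw [this]
  exact mul_mem (pow_mem (hξ a) _) hsa

/-- The integral closure of a subring of a field is the intersection of the valuation rings
containing it, so `ratCone_mem_of_valuation` gives integrality of homogeneous elements. -/
lemma isIntegralElem_ratCone (s : SectionRing h) :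
    ((ratCone h ho).comp (coordMap h).toRingHom).IsIntegralElem (ratCone h ho s) := by
  induction s using DirectSum.induction_on with
  | zero => rw [map_zero]; exact RingHom.isIntegralElem_zero _
  | add s t hs ht => rw [map_add]; exact hs.add _ ht
  | of i s =>
    let ψ := (ratCone h ho).comp (coordMap h).toRingHom
    have h1 : ratCone h ho (DirectSum.of (fun i => sections h i) i s) ∈
        (integralClosure (Subring.closure (Set.range ψ)) _).toSubring := by
      rw [← iInf_valuationSubring_superset, Subring.mem_iInf]
      rintro ⟨V, hV⟩
      exact ratCone_mem_of_valuation h ho V (fun p => hV ⟨p, rfl⟩) s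
    have h2 : Subring.closure (Set.range ψ) = ψ.range := by
      rw [← RingHom.coe_range, Subring.closure_eq]
    rw [h2] at h1
    have h3 : (ψ.range.subtype).IsIntegralElem (ratCone h ho (DirectSum.of (fun i => sections h i) i s)) := h1
    obtain ⟨p, hp, hp'⟩ := h3
    -- The monic equation has coefficients in the image of k[x]; it is lifted to a monic equation
    -- over k[x] itself.
    obtain ⟨q, hq, hqm, hq'⟩ := Polynomial.lifts_and_degree_eq_and_monic (f := ψ.rangeRestrict)
      ((Polynomial.lifts_iff_coeff_lifts p).mpr fun n => ψ.rangeRestrict_surjective _) hp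
    refine ⟨q, hq', ?_⟩
    rw [← hq, Polynomial.eval₂_map] at hp'
    exact hp'

end

section
variable {k : Type u} [Field k] {N : ℕ} {X : Scheme.{u}} (h : X ⟶ PSpace k N) [IsIntegral X]
  [IsFinite h] {o : Fin (N + 1)} (ho : genericPoint X ∈ dom h o)

/-- The relative algebraic closure of the image of k[x] is integrally closed and stable under
inverses. It contains the constants and the ratios x_b / x_o, hence all functions on the chart. -/
lemma isAlgebraic_ratCone_gen (c : Γ(X, dom h o)) :
    IsAlgebraic ((ratCone h ho).comp (coordMap h).toRingHom).range
      (toCone (gen (dom h o) ho c) : FractionRing (Polynomial X.functionField)) := by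
  let ψ := (ratCone h ho).comp (coordMap h).toRingHom
  let E := Subalgebra.algebraicClosure ψ.range (FractionRing (Polynomial X.functionField))
  have hE (p) : ψ p ∈ E := Subalgebra.algebraMap_mem E (⟨ψ p, p, rfl⟩ : ψ.range)
  refine gen_mem_of_integrallyClosed h ho toCone E.toSubring ?_ ?_ ?_ c
  · intro c
    rw [← ratCone_algebraMap]
    have := hE (algebraMap k _ c)
    simp only [ψ, RingHom.comp_apply] at this
    erw [AlgHom.commutes] at this
    exact this
  · intro b
    have h1 : ψ (MvPolynomial.X b) * (ψ (MvPolynomial.X o))⁻¹ = toCone (tau h ho b) := by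
      have h2 (b) : ψ (MvPolynomial.X b) = _ := ratCone_coordMap_X h ho b
      rw [h2, h2, tau_self, map_one, one_mul, mul_assoc, mul_inv_cancel₀ coneVar_ne_zero, mul_one]
    change toCone (tau h ho b) ∈ E
    rw [← h1]
    have h3 : (ψ (MvPolynomial.X o))⁻¹ ∈ E := IsAlgebraic.inv (hE _)
    exact mul_mem (hE _) h3
  · intro x hx
    have h1 : IsIntegral E x := hx
    have h2 : IsAlgebraic E x := h1.isAlgebraic
    exact h2.restrictScalars ψ.range

/-- The coordinates give all ratios x_b / x_o and the cone variable, which is the image of x_o.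
Adjoining module generators of the chart ring of X yields its functions, then their quotients, which
form the function field of X, and finally that of the cone. -/
lemma subfield_closure_cone : ∃ G : Set (FractionRing (Polynomial X.functionField)), G.Finite ∧
    (∀ x ∈ G, ∃ c, x = toCone (gen (dom h o) ho c)) ∧
    Subfield.closure (Set.range ((ratCone h ho).comp (coordMap h).toRingHom) ∪ G) = ⊤ := by
  let ψ := (ratCone h ho).comp (coordMap h).toRingHom
  obtain ⟨G, hG⟩ := exists_finset_span_dom h o
  let γ (c : Γ(X, dom h o)) : FractionRing (Polynomial X.functionField) := toCone (gen (dom h o) ho c)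
  refine ⟨γ '' G, G.finite_toSet.image _, ?_, ?_⟩
  · rintro _ ⟨c, _, rfl⟩
    exact ⟨c, rfl⟩
  set F := Subfield.closure (Set.range ψ ∪ γ '' G) with hFdef
  have hF (p) : ψ p ∈ F := Subfield.subset_closure (Or.inl ⟨p, rfl⟩)
  have hchart (c) : toCone (chartGen h ho c) ∈ F.toSubring := by
    refine chartGen_mem h ho toCone F.toSubring ?_ ?_ c
    · intro c
      rw [← ratCone_algebraMap]
      have := hF (algebraMap k _ c)
      simp only [ψ, RingHom.comp_apply] at this
      erw [AlgHom.commutes] at this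
      exact this
    · intro b
      have h1 : ψ (MvPolynomial.X b) / (ψ (MvPolynomial.X o)) = toCone (tau h ho b) := by
        have h2 (b) : ψ (MvPolynomial.X b) = _ := ratCone_coordMap_X h ho b
        rw [h2, h2, tau_self, map_one, one_mul, mul_div_cancel_right₀ _ coneVar_ne_zero]
      change toCone (tau h ho b) ∈ F
      rw [← h1]
      exact div_mem (hF _) (hF _)
  have hdom (c) : γ c ∈ F := by
    obtain ⟨r, hr⟩ := hG c
    simp only [γ]
    rw [hr, map_sum, map_sum]
    refine sum_mem fun x _ => ?_
    rw [map_mul, map_mul]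
    exact mul_mem (hchart (r x)) (Subfield.subset_closure (Or.inr ⟨x, x.2, rfl⟩))
  have hL (l) : toCone l ∈ F := by
    obtain ⟨s, t, ht, hst⟩ := exists_gen_div
      (U := dom h o) (by exact isAffineOpen_dom h o) ho l
    have h1 : γ t ≠ 0 := (map_ne_zero toCone).mpr ht
    have h2 : toCone l = γ s / γ t := by
      rw [eq_div_iff h1]
      simp only [γ]
      rw [← map_mul, hst]
    rw [h2]
    exact div_mem (hdom s) (hdom t)
  have hT : coneVar ∈ F := by
    have := hF (MvPolynomial.X o)
    rw [show ψ (MvPolynomial.X o) = _ from ratCone_coordMap_X h ho o, tau_self, map_one, one_mul] at this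
    exact this
  have hp (p : Polynomial X.functionField) : algebraMap _ (FractionRing (Polynomial X.functionField)) p ∈ F := by
    induction p using Polynomial.induction_on' with
    | add p q hp hq => rw [map_add]; exact add_mem hp hq
    | monomial n l =>
      rw [← Polynomial.C_mul_X_pow_eq_monomial, map_mul, map_pow]
      exact mul_mem (hL l) (pow_mem hT n)
  rw [eq_top_iff]
  intro x _
  obtain ⟨p, q, _, rfl⟩ := IsFractionRing.div_surjective (A := Polynomial X.functionField) x
  exact div_mem (hp p) (hp q)

/-- The section ring of a finite morphism to projective space is a finite module over the
homogeneous coordinate ring. -/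
theorem exists_finset_span_sectionRing [CharZero k] : ∃ G : Finset (SectionRing h),
    ∀ s, ∃ r : G → MvPolynomial (Fin (N + 1)) k, s = ∑ x, coordMap h (r x) * x.1 := by
  obtain ⟨o, ho⟩ := exists_genericPoint_mem_dom h
  let Ω := FractionRing (Polynomial X.functionField)
  let ψ := (ratCone h ho).comp (coordMap h).toRingHom
  let : Algebra (MvPolynomial (Fin (N + 1)) k) Ω := ψ.toAlgebra
  let : Algebra k Ω := (ψ.comp (algebraMap k _)).toAlgebra
  have : IsScalarTower k (MvPolynomial (Fin (N + 1)) k) Ω := IsScalarTower.of_algebraMap_eq fun _ => rfl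
  let : Module (MvPolynomial (Fin (N + 1)) k) (SectionRing h) :=
    Module.compHom _ (coordMap h).toRingHom
  obtain ⟨G, hG, hGc, htop⟩ := subfield_closure_cone h ho
  have hfg := finite_integralClosure_of_adjoin (k := k) (A := MvPolynomial (Fin (N + 1)) k) (Ω := Ω) G hG
    (fun x hx => by
      obtain ⟨c, rfl⟩ := hGc x hx
      exact isAlgebraic_ratCone_gen h ho c) htop
  have : Module.Finite (MvPolynomial (Fin (N + 1)) k)
      (Subalgebra.toSubmodule (integralClosure (MvPolynomial (Fin (N + 1)) k) Ω)) :=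
    Module.Finite.iff_fg.mpr hfg
  let θ : SectionRing h →ₗ[MvPolynomial (Fin (N + 1)) k]
      (Subalgebra.toSubmodule (integralClosure (MvPolynomial (Fin (N + 1)) k) Ω)) :=
    { toFun s := ⟨ratCone h ho s, isIntegralElem_ratCone h ho s⟩
      map_add' s t := Subtype.ext (map_add _ _ _)
      map_smul' p s := Subtype.ext (map_mul (ratCone h ho) (coordMap h p) s) }
  -- The section ring is a submodule of a finite module over a Noetherian ring.
  have hfin : Module.Finite (MvPolynomial (Fin (N + 1)) k) (SectionRing h) :=
    Module.Finite.of_injective θ fun s t hst => ratCone_injective h ho (congrArg Subtype.val hst)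
  obtain ⟨S, hS⟩ := hfin.fg_top
  refine ⟨S, fun s => ?_⟩
  have hs : s ∈ Submodule.span (MvPolynomial (Fin (N + 1)) k) (S : Set (SectionRing h)) := hS ▸ trivial
  obtain ⟨r, hr⟩ := Submodule.mem_span_finset'.mp hs
  exact ⟨r, hr.symm⟩

lemma finiteType_sectionRing [CharZero k] : Algebra.FiniteType k (SectionRing h) := by
  obtain ⟨G, hG⟩ := exists_finset_span_sectionRing h
  classical
  refine ⟨⟨G ∪ Finset.univ.image (fun b => coordMap h (MvPolynomial.X b)), ?_⟩⟩
  rw [eq_top_iff]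
  intro s _
  obtain ⟨r, rfl⟩ := hG s
  refine sum_mem fun x _ => mul_mem ?_ (Algebra.subset_adjoin (by simp))
  induction r x using MvPolynomial.induction_on with
  | C c =>
    rw [show coordMap h (MvPolynomial.C c) = algebraMap k _ c from AlgHom.commutes _ c]
    exact Subalgebra.algebraMap_mem _ c
  | add p q hp hq => rw [map_add]; exact add_mem hp hq
  | mul_X p b hp => rw [map_mul]; exact mul_mem hp (Algebra.subset_adjoin (by simp))

/-- Multiplication by a coordinate raises the degree by one. So the degree-one part is spanned by
the degree-one components of the module generators and by the products of coordinates with their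
degree-zero components. -/
lemma finite_sections_one [CharZero k] : Module.Finite k (sections h 1) := by
  obtain ⟨G, hG⟩ := exists_finset_span_sectionRing h
  let μ (b : Fin (N + 1)) : sections h 0 →ₗ[k] sections h 1 :=
    { toFun y := ⟨(coordSection h b).1 * y.1,
        SetLike.GradedMul.mul_mem (A := sections h) (coordSection h b).2 y.2⟩
      map_add' y z := Subtype.ext (mul_add _ _ _)
      map_smul' c y := Subtype.ext (mul_smul_comm _ _ _) }
  let M₀ : Submodule k (sections h 0) := Submodule.span k (Set.range fun x : G => x.1 0)
  let M₁ : Submodule k (sections h 1) := Submodule.span k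
    ((Set.range fun x : Fin (N + 1) × G => μ x.1 (x.2.1 0)) ∪ Set.range fun x : G => x.1 1)
  have hμ (b) (y) (hy : y ∈ M₀) : μ b y ∈ M₁ := by
    have : M₀ ≤ M₁.comap (μ b) := by
      rw [Submodule.span_le]
      rintro _ ⟨x, rfl⟩
      exact Submodule.subset_span (Or.inl ⟨(b, x), rfl⟩)
    exact this hy
  -- The two conditions are carried together: multiplying by a coordinate kills degree zero and
  -- moves the old degree-zero component into degree one.
  have key (p : MvPolynomial (Fin (N + 1)) k) (x : SectionRing h) (h0 : x 0 ∈ M₀) (h1 : x 1 ∈ M₁) :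
      (coordMap h p * x) 0 ∈ M₀ ∧ (coordMap h p * x) 1 ∈ M₁ := by
    induction p using MvPolynomial.induction_on generalizing x with
    | C c =>
      rw [show coordMap h (MvPolynomial.C c) = algebraMap k _ c from AlgHom.commutes _ c,
        ← Algebra.smul_def]
      exact ⟨Submodule.smul_mem _ _ h0, Submodule.smul_mem _ _ h1⟩
    | add p q hp hq =>
      rw [map_add, add_mul]
      exact ⟨add_mem (hp x h0 h1).1 (hq x h0 h1).1, add_mem (hp x h0 h1).2 (hq x h0 h1).2⟩
    | mul_X p b hp =>
      rw [map_mul, mul_assoc]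
      refine hp _ ?_ ?_
      · rw [coordMap, MvPolynomial.aeval_X]
        have : (DirectSum.of (fun i => sections h i) 1 (coordSection h b) * x) 0 = 0 :=
          Subtype.ext (DirectSum.coe_of_mul_apply_of_not_le (A := sections h) _ _ _ (by simp))
        rw [this]
        exact zero_mem _
      · rw [coordMap, MvPolynomial.aeval_X]
        have : (DirectSum.of (fun i => sections h i) 1 (coordSection h b) * x) 1 = μ b (x 0) :=
          Subtype.ext (DirectSum.coe_of_mul_apply_add (A := sections h) (coordSection h b) x 0)
        rw [this]
        exact hμ b _ h0
  have htop : M₁ = ⊤ := by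
    rw [eq_top_iff]
    intro y _
    obtain ⟨r, hr⟩ := hG (DirectSum.of (fun i => sections h i) 1 y)
    have h1 : y = ∑ x, (coordMap h (r x) * x.1) 1 := by
      rw [← DirectSum.of_eq_same (β := fun i => sections h i) 1 y, hr]
      exact DFinsupp.finsetSum_apply _ _ _
    rw [h1]
    refine sum_mem fun x _ => (key (r x) x.1 ?_ ?_).2
    · exact Submodule.subset_span ⟨x, rfl⟩
    · exact Submodule.subset_span (Or.inr ⟨x, rfl⟩)
  refine ⟨htop ▸ Submodule.fg_span ?_⟩
  exact (Set.finite_range _).union (Set.finite_range _)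

end

/-! ### The ring R ⊗ Sym, its total degree, and the existence of n_X. -/

lemma isNoetherianRing_tensorProduct {k A B : Type*} [Field k] [CommRing A] [CommRing B] [Algebra k A]
    [Algebra k B] [Algebra.FiniteType k A] [Algebra.FiniteType k B] : IsNoetherianRing (A ⊗[k] B) :=
  have : Algebra.FiniteType k (A ⊗[k] B) := Algebra.FiniteType.trans (S := A) ‹_› inferInstance
  Algebra.FiniteType.isNoetherianRing k _

section Bounded

variable {k : Type u} [Field k] [CharZero k] {N : ℕ} {X Y : Scheme.{u}} [IsIntegral X] [IsIntegral Y]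
  (f : X ⟶ Y) (g : Y ⟶ PSpace k N) [IsFinite f] [IsFinite g]

/-- A basis of the finite-dimensional space H⁰(X, 𝒪_X(1)) makes the symmetric algebra a polynomial
ring in finitely many variables, so both tensor factors are finitely generated over k. -/
lemma isNoetherianRing_bigRing : IsNoetherianRing (BigRing f g) := by
  have := finiteType_sectionRing g
  have := finite_sections_one (f ≫ g)
  have h2 : Algebra.FiniteType k (SymmetricAlgebra k (sections (f ≫ g) 1)) :=
    Algebra.FiniteType.equiv inferInstance
      (SymmetricAlgebra.equivMvPolynomial (Module.finBasis k (sections (f ≫ g) 1))).symm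
  exact isNoetherianRing_tensorProduct (k := k) (A := SectionRing g)
    (B := SymmetricAlgebra k (sections (f ≫ g) 1))

end Bounded

section SymmetricAlgebra

variable {k : Type*} {M : Type*} [CommRing k] [AddCommGroup M] [Module k M]

lemma range_ι_pow_le (n : ℕ) : LinearMap.range (SymmetricAlgebra.ι k M) ^ n ≤ Submodule.span k
    {y | ∃ l : List M, l.length = n ∧ y = (l.map (SymmetricAlgebra.ι k M)).prod} := by
  rw [Submodule.pow_eq_span_pow_set, Submodule.span_le]
  intro y hy
  obtain ⟨v, rfl⟩ := Set.mem_pow.mp hy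
  choose w hw using fun i => (v i).2
  refine Submodule.subset_span ⟨List.ofFn w, by simp, ?_⟩
  rw [List.map_ofFn]
  have : (fun i => (v i).1) = SymmetricAlgebra.ι k _ ∘ w := (funext hw).symm
  rw [← this]

lemma span_prod_ι (y : SymmetricAlgebra k M) : y ∈ Submodule.span k
    {y | ∃ l : List M, y = (l.map (SymmetricAlgebra.ι k M)).prod} := by
  induction y using SymmetricAlgebra.induction with
  | algebraMap c =>
    rw [Algebra.algebraMap_eq_smul_one]
    exact Submodule.smul_mem _ _ (Submodule.subset_span ⟨[], by simp⟩)
  | ι v => exact Submodule.subset_span ⟨[v], by simp⟩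
  | add x y hx hy => exact add_mem hx hy
  | mul x y hx hy =>
    have := Submodule.mul_mem_mul hx hy
    rw [Submodule.span_mul_span] at this
    refine Submodule.span_mono ?_ this
    rintro _ ⟨_, ⟨l, rfl⟩, _, ⟨l', rfl⟩, rfl⟩
    exact ⟨l ++ l', by simp⟩

end SymmetricAlgebra

section BigPart

variable {k : Type u} [Field k] {N : ℕ} {X Y : Scheme.{u}} (f : X ⟶ Y) (g : Y ⟶ PSpace k N)

/-- The product of a homogeneous element of the section ring of `Y` and of sections of `𝒪_X(1)`. -/
def bigMonomial {i : ℕ} (r : sections g i) (l : List (sections (f ≫ g) 1)) : BigRing f g :=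
  DirectSum.of (fun i => sections g i) i r ⊗ₜ (l.map (SymmetricAlgebra.ι k _)).prod

lemma bigMonomial_mem {i : ℕ} (r : sections g i) (l : List (sections (f ≫ g) 1)) :
    bigMonomial f g r l ∈ bigPart f g (i + l.length) := by
  refine Submodule.mem_iSup_of_mem (i, l.length) (Submodule.mem_iSup_of_mem (by simp) ?_)
  refine Submodule.apply_mem_map₂ _ ⟨r, rfl⟩ ?_
  induction l with
  | nil => simp
  | cons v l ih =>
    rw [List.map_cons, List.prod_cons, List.length_cons, pow_succ']
    exact Submodule.mul_mem_mul ⟨v, rfl⟩ ih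

/-- Statements about a graded piece are thereby reduced to monomials r ⊗ v₁ ⋯ v_l, on which the maps
out of R ⊗ Sym are explicit. -/
lemma bigPart_eq_span (d : ℕ) : bigPart f g d = Submodule.span k
    {z | ∃ (i : ℕ) (r : sections g i) (l : List (sections (f ≫ g) 1)), i + l.length = d ∧
      z = bigMonomial f g r l} := by
  apply le_antisymm
  · refine iSup₂_le fun p hp => Submodule.map₂_le.mpr ?_
    rintro _ ⟨r, rfl⟩ y hy
    have hy' := range_ι_pow_le p.2 hy
    refine Submodule.span_induction (p := fun y _ => TensorProduct.mk k (SectionRing g) _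
      (DirectSum.lof k ℕ (fun i => sections g i) p.1 r) y ∈ Submodule.span k _) ?_ ?_ ?_ ?_ hy'
    · rintro _ ⟨l, hl, rfl⟩
      refine Submodule.subset_span ⟨p.1, r, l, ?_, rfl⟩
      rw [hl]
      exact Finset.HasAntidiagonal.mem_antidiagonal.mp hp
    · rw [map_zero]; exact zero_mem _
    · intro x y _ _ hx hy
      rw [map_add]; exact add_mem hx hy
    · intro c x _ hx
      rw [map_smul]; exact Submodule.smul_mem _ _ hx
  · rw [Submodule.span_le]
    rintro _ ⟨i, r, l, rfl, rfl⟩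
    exact bigMonomial_mem f g r l

lemma of_tmul_mem {i : ℕ} (r : sections g i) (y : SymmetricAlgebra k (sections (f ≫ g) 1)) :
    TensorProduct.mk k (SectionRing g) _ (DirectSum.lof k ℕ (fun i => sections g i) i r) y ∈
      ⨆ d, bigPart f g d := by
  refine Submodule.span_induction (p := fun y _ => TensorProduct.mk k (SectionRing g) _
      (DirectSum.lof k ℕ (fun i => sections g i) i r) y ∈ ⨆ d, bigPart f g d) ?_ ?_ ?_ ?_ (span_prod_ι y)
  · rintro _ ⟨l, rfl⟩
    exact Submodule.mem_iSup_of_mem _ (bigMonomial_mem f g r l)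
  · rw [map_zero]; exact zero_mem _
  · intro x y _ _ hx hy
    rw [map_add]; exact add_mem hx hy
  · intro c x _ hx
    rw [map_smul]; exact Submodule.smul_mem _ _ hx

lemma iSup_bigPart (z : BigRing f g) : z ∈ ⨆ d, bigPart f g d := by
  refine TensorProduct.induction_on z (zero_mem _) (fun r y => ?_) fun x y hx hy => add_mem hx hy
  have h1 (r : SectionRing g) : r ∈ Submodule.comap ((TensorProduct.mk k (SectionRing g) _).flip y)
      (⨆ d, bigPart f g d) := by
    refine DirectSum.induction_on r (zero_mem _) (fun i r => ?_) fun x y hx hy => add_mem hx hy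
    exact of_tmul_mem f g r y
  exact h1 r

lemma bigMap_bigMonomial {i : ℕ} (r : sections g i) (l : List (sections (f ≫ g) 1)) :
    bigMap f g (bigMonomial f g r l) = DirectSum.of (fun i => sections (f ≫ g) i) i (pullSections f g i r) *
      (l.map (DirectSum.of (fun i => sections (f ≫ g) i) 1)).prod := by
  rw [bigMap, bigMonomial, Algebra.TensorProduct.productMap_apply_tmul]
  congr 1
  · exact DirectSum.toModule_lof (R := k) (ι := ℕ) (M := fun i => sections g i)
      (φ := fun i => DirectSum.lof k ℕ (fun i => sections (f ≫ g) i) i ∘ₗ pullSections f g i) i r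
  · rw [map_list_prod, List.map_map]
    congr 2
    funext v
    exact SymmetricAlgebra.lift_ι_apply _ v

lemma bigMap_of_mem_bigPart {d : ℕ} {z : BigRing f g} (hz : z ∈ bigPart f g d) :
    ∃ s, bigMap f g z = DirectSum.of (fun i => sections (f ≫ g) i) d s := by
  rw [bigPart_eq_span] at hz
  induction hz using Submodule.span_induction with
  | mem y hy =>
    obtain ⟨i, r, l, rfl, rfl⟩ := hy
    rw [bigMap_bigMonomial]
    have (l : List (sections (f ≫ g) 1)) : ∃ s, (l.map (DirectSum.of (fun i => sections (f ≫ g) i) 1)).prod =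
        DirectSum.of (fun i => sections (f ≫ g) i) l.length s := by
      induction l with
      | nil => exact ⟨GradedMonoid.GOne.one (A := fun i => sections (f ≫ g) i), rfl⟩
      | cons v l ih =>
        obtain ⟨s, hs⟩ := ih
        rw [List.map_cons, List.prod_cons, hs, mul_comm, DirectSum.of_mul_of]
        exact ⟨_, rfl⟩
    obtain ⟨s, hs⟩ := this l
    rw [hs, DirectSum.of_mul_of]
    exact ⟨_, rfl⟩
  | zero => exact ⟨0, by simp⟩
  | add x y _ _ hx hy =>
    obtain ⟨s, hs⟩ := hx
    obtain ⟨s', hs'⟩ := hy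
    exact ⟨s + s', by rw [map_add, map_add, hs, hs']⟩
  | smul c x _ hx =>
    obtain ⟨s, hs⟩ := hx
    refine ⟨c • s, ?_⟩
    rw [map_smul, hs]
    exact (map_smul (DirectSum.lof k ℕ (fun i => sections (f ≫ g) i) d) c s).symm

/-- The map to S respects degrees and S is a direct sum, so every component of a relation is itself
a relation. Any decomposition of z into homogeneous terms will do: uniqueness in R ⊗ Sym plays no
role, only that in S. -/
lemma exists_homogeneous_components (z : BigRing f g) (hz : z ∈ relationIdeal f g) :
    ∃ c : ℕ →₀ BigRing f g, (∀ d, c d ∈ bigPart f g d ∧ c d ∈ relationIdeal f g) ∧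
      c.sum (fun _ x => x) = z := by
  have hz' := iSup_bigPart f g z
  obtain ⟨c, hc, hcz⟩ := (Submodule.mem_iSup_iff_exists_finsupp _ _).mp hz'
  refine ⟨c, fun d => ⟨hc d, ?_⟩, hcz⟩
  choose s hs using fun d => bigMap_of_mem_bigPart f g (hc d)
  have h0 : ∑ d ∈ c.support, DirectSum.of (fun i => sections (f ≫ g) i) d (s d) = 0 := by
    rw [← show bigMap f g z = 0 from hz, ← hcz, Finsupp.sum, map_sum]
    exact Finset.sum_congr rfl fun d _ => (hs d).symm
  by_cases hd : d ∈ c.support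
  · have h1 := congrArg (fun x => x d) h0
    have h2 : (∑ d ∈ c.support, DirectSum.of (fun i => sections (f ≫ g) i) d (s d)) d = s d := by
      refine (DFinsupp.finsetSum_apply _ _ _).trans ?_
      rw [Finset.sum_eq_single d]
      · exact DirectSum.of_eq_same _ _
      · intro b _ hb
        exact DirectSum.of_eq_of_ne _ _ _ hb.symm
      · exact fun h => absurd hd h
    have := hs d
    rw [show s d = 0 from h2.symm.trans h1] at this
    exact this.trans (map_zero _)
  · rw [Finsupp.notMem_support_iff.mp hd]
    exact zero_mem _

end BigPart

section

variable {k : Type u} [Field k] [CharZero k] {N : ℕ} {X Y : Scheme.{u}} [IsIntegral X] [IsIntegral Y]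
  (f : X ⟶ Y) (g : Y ⟶ PSpace k N) [IsFinite f] [IsFinite g]

/-- By Noetherianity I_X has finitely many generators; the largest degree among their homogeneous
components is a bound. -/
lemma exists_generatedInDegreeLE : ∃ n, GeneratedInDegreeLE f g n := by
  have := isNoetherianRing_bigRing f g
  obtain ⟨S, hS⟩ := IsNoetherian.noetherian (relationIdeal f g)
  have hSI (z : S) : z.1 ∈ relationIdeal f g := hS ▸ Ideal.subset_span z.2
  choose c hc hcz using fun z : S => exists_homogeneous_components f g z (hSI z)
  refine ⟨Finset.univ.sup fun z : S => (c z).support.sup id, le_antisymm ?_ ?_⟩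
  · rw [Ideal.span_le]
    exact fun z hz => hz.1
  · have key : Submodule.span (BigRing f g) (S : Set (BigRing f g)) ≤ Ideal.span {r | r ∈ relationIdeal f g ∧
        ∃ d ≤ Finset.univ.sup fun z : S => (c z).support.sup id, r ∈ bigPart f g d} := by
      rw [Submodule.span_le]
      intro z hz
      rw [← show (c ⟨z, hz⟩).sum (fun _ x => x) = z from hcz ⟨z, hz⟩]
      refine Ideal.sum_mem _ fun d hd => Ideal.subset_span ⟨(hc ⟨z, hz⟩ d).2, d, ?_, (hc ⟨z, hz⟩ d).1⟩
      exact (Finset.le_sup (f := id) hd).trans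
        (Finset.le_sup (f := fun z : S => (c z).support.sup id) (Finset.mem_univ (⟨z, hz⟩ : S)))
    rwa [hS] at key

lemma exists_isLeast_generatedInDegreeLE : ∃ n, IsLeast {d | GeneratedInDegreeLE f g d} n := by
  classical
  exact ⟨_, Nat.find_spec (exists_generatedInDegreeLE f g),
    fun m hm => Nat.find_min' (exists_generatedInDegreeLE f g) hm⟩

end

/-! ### Sections of sheaves of modules -/

section ModuleSections

variable {X Y : Scheme.{u}}

/-- Restriction of sections of an `𝒪_X`-module. -/
def modRes (M : X.Modules) {U V : X.Opens} (h : V ≤ U) : Γ(M, U) →+ Γ(M, V) :=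
  (M.presheaf.map (homOfLE h).op).hom

lemma modRes_smul (M : X.Modules) {U V : X.Opens} (h : V ≤ U) (r : Γ(X, U)) (x : Γ(M, U)) :
    modRes M h (r • x) = res h r • modRes M h x :=
  Scheme.Modules.map_smul M (homOfLE h) r x

lemma app_modRes {M M' : X.Modules} (φ : M ⟶ M') {U V : X.Opens} (h : V ≤ U) (x : Γ(M, U)) :
    φ.app V (modRes M h x) = modRes M' h (φ.app U x) :=
  NatTrans.naturality_apply φ.mapPresheaf (homOfLE h).op x

lemma modRes_modRes (M : X.Modules) {U V W : X.Opens} (h : V ≤ U) (h' : W ≤ V) (x : Γ(M, U)) :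
    modRes M h' (modRes M h x) = modRes M (h'.trans h) x := by
  simp only [modRes]
  rw [← AddCommGrpCat.comp_apply, ← Functor.map_comp]
  rfl

lemma app_sum {M M' : X.Modules} {ι : Type*} (s : Finset ι) (φ : ι → (M ⟶ M')) {U : X.Opens}
    (x : Γ(M, U)) : (∑ i ∈ s, φ i).app U x = ∑ i ∈ s, (φ i).app U x := by
  classical
  induction s using Finset.induction_on with
  | empty => simp
  | insert i s hi ih => rw [Finset.sum_insert hi, Finset.sum_insert hi, ← ih]; rfl

lemma comp_app_apply {M M' M'' : X.Modules} (φ : M ⟶ M') (ψ : M' ⟶ M'') {U : X.Opens}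
    (x : Γ(M, U)) : (φ ≫ ψ).app U x = ψ.app U (φ.app U x) := rfl

variable (ι : X ⟶ Y) (E : Y.Modules)

lemma restrictSection_add (U : Y.Opens) (e e' : Γ(E, U)) :
    restrictSection ι E U (e + e') = restrictSection ι E U e + restrictSection ι E U e' :=
  map_add _ _ _

lemma restrictSection_smul (U : Y.Opens) (r : Γ(Y, U)) (e : Γ(E, U)) :
    restrictSection ι E U (r • e) = pull ι (le_refl _) r • restrictSection ι E U e := by
  rw [pull, ← Scheme.Hom.app_eq_appLE]
  exact Scheme.Modules.Hom.app_smul _ r e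

/-- A morphism to a direct image vanishes on sections whose restriction vanishes. -/
lemma app_eq_zero_of_restrictSection {F : X.Modules}
    (ψ : E ⟶ (Scheme.Modules.pushforward ι).obj F) {U : Y.Opens} {e : Γ(E, U)}
    (he : restrictSection ι E U e = 0) : ψ.app U e = 0 := by
  let adj := Scheme.Modules.pullbackPushforwardAdjunction ι
  have h : ψ = adj.unit.app E ≫ (Scheme.Modules.pushforward ι).map ((adj.homEquiv _ _).symm ψ) := by
    exact (((adj.homEquiv _ _).apply_symm_apply ψ).symm.trans (adj.homEquiv_unit _ _ _))
  rw [h, comp_app_apply]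
  refine Eq.trans (congrArg _ ?_) (map_zero _)
  exact he

variable {F : X.Modules} (φ : (Scheme.Modules.pushforward ι).obj F ≅ E) (U : Y.Opens)

/-- A section of `E ≅ ι_* F` as a section of `F`. -/
def toUpper (e : Γ(E, U)) : Γ(F, ι ⁻¹ᵁ U) := φ.inv.app U e

/-- A section of `F` as a section of `E ≅ ι_* F`. -/
def ofUpper (x : Γ(F, ι ⁻¹ᵁ U)) : Γ(E, U) :=
  φ.hom.app U (show Γ((Scheme.Modules.pushforward ι).obj F, U) from x)

lemma action_eq (s : Γ(X, ι ⁻¹ᵁ U)) (e : Γ(E, U)) :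
    action ι φ U s e = ofUpper ι E φ U (s • toUpper ι E φ U e) := rfl

lemma ofUpper_zero : ofUpper ι E φ U 0 = 0 := map_zero _

lemma ofUpper_add (x y : Γ(F, ι ⁻¹ᵁ U)) :
    ofUpper ι E φ U (x + y) = ofUpper ι E φ U x + ofUpper ι E φ U y := map_add _ _ _

lemma ofUpper_toUpper (e : Γ(E, U)) : ofUpper ι E φ U (toUpper ι E φ U e) = e := by
  change φ.hom.app U (φ.inv.app U e) = e
  rw [← comp_app_apply, Iso.inv_hom_id]
  rfl

lemma toUpper_ofUpper (x : Γ(F, ι ⁻¹ᵁ U)) : toUpper ι E φ U (ofUpper ι E φ U x) = x := by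
  refine Eq.trans (comp_app_apply φ.hom φ.inv (U := U)
    (show Γ((Scheme.Modules.pushforward ι).obj F, U) from x)).symm ?_
  rw [Iso.hom_inv_id]
  rfl

lemma ofUpper_smul (r : Γ(Y, U)) (x : Γ(F, ι ⁻¹ᵁ U)) :
    ofUpper ι E φ U (pull ι (le_refl _) r • x) = r • ofUpper ι E φ U x := by
  rw [pull, ← Scheme.Hom.app_eq_appLE]
  exact Scheme.Modules.Hom.app_smul φ.hom r _

lemma zero_action (e : Γ(E, U)) : action ι φ U 0 e = 0 := by
  rw [action_eq, zero_smul, ofUpper_zero]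

lemma add_action (s s' : Γ(X, ι ⁻¹ᵁ U)) (e : Γ(E, U)) :
    action ι φ U (s + s') e = action ι φ U s e + action ι φ U s' e := by
  rw [action_eq, add_smul, ofUpper_add]
  rfl

lemma mul_action (s s' : Γ(X, ι ⁻¹ᵁ U)) (e : Γ(E, U)) :
    action ι φ U (s * s') e = action ι φ U s (action ι φ U s' e) := by
  rw [action_eq, action_eq, action_eq, toUpper_ofUpper, mul_smul]

lemma pull_action (r : Γ(Y, U)) (e : Γ(E, U)) : action ι φ U (pull ι (le_refl _) r) e = r • e := by
  rw [action_eq, ofUpper_smul, ofUpper_toUpper]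

end ModuleSections

/-! ### Pulling back sections of 𝒪(n). -/

section TwistRestriction

variable {k : Type u} [Field k] {N : ℕ} {Y Z : Scheme.{u}} (g : Y ⟶ PSpace k N) (ι : Z ⟶ Y)

lemma pull_mem_twistSections {n : ℤ} {U : Y.Opens} {s : ChartFun g U} (hs : s ∈ twistSections g n U) :
    (fun a => pull ι (le_refl _) (s a) : ChartFun (ι ≫ g) (ι ⁻¹ᵁ U)) ∈
      twistSections (ι ≫ g) n (ι ⁻¹ᵁ U) := by
  intro a b
  have := congrArg (pull ι (le_refl (ι ⁻¹ᵁ (U ⊓ (dom g a ⊓ dom g b))))) (hs a b)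
  rw [map_mul, map_mul, map_pow, map_pow, pull_res, pull_res, pull_res] at this
  rw [← pull_transFun ι g a b]
  refine Eq.trans ?_ (this.trans ?_)
  · exact congrArg₂ (· * ·) (congrArg (· ^ _) (res_pull ι _ _ _)) (res_pull ι _ _ _)
  · exact (congrArg₂ (· * ·) (congrArg (· ^ _) (res_pull ι _ _ _)) (res_pull ι _ _ _)).symm

/-- Pullback of families of functions on an open subset. -/
def pullChart (U : Y.Opens) : ChartFun g U →+ ChartFun (ι ≫ g) (ι ⁻¹ᵁ U) where
  toFun s a := pull ι (le_refl (ι ⁻¹ᵁ (U ⊓ dom g a))) (s a)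
  map_zero' := funext fun _ => map_zero _
  map_add' _ _ := funext fun _ => map_add _ _ _

lemma pullChart_smul {U : Y.Opens} (r : Γ(Y, U)) (s : ChartFun g U) :
    pullChart g ι U (r • s) = (ι.app U).hom r • pullChart g ι U s := by
  funext a
  rw [smul_chartFun, Scheme.Hom.app_eq_appLE]
  refine (congrArg (pull ι (le_refl (ι ⁻¹ᵁ (U ⊓ dom g a)))) (smul_chartFun g r s a)).trans ?_
  rw [map_mul, pull_res]
  congr 1
  exact (res_pull ι _ _ _).symm

/-- The morphism `𝒪_Y(n) ⟶ ι_* 𝒪_Z(n)`. -/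
def twistToPushforward (n : ℤ) : twist g n ⟶ (Scheme.Modules.pushforward ι).obj (twist (ι ≫ g) n) where
  val := PresheafOfModules.homMk (M₁ := (twist g n).val)
    (M₂ := ((Scheme.Modules.pushforward ι).obj (twist (ι ≫ g) n)).val)
    { app U := AddCommGrpCat.ofHom
        (show twistSections g n U.unop →+ twistSections (ι ≫ g) n (ι ⁻¹ᵁ U.unop) from
        { toFun s := ⟨_, pull_mem_twistSections g ι s.2⟩
          map_zero' := Subtype.ext (funext fun a => map_zero _)
          map_add' s t := Subtype.ext (funext fun a => map_add _ _ _) })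
      naturality U V i := by
        ext s
        refine Subtype.ext (funext fun a => ?_)
        exact (pull_res ι _ _ _).trans (res_pull ι _ _ _).symm }
    (by
      intro U r s
      exact Subtype.ext (pullChart_smul g ι (show Γ(Y, U.unop) from r)
        (show twistSections g n U.unop from s).1))

end TwistRestriction

/-! ### Components and rational coordinates of sections of ⊕ 𝒪_Y(-a_j). -/

section Dissocie

variable {k : Type u} [Field k] {N : ℕ} {Y : Scheme.{u}} (g : Y ⟶ PSpace k N) {t : ℕ} (a : Fin t → ℤ)

/-- The `j`-th component of a section of `⊕_j 𝒪_Y(-a_j)`. -/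
def component {U : Y.Opens} (e : Γ(dissocie g a, U)) (j : Fin t) : twistSections g (-a j) U :=
  (Limits.biproduct.π (fun j => twist g (-a j)) j).app U e

lemma component_add {U : Y.Opens} (e e' : Γ(dissocie g a, U)) (j : Fin t) :
    component g a (e + e') j = component g a e j + component g a e' j := map_add _ _ _

lemma component_zero {U : Y.Opens} (j : Fin t) :
    component g a (0 : Γ(dissocie g a, U)) j = 0 := map_zero _

lemma component_smul {U : Y.Opens} (r : Γ(Y, U)) (e : Γ(dissocie g a, U)) (j : Fin t) :
    component g a (r • e) j = r • component g a e j := Scheme.Modules.Hom.app_smul _ r e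

lemma component_modRes {U V : Y.Opens} (h : V ≤ U) (e : Γ(dissocie g a, U)) (j : Fin t) :
    (component g a (modRes _ h e) j).1 = resFun g h (component g a e j).1 :=
  congrArg Subtype.val (app_modRes (Limits.biproduct.π (fun j => twist g (-a j)) j) h e)

/-- The section of `⊕_j 𝒪_Y(-a_j)` with given components. -/
def ofComponents {U : Y.Opens} (s : ∀ j, twistSections g (-a j) U) : Γ(dissocie g a, U) :=
  ∑ j, (Limits.biproduct.ι (fun j => twist g (-a j)) j).app U (s j)

lemma component_ofComponents {U : Y.Opens} (s : ∀ j, twistSections g (-a j) U) (j : Fin t) :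
    component g a (ofComponents g a s) j = s j := by
  refine (map_sum ((Limits.biproduct.π (fun j => twist g (-a j)) j).app U).hom _ _).trans ?_
  refine (Finset.sum_eq_single j ?_ ?_).trans ?_
  · intro i _ hi
    exact (comp_app_apply (Limits.biproduct.ι (fun j => twist g (-a j)) i)
      (Limits.biproduct.π (fun j => twist g (-a j)) j) (s i)).symm.trans
      (by rw [Limits.biproduct.ι_π_ne _ hi]; rfl)
  · exact fun h => absurd (Finset.mem_univ _) h
  · exact (comp_app_apply (Limits.biproduct.ι (fun j => twist g (-a j)) j)
      (Limits.biproduct.π (fun j => twist g (-a j)) j) (s j)).symm.trans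
      (by rw [Limits.biproduct.ι_π_self]; rfl)

lemma ofComponents_component {U : Y.Opens} (e : Γ(dissocie g a, U)) :
    ofComponents g a (component g a e) = e := by
  have h := app_sum Finset.univ (fun j => Limits.biproduct.π (fun j => twist g (-a j)) j ≫
    Limits.biproduct.ι (fun j => twist g (-a j)) j) e
  rw [Limits.biproduct.total] at h
  exact h.symm

lemma component_ext {U : Y.Opens} {e e' : Γ(dissocie g a, U)}
    (h : ∀ j, component g a e j = component g a e' j) : e = e' := by
  rw [← ofComponents_component g a e, ← ofComponents_component g a e', funext h]

/-- The j-th projection followed by 𝒪_Y(-a_j) → ι_* 𝒪_Z(-a_j) is a morphism from E to a direct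
image, so it factors through the restriction to Z. No description of ι^* E is needed. -/
lemma pull_component_eq_zero {Z : Scheme.{u}} (ι : Z ⟶ Y) {U : Y.Opens} {e : Γ(dissocie g a, U)}
    (he : restrictSection ι _ U e = 0) (j : Fin t) (b : Fin (N + 1)) :
    (ι.app _).hom ((component g a e j).1 b) = 0 := by
  have h := app_eq_zero_of_restrictSection ι _
    (Limits.biproduct.π (fun j => twist g (-a j)) j ≫ twistToPushforward g ι (-a j)) he
  rw [Scheme.Hom.app_eq_appLE]
  exact congrFun (congrArg Subtype.val h) b

variable [IsIntegral Y] {o : Fin (N + 1)} (ho : genericPoint Y ∈ dom g o)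

/-- The rational coordinates of a section of `⊕_j 𝒪_Y(-a_j)`. -/
def coord {U : Y.Opens} (hU : genericPoint Y ∈ U) (e : Γ(dissocie g a, U)) : Fin t → Y.functionField :=
  fun j => rat g ho hU (component g a e j).1

section

variable {U : Y.Opens} (hU : genericPoint Y ∈ U)

lemma coord_add (e e' : Γ(dissocie g a, U)) :
    coord g a ho hU (e + e') = coord g a ho hU e + coord g a ho hU e' := by
  funext j
  rw [coord, component_add]
  exact rat_add _ _ _ _ _

lemma coord_zero : coord g a ho hU 0 = 0 := by
  funext j
  rw [coord, component_zero]
  exact rat_zero _ _ _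

lemma coord_sum {ι : Type*} (S : Finset ι) (e : ι → Γ(dissocie g a, U)) :
    coord g a ho hU (∑ i ∈ S, e i) = ∑ i ∈ S, coord g a ho hU (e i) :=
  map_sum ({ toFun := coord g a ho hU
             map_zero' := coord_zero g a ho hU
             map_add' := coord_add g a ho hU } : Γ(dissocie g a, U) →+ (Fin t → Y.functionField)) e S

lemma coord_smul (r : Γ(Y, U)) (e : Γ(dissocie g a, U)) :
    coord g a ho hU (r • e) = gen U hU r • coord g a ho hU e := by
  funext j
  rw [coord, component_smul]
  exact rat_smul _ _ _ _ _

lemma coord_modRes {V : Y.Opens} (h : V ≤ U) (hV : genericPoint Y ∈ V) (e : Γ(dissocie g a, U)) :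
    coord g a ho hV (modRes _ h e) = coord g a ho (h hV) e := by
  funext j
  rw [coord, component_modRes]
  exact rat_resFun _ _ _ _ _

lemma coord_injective : Function.Injective (coord g a ho hU) := by
  intro e e' h
  refine component_ext g a fun j => Subtype.ext ?_
  exact twistSections_ext g ho (component g a e j).2 (component g a e' j).2 fun _ => congrFun h j

lemma exists_coord_iff {w : Fin t → Y.functionField} :
    (∃ e, coord g a ho hU e = w) ↔ ∀ j, ∃ s ∈ twistSections g (-a j) U, rat g ho hU s = w j := by
  constructor
  · rintro ⟨e, rfl⟩ j
    exact ⟨_, (component g a e j).2, rfl⟩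
  · intro h
    choose s hs hsw using h
    refine ⟨ofComponents g a fun j => ⟨s j, hs j⟩, funext fun j => ?_⟩
    rw [coord, component_ofComponents]
    exact hsw j

/-- Inside the chart D₊(x_b) the bundle 𝒪(n) is free on x_b ^ n. -/
lemma exists_twistSections_iff {b : Fin (N + 1)} (hb : U ≤ dom g b) {n : ℤ} {x : Y.functionField} :
    (∃ s ∈ twistSections g n U, rat g ho hU s = x) ↔ ∃ r, x = tau g ho b ^ n * gen U hU r := by
  have h0 := tau_ne_zero g ho (hb hU)
  constructor
  · rintro ⟨s, hs, rfl⟩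
    refine ⟨res (le_inf le_rfl hb) (s b), ?_⟩
    rw [rat_eq g ho hU hs (hb hU), gen_res]
  · rintro ⟨r, rfl⟩
    -- In the chart c the function is r (x_b / x_c) ^ n. For negative n the inverse ratio x_c / x_b
    -- is used, so one of the two exponents is always zero.
    let s : ChartFun g U := fun c => res inf_le_left r *
      (res inf_le_right (transFun g c b) ^ n.toNat *
        res (inf_le_left.trans hb) (transFun g b c) ^ (-n).toNat)
    have key : ∀ c (hc : genericPoint Y ∈ dom g c) (hU' : genericPoint Y ∈ U),
        tau g ho b ^ n * gen U hU r = tau g ho c ^ n * gen (U ⊓ dom g c) (mem_inf hU' hc) (s c) := by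
      intro c hc _
      have hc0 := tau_ne_zero g ho hc
      simp only [s, map_mul, map_pow, gen_res]
      have h1 : gen (dom g c) hc (transFun g c b) = tau g ho b * (tau g ho c)⁻¹ := by
        rw [← tau_mul_gen g ho hc b, mul_comm, inv_mul_cancel_left₀ hc0]
      have h2 : gen (dom g b) (hb hU) (transFun g b c) = (tau g ho b * (tau g ho c)⁻¹)⁻¹ := by
        rw [← tau_mul_gen g ho (hb hU) c, mul_inv, inv_inv, inv_mul_cancel_left₀ h0]
      rw [h1, h2, inv_pow, ← zpow_natCast, ← zpow_natCast, ← zpow_neg,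
        ← zpow_add₀ (mul_ne_zero h0 (inv_ne_zero hc0)), show ((n.toNat : ℤ) + -((-n).toNat : ℤ)) = n by omega,
        mul_zpow, inv_zpow]
      field_simp
    refine ⟨s, mem_twistSections_of_rat g ho key, ?_⟩
    have := key o ho hU
    rw [this, tau_self, one_zpow, one_mul]
    rfl

lemma exists_coord_iff_of_le {b : Fin (N + 1)} (hb : U ≤ dom g b) {w : Fin t → Y.functionField} :
    (∃ e, coord g a ho hU e = w) ↔ ∀ j, ∃ r, w j = tau g ho b ^ (-a j) * gen U hU r := by
  rw [exists_coord_iff]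
  exact forall_congr' fun j => exists_twistSections_iff g ho hU hb

end

end Dissocie

/-! ### Sections of the tensor product -/

section Tensor

variable {X : Scheme.{u}} {M M' : X.Modules} {U : X.Opens}

variable (M M' U) in
/-- The map from the tensor product of the sections to the sections of the tensor product. -/
def tmulHom : Γ(M, U) ⊗[Γ(X, U)] Γ(M', U) →ₗ[Γ(X, U)] Γ(tensor M M', U) :=
  (((PresheafOfModules.sheafificationAdjunction (𝟙 X.ringCatSheaf.obj)).unit.app
    (tensorPresheaf M M')).app (op U)).hom

lemma tmul_eq (m : Γ(M, U)) (n : Γ(M', U)) : tmul m n = tmulHom M M' U (m ⊗ₜ n) := rfl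

lemma tmul_add (m : Γ(M, U)) (n n' : Γ(M', U)) : tmul m (n + n') = tmul m n + tmul m n' := by
  rw [tmul_eq, TensorProduct.tmul_add, map_add, tmul_eq, tmul_eq]

lemma add_tmul (m m' : Γ(M, U)) (n : Γ(M', U)) : tmul (m + m') n = tmul m n + tmul m' n := by
  rw [tmul_eq, TensorProduct.add_tmul, map_add, tmul_eq, tmul_eq]

lemma tmul_smul (r : Γ(X, U)) (m : Γ(M, U)) (n : Γ(M', U)) : tmul m (r • n) = r • tmul m n := by
  rw [tmul_eq, TensorProduct.tmul_smul, map_smul, tmul_eq]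

lemma smul_tmul (r : Γ(X, U)) (m : Γ(M, U)) (n : Γ(M', U)) : tmul (r • m) n = r • tmul m n := by
  rw [tmul_eq, ← TensorProduct.smul_tmul', map_smul, tmul_eq]

lemma modRes_tmul {V : X.Opens} (h : V ≤ U) (m : Γ(M, U)) (n : Γ(M', U)) :
    modRes (tensor M M') h (tmul m n) = tmul (modRes M h m) (modRes M' h n) := by
  have := PresheafOfModules.naturality_apply
    ((PresheafOfModules.sheafificationAdjunction (𝟙 X.ringCatSheaf.obj)).unit.app
      (tensorPresheaf M M')) (homOfLE h).op
      (TensorProduct.tmul Γ(X, U) (M := Γ(M, U)) (N := Γ(M', U)) m n)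
  exact this.symm

end Tensor

/-! ### The bilinear product defined by α. -/

section MulSection

variable {X Y : Scheme.{u}} (f : X ⟶ Y) {E : Y.Modules}
  (α : tensor ((Scheme.Modules.pushforward f).obj (structureModule X)) E ⟶ E)

/-- A function as a section of `f_* 𝒪_X`. -/
def asSection {U : Y.Opens} (s : Γ(X, f ⁻¹ᵁ U)) :
    Γ((Scheme.Modules.pushforward f).obj (structureModule X), U) := s

/-- The product of a section of `f_* 𝒪_X` and a section of `E` under `α`. -/
def mulSec {U : Y.Opens} (s : Γ(X, f ⁻¹ᵁ U)) (e : Γ(E, U)) : Γ(E, U) :=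
  α.app U (tmul (asSection f s) e)

variable {U : Y.Opens}

lemma mulSec_add (s : Γ(X, f ⁻¹ᵁ U)) (e e' : Γ(E, U)) :
    mulSec f α s (e + e') = mulSec f α s e + mulSec f α s e' := by
  rw [mulSec, tmul_add, map_add]
  rfl

lemma add_mulSec (s s' : Γ(X, f ⁻¹ᵁ U)) (e : Γ(E, U)) :
    mulSec f α (s + s') e = mulSec f α s e + mulSec f α s' e := by
  have : asSection f (s + s') = asSection f s + asSection f s' := rfl
  rw [mulSec, this, add_tmul, map_add]
  rfl

lemma mulSec_smul (s : Γ(X, f ⁻¹ᵁ U)) (r : Γ(Y, U)) (e : Γ(E, U)) :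
    mulSec f α s (r • e) = r • mulSec f α s e := by
  rw [mulSec, tmul_smul, Scheme.Modules.Hom.app_smul]
  rfl

lemma asSection_pull_mul (r : Γ(Y, U)) (s : Γ(X, f ⁻¹ᵁ U)) :
    asSection f (pull f (le_refl _) r * s) = r • asSection f s := by
  rw [pull, ← Scheme.Hom.app_eq_appLE]
  rfl

lemma pull_mulSec (r : Γ(Y, U)) (s : Γ(X, f ⁻¹ᵁ U)) (e : Γ(E, U)) :
    mulSec f α (pull f (le_refl _) r * s) e = r • mulSec f α s e := by
  rw [mulSec, asSection_pull_mul, smul_tmul, Scheme.Modules.Hom.app_smul]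
  rfl

lemma modRes_mulSec {V : Y.Opens} (h : V ≤ U) (s : Γ(X, f ⁻¹ᵁ U)) (e : Γ(E, U)) :
    modRes E h (mulSec f α s e) = mulSec f α (res (f.preimage_mono h) s) (modRes E h e) := by
  rw [mulSec, ← app_modRes, modRes_tmul]
  rfl

lemma mulSec_sum (s : Γ(X, f ⁻¹ᵁ U)) {ι : Type*} (S : Finset ι) (e : ι → Γ(E, U)) :
    mulSec f α s (∑ i ∈ S, e i) = ∑ i ∈ S, mulSec f α s (e i) := by
  have h0 : mulSec f α s 0 = 0 := by
    have := mulSec_smul f α s 0 0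
    rwa [zero_smul, zero_smul] at this
  exact map_sum ({ toFun := mulSec f α s
                   map_zero' := h0
                   map_add' := mulSec_add f α s } : Γ(E, U) →+ Γ(E, U)) e S

end MulSection

/-! ### Values of sections in charts of X and over charts of Y. -/

section ChartValue

variable {k : Type u} [Field k] {N : ℕ} {X : Scheme.{u}} (h : X ⟶ PSpace k N)

/-- The value of a family of functions in a chart. -/
def chartVal (b : Fin (N + 1)) : ChartFun h ⊤ →+* Γ(X, dom h b) :=
  (res (le_inf le_top le_rfl)).comp (Pi.evalRingHom _ b)

lemma chartVal_smul (b : Fin (N + 1)) (c : k) (s : ChartFun h ⊤) :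
    chartVal h b (c • s) = scalar h _ c * chartVal h b s := by
  rw [Algebra.smul_def, map_mul]
  congr 1
  exact res_scalar h _ c

lemma chartVal_trans {i : ℕ} {s : ChartFun h ⊤} (hs : s ∈ sections h i) {b c : Fin (N + 1)}
    {U : X.Opens} (hb : U ≤ dom h b) (hc : U ≤ dom h c) : res hb (chartVal h b s) =
      res hb (transFun h b c) ^ i * res hc (chartVal h c s) := by
  rw [mem_sections] at hs
  have := congrArg (res (le_inf le_top (le_inf hb hc))) (hs b c)
  rw [map_mul, map_pow, res_res, res_res, res_res] at this
  simp only [chartVal, RingHom.comp_apply, res_res]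
  exact this

variable [IsIntegral X] {o : Fin (N + 1)} (ho : genericPoint X ∈ dom h o)

lemma rat_eq_chartVal {i : ℕ} {s : ChartFun h ⊤} (hs : s ∈ sections h i) {b : Fin (N + 1)}
    (hb : genericPoint X ∈ dom h b) : rat h ho (Opens.mem_top _) s =
      tau h ho b ^ i * gen (dom h b) hb (chartVal h b s) := by
  rw [rat_eq h ho (Opens.mem_top _) (twistSections_of_sections h hs) hb, zpow_natCast]
  simp only [chartVal, RingHom.comp_apply, gen_res]
  rfl

lemma rat_eq_gen_chartVal (s : ChartFun h ⊤) :
    rat h ho (Opens.mem_top _) s = gen (dom h o) ho (chartVal h o s) := by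
  simp only [chartVal, RingHom.comp_apply, gen_res]
  rfl

/-- Constants as rational functions. -/
def scalarGen : k →+* X.functionField := (gen ⊤ (Opens.mem_top _)).comp (scalar h ⊤)

lemma gen_scalar {U : X.Opens} (hU : genericPoint X ∈ U) (c : k) :
    gen U hU (scalar h U c) = scalarGen h c := by
  rw [← res_scalar h (le_top : U ≤ ⊤), gen_res]
  rfl

lemma rat_smul_const (c : k) (s : ChartFun h ⊤) : rat h ho (Opens.mem_top _) (c • s) =
    scalarGen h c * rat h ho (Opens.mem_top _) s := by
  rw [rat_eq_gen_chartVal, chartVal_smul, map_mul, gen_scalar, ← rat_eq_gen_chartVal]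

end ChartValue

section UpValue

variable {k : Type u} [Field k] {N : ℕ} {X Y : Scheme.{u}} (f : X ⟶ Y) (g : Y ⟶ PSpace k N)

/-- The value of a family of functions on the preimage of a chart of `Y`. -/
def upVal (b : Fin (N + 1)) : ChartFun (f ≫ g) ⊤ →+* Γ(X, f ⁻¹ᵁ dom g b) := chartVal (f ≫ g) b

lemma upVal_smul (b : Fin (N + 1)) (c : k) (s : ChartFun (f ≫ g) ⊤) :
    upVal f g b (c • s) = pull f (le_refl _) (scalar g (dom g b) c) * upVal f g b s := by
  rw [pull_scalar]
  exact chartVal_smul (f ≫ g) b c s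

lemma upVal_trans {i : ℕ} {s : ChartFun (f ≫ g) ⊤} (hs : s ∈ sections (f ≫ g) i) (b c : Fin (N + 1)) :
    res (f.preimage_mono (inf_le_left : dom g b ⊓ dom g c ≤ _)) (upVal f g b s) =
      pull f (le_refl _) (res inf_le_left (transFun g b c)) ^ i *
        res (f.preimage_mono inf_le_right) (upVal f g c s) := by
  refine (chartVal_trans (f ≫ g) hs _ (c := c) (f.preimage_mono inf_le_right)).trans ?_
  rw [pull_res, ← pull_transFun f g b c]
  refine congrArg₂ (· * ·) (congrArg (· ^ i) (res_pull f _ _ _)) rfl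

lemma upVal_pullSections {i : ℕ} (r : sections g i) (b : Fin (N + 1)) :
    upVal f g b (pullSections f g i r).1 = pull f (le_refl _) (chartVal g b r.1) := by
  refine (res_pull f (preimage_overlap_le f g b) _ (r.1 b)).trans ?_
  exact (pull_res f (le_inf le_top le_rfl) (le_refl _) (r.1 b)).symm

end UpValue

/-! ### Operators on the generic fibre attached to sections of 𝒪_X(1). -/

section Operators

variable {k : Type u} [Field k] {N : ℕ} {X Y : Scheme.{u}} [IsIntegral Y] (f : X ⟶ Y)
  (g : Y ⟶ PSpace k N) {t : ℕ} (a : Fin t → ℤ) {o : Fin (N + 1)} (ho : genericPoint Y ∈ dom g o)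

lemma exists_stdSection (j : Fin t) : ∃ e, coord g a ho ho e = Pi.single j 1 := by
  rw [exists_coord_iff_of_le g a ho ho le_rfl]
  intro i
  rw [tau_self, one_zpow]
  by_cases h : i = j
  · subst h
    exact ⟨1, by simp⟩
  · exact ⟨0, by simp [h]⟩

/-- The generators of `⊕_j 𝒪_Y(-a_j)` over the base chart. -/
def stdSection (j : Fin t) : Γ(dissocie g a, dom g o) := (exists_stdSection g a ho j).choose

lemma coord_stdSection (j : Fin t) : coord g a ho ho (stdSection g a ho j) = Pi.single j 1 :=
  (exists_stdSection g a ho j).choose_spec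

lemma exists_sum_stdSection {U : Y.Opens} (hU : genericPoint Y ∈ U) (h : U ≤ dom g o)
    (e : Γ(dissocie g a, U)) : ∃ c : Fin t → Γ(Y, U),
      e = ∑ j, c j • modRes _ h (stdSection g a ho j) ∧ coord g a ho hU e = fun j => gen U hU (c j) := by
  choose c hc using (exists_coord_iff_of_le g a ho hU h).mp ⟨e, rfl⟩
  simp only [tau_self, one_zpow, one_mul] at hc
  refine ⟨c, coord_injective g a ho hU ?_, funext hc⟩
  rw [coord_sum]
  funext i
  rw [hc i, Finset.sum_apply, Finset.sum_eq_single i]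
  · rw [coord_smul, coord_modRes, coord_stdSection]
    simp
  · intro j _ hj
    rw [coord_smul, coord_modRes, coord_stdSection]
    simp [hj.symm]
  · simp

variable (α : tensor ((Scheme.Modules.pushforward f).obj (structureModule X)) (dissocie g a) ⟶
  dissocie g a)

/-- The endomorphism of the generic fibre of `⊕_j 𝒪_Y(-a_j)` given by the product with a function. -/
def opOf (s : Γ(X, f ⁻¹ᵁ dom g o)) : Module.End Y.functionField (Fin t → Y.functionField) :=
  (Pi.basisFun Y.functionField (Fin t)).constr Y.functionField
    fun j => coord g a ho ho (mulSec f α s (stdSection g a ho j))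

lemma opOf_apply (s : Γ(X, f ⁻¹ᵁ dom g o)) (w : Fin t → Y.functionField) : opOf f g a ho α s w =
    ∑ j, w j • coord g a ho ho (mulSec f α s (stdSection g a ho j)) := by
  rw [opOf, Module.Basis.constr_apply_fintype]
  rfl

lemma opOf_add (s s' : Γ(X, f ⁻¹ᵁ dom g o)) :
    opOf f g a ho α (s + s') = opOf f g a ho α s + opOf f g a ho α s' := by
  refine LinearMap.ext fun w => ?_
  simp only [opOf_apply, LinearMap.add_apply, add_mulSec, coord_add, smul_add, Finset.sum_add_distrib]

lemma opOf_smul (r : Γ(Y, dom g o)) (s : Γ(X, f ⁻¹ᵁ dom g o)) :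
    opOf f g a ho α (pull f (le_refl _) r * s) = gen _ ho r • opOf f g a ho α s := by
  refine LinearMap.ext fun w => ?_
  simp only [opOf_apply, LinearMap.smul_apply, pull_mulSec, coord_smul, Finset.smul_sum]
  refine Finset.sum_congr rfl fun j _ => smul_comm _ _ _

/-- The product is 𝒪_Y-bilinear, so it is determined after restriction to U ∩ D₊(x_o), where E is
free on the standard sections. If s' = r s there, the product with s' becomes r times the operator
of s. -/
lemma coord_mulSec {U : Y.Opens} (hU : genericPoint Y ∈ U) (s : Γ(X, f ⁻¹ᵁ dom g o))
    (s' : Γ(X, f ⁻¹ᵁ U)) (r : Γ(Y, U ⊓ dom g o))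
    (hs : res (f.preimage_mono inf_le_left) s' =
      pull f (le_refl _) r * res (f.preimage_mono inf_le_right) s) (e : Γ(dissocie g a, U)) :
    coord g a ho hU (mulSec f α s' e) = gen _ (mem_inf hU ho) r • opOf f g a ho α s (coord g a ho hU e) := by
  rw [← coord_modRes g a ho inf_le_left (mem_inf hU ho), modRes_mulSec, hs, pull_mulSec, coord_smul,
    ← coord_modRes g a ho inf_le_left (mem_inf hU ho) e]
  congr 1
  obtain ⟨c, hc, hc'⟩ := exists_sum_stdSection g a ho (mem_inf hU ho) inf_le_right (modRes _ inf_le_left e)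
  rw [hc', opOf_apply, hc, mulSec_sum, coord_sum]
  refine Finset.sum_congr rfl fun j _ => ?_
  rw [mulSec_smul, coord_smul, ← modRes_mulSec, coord_modRes]

/-- The operator attached to a section of `𝒪_X(1)`. -/
def sectionOp (v : sections (f ≫ g) 1) : Module.End Y.functionField (Fin t → Y.functionField) :=
  opOf f g a ho α (upVal f g o v.1)

lemma sectionOp_add (v w : sections (f ≫ g) 1) :
    sectionOp f g a ho α (v + w) = sectionOp f g a ho α v + sectionOp f g a ho α w := by
  rw [sectionOp, Submodule.coe_add, map_add, opOf_add]
  rfl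

lemma sectionOp_smul (c : k) (v : sections (f ≫ g) 1) :
    sectionOp f g a ho α (c • v) = scalarGen g c • sectionOp f g a ho α v := by
  rw [sectionOp, Submodule.coe_smul, upVal_smul, opOf_smul, gen_scalar]
  rfl

/-- The value of v in the chart b is x_o / x_b times its value in the chart o. Thus one operator,
normalised by x_o, describes the product with v in every chart, up to the factor that makes it a map
from E to E(1). -/
lemma coord_mulSec_upVal (v : sections (f ≫ g) 1) {b : Fin (N + 1)} (hb : genericPoint Y ∈ dom g b)
    (e : Γ(dissocie g a, dom g b)) :
    coord g a ho hb (mulSec f α (upVal f g b v.1) e) =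
      (tau g ho b)⁻¹ • sectionOp f g a ho α v (coord g a ho hb e) := by
  rw [coord_mulSec f g a ho α hb (upVal f g o v.1) _ (res inf_le_left (transFun g b o))]
  · rw [gen_res]
    congr 1
    rw [eq_comm, inv_eq_iff_eq_inv, eq_comm]
    refine inv_eq_of_mul_eq_one_left ?_
    rw [tau_mul_gen, tau_self]
  · rw [upVal_trans f g v.2, pow_one]

end Operators

/-! ### Operators that lift multiplication on the restriction to Z. -/

section Liftable

variable {k : Type u} [Field k] {N : ℕ} {X Y Z : Scheme.{u}} (f : X ⟶ Y)
  (g : Y ⟶ PSpace k N) {t : ℕ} (a : Fin t → ℤ) (ι : Z ⟶ Y) {F : (Limits.pullback f ι).Modules}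
  (φ : (Scheme.Modules.pushforward (Limits.pullback.snd f ι)).obj F ≅
    (Scheme.Modules.pullback ι).obj (dissocie g a))

/-- Pullback of functions from `X` to `X ×_Y Z`. -/
def toFiber (U : Y.Opens) : Γ(X, f ⁻¹ᵁ U) →+* Γ(Limits.pullback f ι, Limits.pullback.snd f ι ⁻¹ᵁ ι ⁻¹ᵁ U) :=
  pull (Limits.pullback.fst f ι) (preimage_fst_snd f ι U)

lemma toFiber_pull (U : Y.Opens) (r : Γ(Y, U)) : toFiber f ι U (pull f (le_refl _) r) =
    pull (Limits.pullback.snd f ι) (le_refl _) (pull ι (le_refl _) r) := by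
  simp only [toFiber, pull]
  rw [← CommRingCat.comp_apply, ← CommRingCat.comp_apply, Scheme.Hom.appLE_comp_appLE,
    Scheme.Hom.appLE_comp_appLE]
  simp only [Limits.pullback.condition]

variable [IsIntegral Y] {o : Fin (N + 1)} (ho : genericPoint Y ∈ dom g o)

/-- The endomorphism `B` of the generic fibre of `E = ⊕_j 𝒪_Y(-a_j)` maps `E` to `E(d)`, and induces
the multiplication with the section `s` of `𝒪_X(d)` on the restriction to `Z`. -/
def LiftsMul (d : ℕ) (B : Module.End Y.functionField (Fin t → Y.functionField))
    (s : ChartFun (f ≫ g) ⊤) : Prop :=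
  ∀ (b : Fin (N + 1)) (hb : genericPoint Y ∈ dom g b) (e : Γ(dissocie g a, dom g b)),
    ∃ e', coord g a ho hb e' = ((tau g ho b)⁻¹) ^ d • B (coord g a ho hb e) ∧
      restrictSection ι _ _ e' = action (Limits.pullback.snd f ι) φ _
        (toFiber f ι _ (upVal f g b s)) (restrictSection ι _ _ e)

variable {f g a ho ι φ}

lemma LiftsMul.zero (d : ℕ) : LiftsMul f g a ι φ ho d 0 0 := by
  intro b hb e
  refine ⟨0, ?_, ?_⟩
  · rw [coord_zero, LinearMap.zero_apply, smul_zero]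
  · rw [map_zero, map_zero, zero_action]
    exact map_zero _

lemma LiftsMul.add {d : ℕ} {B B' : Module.End Y.functionField (Fin t → Y.functionField)}
    {s s' : ChartFun (f ≫ g) ⊤} (h : LiftsMul f g a ι φ ho d B s) (h' : LiftsMul f g a ι φ ho d B' s') :
    LiftsMul f g a ι φ ho d (B + B') (s + s') := by
  intro b hb e
  obtain ⟨e₁, h1, h2⟩ := h b hb e
  obtain ⟨e₂, h3, h4⟩ := h' b hb e
  refine ⟨e₁ + e₂, ?_, ?_⟩
  · rw [coord_add, h1, h3, LinearMap.add_apply, smul_add]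
  · rw [restrictSection_add, h2, h4, map_add, map_add, add_action]

lemma LiftsMul.mul {d d' : ℕ} {B B' : Module.End Y.functionField (Fin t → Y.functionField)}
    {s s' : ChartFun (f ≫ g) ⊤} (h : LiftsMul f g a ι φ ho d B s) (h' : LiftsMul f g a ι φ ho d' B' s') :
    LiftsMul f g a ι φ ho (d + d') (B * B') (s * s') := by
  intro b hb e
  obtain ⟨e₁, h1, h2⟩ := h' b hb e
  obtain ⟨e₂, h3, h4⟩ := h b hb e₁
  refine ⟨e₂, ?_, ?_⟩
  · rw [h3, h1, map_smul, smul_smul, ← pow_add, Module.End.mul_apply]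
  · rw [h4, h2, map_mul, map_mul, mul_action]

/-- A section of 𝒪_Y(d) acts on E through the 𝒪_Y-module structure, and restriction to Z is linear.
-/
lemma liftsMul_pullSections {d : ℕ} (r : sections g d) :
    LiftsMul f g a ι φ ho d (rat g ho (Opens.mem_top _) r.1 • 1) (pullSections f g d r).1 := by
  intro b hb e
  refine ⟨chartVal g b r.1 • e, ?_, ?_⟩
  · rw [coord_smul, LinearMap.smul_apply, Module.End.one_apply, smul_smul, rat_eq_chartVal g ho r.2 hb,
      inv_pow, inv_mul_cancel_left₀ (pow_ne_zero _ (tau_ne_zero g ho hb))]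
  · rw [upVal_pullSections, toFiber_pull, pull_action, restrictSection_smul]

lemma LiftsMul.scalar_smul {d : ℕ} {B : Module.End Y.functionField (Fin t → Y.functionField)}
    {s : ChartFun (f ≫ g) ⊤} (h : LiftsMul f g a ι φ ho d B s) (c : k) :
    LiftsMul f g a ι φ ho d (scalarGen g c • B) (c • s) := by
  intro b hb e
  obtain ⟨e₁, h1, h2⟩ := h b hb e
  refine ⟨scalar g (dom g b) c • e₁, ?_, ?_⟩
  · rw [coord_smul, h1, gen_scalar, LinearMap.smul_apply, smul_comm]
  · rw [restrictSection_smul, h2, upVal_smul, map_mul, toFiber_pull, mul_action, pull_action]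

/-- This is where the compatibility of α with the action on E|_Z is used. -/
lemma liftsMul_sectionOp {α : tensor ((Scheme.Modules.pushforward f).obj (structureModule X)) (dissocie g a) ⟶
    dissocie g a} (hα : IsRestrictionOf f ι (dissocie g a) φ α) (v : sections (f ≫ g) 1) :
    LiftsMul f g a ι φ ho 1 (sectionOp f g a ho α v) v.1 := by
  intro b hb e
  refine ⟨mulSec f α (upVal f g b v.1) e, ?_, ?_⟩
  · rw [coord_mulSec_upVal, pow_one]
  · exact (hα _ _ _).symm

/-- Apply the operator to the local generator x_b ^ (-a_j) e_j of E. The resulting section restricts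
to zero on Z, so its i-th component, in the trivialisation by powers of x_b, is a function in the
ideal of Z. -/
lemma LiftsMul.exists_eq_tau_mul {d : ℕ} {B : Module.End Y.functionField (Fin t → Y.functionField)}
    (h : LiftsMul f g a ι φ ho d B 0) (i j : Fin t) {b : Fin (N + 1)} (hb : genericPoint Y ∈ dom g b) :
    ∃ c : Γ(Y, dom g b), pull ι (le_refl _) c = 0 ∧
      B (Pi.single j 1) i = tau g ho b ^ (d + a j - a i) * gen _ hb c := by
  have h0 := tau_ne_zero g ho hb
  obtain ⟨e, he⟩ : ∃ e, coord g a ho hb e = tau g ho b ^ (-a j) • Pi.single j 1 := by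
    rw [exists_coord_iff_of_le g a ho hb le_rfl]
    intro l
    by_cases hl : l = j
    · subst hl
      exact ⟨1, by simp⟩
    · exact ⟨0, by simp [hl]⟩
  obtain ⟨e', h1, h2⟩ := h b hb e
  rw [map_zero, map_zero, zero_action] at h2
  refine ⟨res (le_inf le_rfl le_rfl) ((component g a e' i).1 b), ?_, ?_⟩
  · have := pull_component_eq_zero g a ι h2 i b
    rw [Scheme.Hom.app_eq_appLE] at this
    have hle : dom g b ≤ dom g b ⊓ dom g b := le_inf le_rfl le_rfl
    refine (pull_res ι hle (le_refl _) _).trans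
      ((res_pull ι (le_refl _) (ι.preimage_mono hle) _).symm.trans ?_)
    exact (congrArg _ this).trans (map_zero _)
  · have h3 := congrFun h1 i
    rw [coord, rat_eq g ho hb (component g a e' i).2 hb, he, map_smul, Pi.smul_apply, Pi.smul_apply,
      smul_eq_mul, smul_eq_mul, ← zpow_natCast, inv_zpow, ← zpow_neg, ← mul_assoc,
      ← zpow_add₀ h0] at h3
    rw [gen_res, show (d + a j - a i : ℤ) = -(-(d : ℤ) + -a j) + -a i by ring, zpow_add₀ h0, mul_assoc, h3,
      ← mul_assoc, ← zpow_add₀ h0, neg_add_cancel, zpow_zero, one_mul]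

/-- The vanishing which follows from the separation hypothesis. -/
lemma LiftsMul.eq_zero {d n : ℕ} {B : Module.End Y.functionField (Fin t → Y.functionField)}
    (h : LiftsMul f g a ι φ ho d B 0) (hn : d + spread a ≤ n) (hZ : IsSeparating g ι n) : B = 0 := by
  refine LinearMap.pi_ext' fun j => LinearMap.ext_ring (funext fun i => ?_)
  change B (Pi.single j 1) i = 0
  have key : ∀ b, ∃ c : Γ(Y, dom g b), pull ι (le_refl _) c = 0 ∧ ∀ hb : genericPoint Y ∈ dom g b,
      B (Pi.single j 1) i = tau g ho b ^ (d + a j - a i) * gen _ hb c := by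
    intro b
    by_cases hb : genericPoint Y ∈ dom g b
    · obtain ⟨c, h1, h2⟩ := h.exists_eq_tau_mul i j hb
      exact ⟨c, h1, fun _ => h2⟩
    · exact ⟨0, map_zero _, fun h => absurd h hb⟩
  choose c hc hcx using key
  set m : ℤ := d + a j - a i with hm
  -- Separation speaks only of degrees at least zero. If m < 0, multiplication by x_o ^ (-m) gives a
  -- section of degree zero with the same rational function, since coordinates are normalised by
  -- x_o; if m ≥ 0 the extra factor is 1.
  let s : ChartFun g ⊤ := fun b => res inf_le_right (c b * transFun g b o ^ (-m).toNat)
  have hs : ∀ b (hb : genericPoint Y ∈ dom g b) (hU : genericPoint Y ∈ (⊤ : Y.Opens)),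
      B (Pi.single j 1) i = tau g ho b ^ (m.toNat : ℤ) * gen (⊤ ⊓ dom g b) (mem_inf hU hb) (s b) := by
    intro b hb hU
    have h0 := tau_ne_zero g ho hb
    have h1 : gen _ hb (transFun g b o) = (tau g ho b)⁻¹ := by
      refine (inv_eq_of_mul_eq_one_right ?_).symm
      rw [tau_mul_gen, tau_self]
    simp only [s, gen_res]
    rw [hcx b hb, map_mul, map_pow, h1, inv_pow, show (m.toNat : ℤ) = m + (-m).toNat by omega,
      zpow_add₀ h0, zpow_natCast]
    field_simp
  have hmem : s ∈ idealSections g ι m.toNat := by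
    refine ⟨mem_twistSections_of_rat g ho hs, fun b => ?_⟩
    rw [Scheme.Hom.app_eq_appLE]
    refine (pull_res ι inf_le_right (le_refl _) _).trans ?_
    refine (res_pull ι (le_refl _) (ι.preimage_mono inf_le_right) _).symm.trans ?_
    rw [map_mul, hc, zero_mul, map_zero]
  have hle : m.toNat ≤ n := by
    have : (a j - a i).toNat ≤ spread a :=
      Finset.le_sup (f := fun p : Fin t × Fin t => (a p.1 - a p.2).toNat) (Finset.mem_univ (j, i))
    omega
  rw [hZ _ hle] at hmem
  rw [hs o ho (Opens.mem_top _), show s = 0 from hmem, Pi.zero_apply, map_zero, mul_zero]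

end Liftable

/-! ### Operators attached to rational functions -/

/-- A multiplicative relation between a field extension and an algebra is the graph of a
homomorphism, if it is single-valued and its domain generates the field. -/
lemma exists_algHom_of_graph {K L A V : Type*} [Field K] [Field L] [Ring A] [Algebra K L] [Algebra K A]
    [Algebra.IsAlgebraic K L] (x : V → L) (T : V → A) (P : Subalgebra K (L × A))
    (hmem : ∀ v, (x v, T v) ∈ P) (hinj : ∀ z ∈ P, z.1 = 0 → z.2 = 0)
    (hgen : Subfield.closure (Set.range (algebraMap K L) ∪ Set.range x) = ⊤) :
    ∃ Φ : L →ₐ[K] A, ∀ v, Φ (x v) = T v := by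
  let p : P →ₐ[K] L := (AlgHom.fst K L A).comp P.val
  have hp : Function.Injective p := by
    rw [injective_iff_map_eq_zero]
    intro z hz
    exact Subtype.ext (Prod.ext hz (hinj z.1 z.2 hz))
  have hps : Function.Surjective p := by
    -- A K-subalgebra of an algebraic extension is a field, so the domain of the relation contains
    -- everything the generators produce, inverses included.
    let S := p.range.toIntermediateField' (Subalgebra.isField_of_algebraic _)
    have h1 : Subfield.closure (Set.range (algebraMap K L) ∪ Set.range x) ≤ S.toSubfield := by
      rw [Subfield.closure_le]
      rintro _ (⟨c, rfl⟩ | ⟨v, rfl⟩)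
      · exact S.algebraMap_mem c
      · exact ⟨⟨_, hmem v⟩, rfl⟩
    rw [hgen] at h1
    exact fun y => h1 (show y ∈ (⊤ : Subfield L) from trivial)
  let e := AlgEquiv.ofBijective p ⟨hp, hps⟩
  refine ⟨((AlgHom.snd K L A).comp P.val).comp e.symm.toAlgHom, fun v => ?_⟩
  have : e.symm (x v) = ⟨_, hmem v⟩ := e.injective (by rw [AlgEquiv.apply_symm_apply]; rfl)
  change ((e.symm (x v)).1).2 = _
  rw [this]

lemma mul_mem_of_span {k B : Type*} [CommSemiring k] [Semiring B] [Algebra k B] {S T : Set B}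
    {P : Submodule k B} (h : ∀ s ∈ S, ∀ t ∈ T, s * t ∈ P) {y z : B} (hy : y ∈ Submodule.span k S)
    (hz : z ∈ Submodule.span k T) : y * z ∈ P := by
  have := Submodule.mul_mem_mul hy hz
  rw [Submodule.span_mul_span] at this
  refine Submodule.span_le.mpr ?_ this
  rintro _ ⟨s, hs, t, ht, rfl⟩
  exact h s hs t ht

section Eval

variable {k : Type u} [Field k] {N : ℕ} {X : Scheme.{u}} (h : X ⟶ PSpace k N)

lemma mul_mem_bigPart {Y : Scheme.{u}} (f : Y ⟶ X) {d e : ℕ} {y z : BigRing f h}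
    (hy : y ∈ bigPart f h d) (hz : z ∈ bigPart f h e) : y * z ∈ bigPart f h (d + e) := by
  rw [bigPart_eq_span] at hy hz
  refine mul_mem_of_span (k := k) (B := BigRing f h) ?_ hy hz
  rintro _ ⟨i, r, l, rfl, rfl⟩ _ ⟨i', r', l', rfl, rfl⟩
  rw [bigPart_eq_span]
  refine Submodule.subset_span
    ⟨i + i', GradedMonoid.GMul.mul (A := fun i => sections h i) r r', l ++ l', by rw [List.length_append]; omega, ?_⟩
  have : SMulCommClass k (SectionRing h) (SectionRing h) :=
    Algebra.to_smulCommClass (R := k) (A := SectionRing h)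
  have : IsScalarTower k (SectionRing h) (SectionRing h) :=
    IsScalarTower.right (R := k) (A := SectionRing h)
  simp only [bigMonomial]
  rw [Algebra.TensorProduct.tmul_mul_tmul, DirectSum.of_mul_of, List.map_append, List.prod_append]

variable [IsIntegral X] {o : Fin (N + 1)} (ho : genericPoint X ∈ dom h o)

/-- The sum of the rational functions attached to the components of an element of the section ring. -/
def ratSum : SectionRing h →+* X.functionField := (Polynomial.evalRingHom 1).comp (ratPoly h ho)

lemma ratSum_of {i : ℕ} (s : sections h i) : ratSum h ho (DirectSum.of (fun i => sections h i) i s) =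
    rat h ho (Opens.mem_top _) s.1 := by
  rw [ratSum, RingHom.comp_apply, ratPoly_of]
  simp

lemma ratSum_algebraMap (c : k) : ratSum h ho (algebraMap k _ c) = scalarGen h c := by
  refine (ratSum_of h ho (algebraMap k (SetLike.GradeZero.subalgebra (sections h)) c)).trans ?_
  have : ((algebraMap k (SetLike.GradeZero.subalgebra (sections h)) c) : ChartFun h ⊤) = c • 1 := by
    rw [← Algebra.algebraMap_eq_smul_one]; rfl
  refine (congrArg (rat h ho (Opens.mem_top _)) this).trans ?_
  rw [rat_smul_const, rat_one, mul_one]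

/-- Setting x_o = 1 is not injective on the whole section ring, but it is on each homogeneous piece.
This is why the arguments about the function field keep track of degrees. -/
lemma eq_zero_of_ratSum {i : ℕ} (s : sections h i)
    (hs : ratSum h ho (DirectSum.of (fun i => sections h i) i s) = 0) : s = 0 := by
  rw [ratSum_of] at hs
  refine Subtype.ext (twistSections_ext h ho (n := i) s.2 (zero_mem _) fun _ => ?_)
  exact hs.trans (rat_zero _ _ _).symm

/-- The evaluation of `R ⊗ Sym H⁰(𝒪_X(1))` at the rational functions of `R` and at given values on
`H⁰(𝒪_X(1))`. -/
lemma exists_evalBig {Y : Scheme.{u}} (f : Y ⟶ X) {A : Type u} [CommRing A] [Algebra X.functionField A]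
    (T : sections (f ≫ h) 1 → A) (hadd : ∀ v w, T (v + w) = T v + T w)
    (hsmul : ∀ (c : k) v, T (c • v) = scalarGen h c • T v) :
    ∃ ρ : BigRing f h →+* A, (∀ (c : k) z, ρ (c • z) = scalarGen h c • ρ z) ∧
      ∀ {i : ℕ} (r : sections h i) (l : List (sections (f ≫ h) 1)), ρ (bigMonomial f h r l) =
        algebraMap _ A (rat h ho (Opens.mem_top _) r.1) * (l.map T).prod := by
  let : Algebra k A := ((algebraMap X.functionField A).comp (scalarGen h)).toAlgebra
  let r₀ : SectionRing h →ₐ[k] A :=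
    { (algebraMap X.functionField A).comp (ratSum h ho) with
      commutes' := fun c => congrArg (algebraMap X.functionField A) (ratSum_algebraMap h ho c) }
  let l₀ : sections (f ≫ h) 1 →ₗ[k] A :=
    { toFun := T
      map_add' := hadd
      map_smul' := fun c v => by
        rw [hsmul, Algebra.smul_def, RingHom.id_apply, Algebra.smul_def]
        rfl }
  refine ⟨(Algebra.TensorProduct.productMap r₀ (SymmetricAlgebra.lift l₀)).toRingHom,
    fun c z => ?_, fun r l => ?_⟩
  · refine (map_smul (Algebra.TensorProduct.productMap r₀ (SymmetricAlgebra.lift l₀)) c z).trans ?_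
    rw [Algebra.smul_def, Algebra.smul_def]
    rfl
  refine (Algebra.TensorProduct.productMap_apply_tmul _ _ _ _).trans ?_
  congr 1
  · exact congrArg (algebraMap X.functionField A) (ratSum_of h ho r)
  · rw [map_list_prod, List.map_map]
    congr 2
    funext v
    exact SymmetricAlgebra.lift_ι_apply _ v

end Eval

/-! ### The extension of function fields -/

section FieldMap

variable {X Y : Scheme.{u}} [IsIntegral X] [IsIntegral Y] (f : X ⟶ Y)

/-- Generalisations lift along a flat morphism, so some point of X maps to the generic point of Y,
and it specialises to no point more generic than that of X. -/
lemma map_genericPoint [Flat f] : f (genericPoint X) = genericPoint Y := by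
  have h : genericPoint Y ⤳ f (genericPoint X) := genericPoint_specializes _
  obtain ⟨x, hx, hfx⟩ := Flat.generalizingMap f h
  have : x = genericPoint X := ((genericPoint_specializes x).antisymm hx).eq.symm
  rw [← this, hfx]

lemma genericPoint_mem_preimage [Flat f] {U : Y.Opens} (hU : genericPoint Y ∈ U) :
    genericPoint X ∈ f ⁻¹ᵁ U := by
  rw [← map_genericPoint f] at hU
  exact hU

lemma genericPoint_mem_of_preimage {U : Y.Opens} (hU : genericPoint X ∈ f ⁻¹ᵁ U) :
    genericPoint Y ∈ U := genericPoint_mem (x := f (genericPoint X)) hU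

/-- The extension of function fields induced by a dominant morphism. -/
def fieldMap [Flat f] : Y.functionField →+* X.functionField :=
  (Y.presheaf.stalkSpecializes (specializes_of_eq (map_genericPoint f).symm.symm) ≫
    f.stalkMap (genericPoint X)).hom

lemma fieldMap_gen [Flat f] {U : Y.Opens} (hU : genericPoint Y ∈ U) (r : Γ(Y, U)) :
    fieldMap f (gen U hU r) = gen _ (genericPoint_mem_preimage f hU) (pull f (le_refl _) r) := by
  rw [pull, ← Scheme.Hom.app_eq_appLE]
  refine Eq.trans ?_ (Scheme.Hom.germ_stalkMap_apply f U (genericPoint X) _ r)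
  rw [fieldMap, CommRingCat.comp_apply]
  refine congrArg (f.stalkMap (genericPoint X)) ?_
  exact ConcreteCategory.congr_hom (Y.presheaf.germ_stalkSpecializes hU _) r

variable {k : Type u} [Field k] {N : ℕ} (g : Y ⟶ PSpace k N) {o : Fin (N + 1)}
  (ho : genericPoint Y ∈ dom g o)

include ho in
lemma mem_dom_comp [Flat f] : genericPoint X ∈ dom (f ≫ g) o := genericPoint_mem_preimage f ho

lemma fieldMap_tau [Flat f] (b : Fin (N + 1)) :
    fieldMap f (tau g ho b) = tau (f ≫ g) (mem_dom_comp f g ho) b := by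
  rw [tau, fieldMap_gen, pull_transFun]
  rfl

lemma fieldMap_rat [Flat f] {i : ℕ} (r : sections g i) :
    fieldMap f (rat g ho (Opens.mem_top _) r.1) =
      rat (f ≫ g) (mem_dom_comp f g ho) (Opens.mem_top _) (pullSections f g i r).1 := by
  rw [rat_eq_gen_chartVal, fieldMap_gen, ← upVal_pullSections, rat_eq_gen_chartVal]
  rfl

lemma fieldMap_scalarGen [Flat f] (c : k) : fieldMap f (scalarGen g c) = scalarGen (f ≫ g) c := by
  rw [scalarGen, RingHom.comp_apply, fieldMap_gen, pull_scalar, gen_scalar]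

include ho in
lemma isAlgebraic_fieldMap [Flat f] [IsFinite f] [IsAffineHom g] :
    letI := (fieldMap f).toAlgebra
    Algebra.IsAlgebraic Y.functionField X.functionField := by
  let := (fieldMap f).toAlgebra
  have hU : IsAffineOpen (f ⁻¹ᵁ dom g o) := (isAffineOpen_dom g o).preimage f
  have hint (s : Γ(X, f ⁻¹ᵁ dom g o)) :
      _root_.IsIntegral Y.functionField (gen _ (genericPoint_mem_preimage f ho) s) := by
    have h1 := (f.isIntegral_app (dom g o) (isAffineOpen_dom g o) s).map
      (gen _ (genericPoint_mem_preimage f ho))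
    obtain ⟨p, hp, hps⟩ := h1
    refine ⟨p.map (gen _ ho), hp.map _, ?_⟩
    rw [Polynomial.eval₂_map, ← hps]
    congr 1
    refine RingHom.ext fun r => (fieldMap_gen f ho r).trans ?_
    rw [pull, ← Scheme.Hom.app_eq_appLE]
    rfl
  refine ⟨fun x => ?_⟩
  obtain ⟨s, t, ht, hst⟩ := exists_gen_div hU (genericPoint_mem_preimage f ho) x
  rw [eq_div_of_mul_eq ht hst, div_eq_mul_inv]
  exact (hint s).isAlgebraic.mul (hint t).isAlgebraic.inv

end FieldMap

/-! ### K(Y) as the degree-zero fractions of R. -/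

section Fractions

variable {k : Type u} [Field k] {N : ℕ} {Y : Scheme.{u}} [IsIntegral Y] (g : Y ⟶ PSpace k N)
  {o : Fin (N + 1)} (ho : genericPoint Y ∈ dom g o)

/-- The product of two sections. -/
def mulSections {i j : ℕ} (p : sections g i) (q : sections g j) : sections g (i + j) :=
  ⟨p.1 * q.1, SetLike.GradedMul.mul_mem p.2 q.2⟩

lemma rat_mulSections {i j : ℕ} (p : sections g i) (q : sections g j) :
    rat g ho (Opens.mem_top _) (mulSections g p q).1 =
      rat g ho (Opens.mem_top _) p.1 * rat g ho (Opens.mem_top _) q.1 := rat_mul _ _ _ _ _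

/-- The chart ring is generated by constants and ratios x_b / x_o, which are quotients of sections
of equal degree. Such quotients are stable under the ring operations and division. -/
lemma exists_rat_div [IsClosedImmersion g] (c : Y.functionField) : ∃ (d : ℕ) (p q : sections g d),
    rat g ho (Opens.mem_top _) q.1 ≠ 0 ∧
      c * rat g ho (Opens.mem_top _) q.1 = rat g ho (Opens.mem_top _) p.1 := by
  have key (s : Γ(Y, dom g o)) : ∃ (d : ℕ) (p q : sections g d),
      rat g ho (Opens.mem_top _) q.1 ≠ 0 ∧
        gen _ ho s * rat g ho (Opens.mem_top _) q.1 = rat g ho (Opens.mem_top _) p.1 := by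
    have hs : s ∈ Subring.closure (Set.range (scalar g (dom g o)) ∪ Set.range (transFun g o)) := by
      rw [closure_dom]; trivial
    induction hs using Subring.closure_induction with
    | mem s hs =>
      rcases hs with ⟨c, rfl⟩ | ⟨b, rfl⟩
      · refine ⟨0, c • ⟨1, SetLike.GradedOne.one_mem⟩, ⟨1, SetLike.GradedOne.one_mem⟩, ?_, ?_⟩
        · rw [rat_one]; exact one_ne_zero
        · rw [Submodule.coe_smul, rat_smul_const, rat_one, gen_scalar]
      · refine ⟨1, coordSection g b, coordSection g o, ?_, ?_⟩
        · rw [rat_coordSection, tau_self]; exact one_ne_zero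
        · rw [rat_coordSection, rat_coordSection, tau_self, mul_one, tau]
    | zero => exact ⟨0, 0, ⟨1, SetLike.GradedOne.one_mem⟩, by rw [rat_one]; exact one_ne_zero,
        by rw [map_zero, zero_mul]; exact (rat_zero _ _ _).symm⟩
    | one => exact ⟨0, ⟨1, SetLike.GradedOne.one_mem⟩, ⟨1, SetLike.GradedOne.one_mem⟩,
        by rw [rat_one]; exact one_ne_zero, by rw [map_one, one_mul]⟩
    | add x y _ _ hx hy =>
      obtain ⟨d, p, q, hq, hx⟩ := hx
      obtain ⟨d', p', q', hq', hy⟩ := hy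
      refine ⟨d + d', mulSections g p q' + mulSections g q p', mulSections g q q', ?_, ?_⟩
      · rw [rat_mulSections]; exact mul_ne_zero hq hq'
      · rw [Submodule.coe_add, rat_add, rat_mulSections, rat_mulSections, rat_mulSections, ← hx, ← hy, map_add]
        ring
    | neg x _ hx =>
      obtain ⟨d, p, q, hq, hx⟩ := hx
      refine ⟨d, (-1 : k) • p, q, hq, ?_⟩
      rw [Submodule.coe_smul, rat_smul_const, ← hx, map_neg, map_neg, map_one]
      ring
    | mul x y _ _ hx hy =>
      obtain ⟨d, p, q, hq, hx⟩ := hx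
      obtain ⟨d', p', q', hq', hy⟩ := hy
      refine ⟨d + d', mulSections g p p', mulSections g q q', ?_, ?_⟩
      · rw [rat_mulSections]; exact mul_ne_zero hq hq'
      · rw [rat_mulSections, rat_mulSections, ← hx, ← hy, map_mul]
        ring
  obtain ⟨s, t, ht, hst⟩ := exists_gen_div (isAffineOpen_dom g o) ho c
  obtain ⟨d, p, q, hq, hs⟩ := key s
  obtain ⟨d', p', q', hq', ht'⟩ := key t
  refine ⟨d + d', mulSections g p q', mulSections g q p', ?_, ?_⟩
  · rw [rat_mulSections, ← ht']
    exact mul_ne_zero hq (mul_ne_zero ht hq')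
  · rw [rat_mulSections, rat_mulSections, ← ht', ← hs, ← hst]
    ring

end Fractions

/-! ### From commuting operators to an action of K(X). -/

section FieldAction

variable {k : Type u} [Field k] {N : ℕ} {X Y Z : Scheme.{u}} [IsIntegral Y] {f : X ⟶ Y}
  {g : Y ⟶ PSpace k N} {t : ℕ} {a : Fin t → ℤ} {ι : Z ⟶ Y} {F : (Limits.pullback f ι).Modules}
  {φ : (Scheme.Modules.pushforward (Limits.pullback.snd f ι)).obj F ≅
    (Scheme.Modules.pullback ι).obj (dissocie g a)}
  {α : tensor ((Scheme.Modules.pushforward f).obj (structureModule X)) (dissocie g a) ⟶ dissocie g a}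
  {o : Fin (N + 1)} (ho : genericPoint Y ∈ dom g o)

/-- The commutator lifts multiplication by v w - w v = 0 in degree 2, so separation kills it. This
accounts for the 2 in the bound. -/
lemma sectionOp_mul_comm (hα : IsRestrictionOf f ι (dissocie g a) φ α) {n : ℕ}
    (hn : 2 + spread a ≤ n) (hZ : IsSeparating g ι n) (v w : sections (f ≫ g) 1) :
    sectionOp f g a ho α v * sectionOp f g a ho α w = sectionOp f g a ho α w * sectionOp f g a ho α v := by
  have h1 := (liftsMul_sectionOp (ho := ho) hα v).mul (liftsMul_sectionOp (ho := ho) hα w)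
  have h2 := ((liftsMul_sectionOp (ho := ho) hα w).mul (liftsMul_sectionOp (ho := ho) hα v)).scalar_smul (-1)
  have h3 := h1.add h2
  rw [mul_comm w.1, neg_one_smul, add_neg_cancel, map_neg, map_one] at h3
  refine sub_eq_zero.mp (Eq.trans ?_ (h3.eq_zero hn hZ))
  rw [sub_eq_add_neg]
  congr 1
  exact (neg_one_smul _ _).symm

lemma liftsMul_prod (hα : IsRestrictionOf f ι (dissocie g a) φ α) (l : List (sections (f ≫ g) 1)) :
    LiftsMul f g a ι φ ho l.length (l.map (sectionOp f g a ho α)).prod (l.map Subtype.val).prod := by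
  induction l with
  | nil =>
    intro b hb e
    refine ⟨e, by simp, ?_⟩
    simp only [List.map_nil, List.prod_nil, map_one]
    rw [← map_one (pull (Limits.pullback.snd f ι) (le_refl _)), pull_action, one_smul]
  | cons v l ih =>
    rw [List.map_cons, List.prod_cons, List.map_cons, List.prod_cons, List.length_cons, add_comm]
    exact (liftsMul_sectionOp hα v).mul ih

/-- A ring homomorphism from `R ⊗ Sym H⁰(𝒪_X(1))` to the endomorphisms of the generic fibre which has
the expected values on monomials lifts the multiplication with sections. -/
lemma liftsMul_of_bigMonomial (hα : IsRestrictionOf f ι (dissocie g a) φ α)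
    (ρ : BigRing f g →+ Module.End Y.functionField (Fin t → Y.functionField))
    (hρ : ∀ {i : ℕ} (r : sections g i) (l : List (sections (f ≫ g) 1)), ρ (bigMonomial f g r l) =
      rat g ho (Opens.mem_top _) r.1 • (l.map (sectionOp f g a ho α)).prod)
    (hρk : ∀ (c : k) z, ρ (c • z) = scalarGen g c • ρ z) {d : ℕ} {z : BigRing f g} (hz : z ∈ bigPart f g d) :
    LiftsMul f g a ι φ ho d (ρ z) (DirectSum.coeAlgHom (sections (f ≫ g)) (bigMap f g z)) := by
  rw [bigPart_eq_span] at hz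
  induction hz using Submodule.span_induction with
  | mem z hz =>
    obtain ⟨i, r, l, rfl, rfl⟩ := hz
    have h1 := (liftsMul_pullSections (ho := ho) (f := f) (ι := ι) (a := a) (φ := φ) r).mul
      (liftsMul_prod ho hα l)
    rw [hρ, bigMap_bigMonomial, map_mul, map_list_prod, List.map_map]
    rw [smul_mul_assoc, one_mul] at h1
    convert h1 using 2
    · exact DirectSum.coeAlgHom_of (sections (f ≫ g)) _ _
    · congr 2
      funext v
      exact DirectSum.coeAlgHom_of (sections (f ≫ g)) _ _
  | zero => rw [map_zero, map_zero, map_zero]; exact LiftsMul.zero d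
  | add x y _ _ hx hy => rw [map_add, map_add, map_add]; exact hx.add hy
  | smul c x _ hx => rw [hρk, map_smul, map_smul]; exact hx.scalar_smul c

variable [IsIntegral X]

open scoped IsMulCommutative in
set_option maxHeartbeats 1000000 in
/-- The action of the function field of `X` on the generic fibre of `E`. -/
lemma exists_fieldAction [Flat f] [IsFinite f] [IsClosedImmersion g]
    (hgen : Subfield.closure (Set.range (fieldMap f) ∪ Set.range fun v : sections (f ≫ g) 1 =>
      rat (f ≫ g) (mem_dom_comp f g ho) (Opens.mem_top _) v.1) = ⊤)
    (hα : IsRestrictionOf f ι (dissocie g a) φ α) {m n : ℕ} (hm : GeneratedInDegreeLE f g m)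
    (hn : max 2 m + spread a ≤ n) (hZ : IsSeparating g ι n) :
    ∃ Φ : X.functionField →+* Module.End Y.functionField (Fin t → Y.functionField),
      (∀ c, Φ (fieldMap f c) = algebraMap _ _ c) ∧ ∀ v : sections (f ≫ g) 1,
        Φ (rat (f ≫ g) (mem_dom_comp f g ho) (Opens.mem_top _) v.1) = sectionOp f g a ho α v := by
  have hcomm : ∀ x ∈ Set.range (sectionOp f g a ho α), ∀ y ∈ Set.range (sectionOp f g a ho α),
      x * y = y * x := by
    rintro _ ⟨v, rfl⟩ _ ⟨w, rfl⟩
    exact sectionOp_mul_comm ho hα (n := n) (by omega) hZ v w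
  -- Symmetric algebras map only to commutative algebras, so the target is cut down to the
  -- subalgebra generated by the commuting operators.
  obtain ⟨A, hA, hAT⟩ : ∃ A : Subalgebra Y.functionField (Module.End Y.functionField
      (Fin t → Y.functionField)), IsMulCommutative A ∧ ∀ v, sectionOp f g a ho α v ∈ A :=
    ⟨_, Algebra.isMulCommutative_adjoin Y.functionField hcomm, fun v => Algebra.subset_adjoin ⟨v, rfl⟩⟩
  obtain ⟨ρ₀, hρk, hρ₀⟩ := exists_evalBig g ho f (A := A)
    (fun v => ⟨sectionOp f g a ho α v, hAT v⟩)
    (fun v w => Subtype.ext (sectionOp_add f g a ho α v w))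
    (fun c v => Subtype.ext (sectionOp_smul f g a ho α c v))
  let ρ : BigRing f g →+* Module.End Y.functionField (Fin t → Y.functionField) := A.val.toRingHom.comp ρ₀
  have hρ {i : ℕ} (r : sections g i) (l : List (sections (f ≫ g) 1)) : ρ (bigMonomial f g r l) =
      rat g ho (Opens.mem_top _) r.1 • (l.map (sectionOp f g a ho α)).prod := by
    change A.val (ρ₀ _) = _
    rw [hρ₀, map_mul, map_list_prod, List.map_map, AlgHom.commutes, ← Algebra.smul_def]
    rfl
  -- A generator of I_X of degree at most m acts as a lift of multiplication by 0 and hence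
  -- vanishes. This accounts for n_X in the bound.
  have hker : relationIdeal f g ≤ RingHom.ker ρ₀ := by
    rw [← show Ideal.span _ = relationIdeal f g from hm, Ideal.span_le]
    rintro z ⟨hz, d, hd, hzd⟩
    have h1 := liftsMul_of_bigMonomial ho hα ρ.toAddMonoidHom hρ
      (fun c z => congrArg Subtype.val (hρk c z)) hzd
    rw [show bigMap f g z = 0 from hz, map_zero] at h1
    have h2 : d ≤ max 2 m := hd.trans (le_max_right _ _)
    exact Subtype.ext (h1.eq_zero (n := n) (by omega) hZ)
  let ev : BigRing f g →+* X.functionField := (ratSum (f ≫ g) (mem_dom_comp f g ho)).comp (bigMap f g).toRingHom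
  have hev {i : ℕ} (r : sections g i) (l : List (sections (f ≫ g) 1)) : ev (bigMonomial f g r l) =
      fieldMap f (rat g ho (Opens.mem_top _) r.1) * (l.map fun v => rat (f ≫ g) (mem_dom_comp f g ho)
        (Opens.mem_top _) v.1).prod := by
    change ratSum (f ≫ g) _ (bigMap f g _) = _
    rw [bigMap_bigMonomial, map_mul, map_list_prod, List.map_map, ratSum_of, fieldMap_rat]
    congr 3
    funext v
    exact ratSum_of _ _ _
  have hρq {i : ℕ} (r : sections g i) : ρ (bigMonomial f g r []) = rat g ho (Opens.mem_top _) r.1 • 1 := by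
    rw [hρ]; rfl
  have hevq {i : ℕ} (r : sections g i) : ev (bigMonomial f g r []) =
      fieldMap f (rat g ho (Opens.mem_top _) r.1) := by
    rw [hev]; exact mul_one _
  let := (fieldMap f).toAlgebra
  have := isAlgebraic_fieldMap f g ho
  -- P is the graph of the action with denominators from R: q y = ev z and q B = ρ z. Requiring z to
  -- be homogeneous of the degree of q costs nothing and ensures that ev z = 0 puts z in I_X, which
  -- makes the graph single-valued.
  let P : Subalgebra Y.functionField
      (X.functionField × Module.End Y.functionField (Fin t → Y.functionField)) :=
    { carrier := {y | ∃ (d : ℕ) (q : sections g d), ∃ z ∈ bigPart f g d,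
        rat g ho (Opens.mem_top _) q.1 ≠ 0 ∧ fieldMap f (rat g ho (Opens.mem_top _) q.1) * y.1 = ev z ∧
          rat g ho (Opens.mem_top _) q.1 • y.2 = ρ z}
      mul_mem' := by
        rintro y y' ⟨d, q, z, hz, hq, h1, h2⟩ ⟨d', q', z', hz', hq', h1', h2'⟩
        refine ⟨d + d', mulSections g q q', z * z', mul_mem_bigPart g f hz hz', ?_, ?_, ?_⟩
        · rw [rat_mulSections]; exact mul_ne_zero hq hq'
        · rw [rat_mulSections, map_mul, map_mul, ← h1, ← h1', Prod.fst_mul]; ring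
        · rw [rat_mulSections, map_mul, ← h2, ← h2', Prod.snd_mul, smul_mul_smul_comm]
      add_mem' := by
        rintro y y' ⟨d, q, z, hz, hq, h1, h2⟩ ⟨d', q', z', hz', hq', h1', h2'⟩
        refine ⟨d + d', mulSections g q q', z * bigMonomial f g q' [] + bigMonomial f g q [] * z',
          add_mem (mul_mem_bigPart g f hz (bigMonomial_mem f g q' []))
            (mul_mem_bigPart g f (bigMonomial_mem f g q []) hz'), ?_, ?_, ?_⟩
        · rw [rat_mulSections]; exact mul_ne_zero hq hq'
        · rw [rat_mulSections, map_add, map_mul, map_mul, map_mul, hevq, hevq, ← h1, ← h1', Prod.fst_add]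
          ring
        · rw [rat_mulSections, map_add, map_mul, map_mul, hρq, hρq, ← h2, ← h2', Prod.snd_add, smul_add,
            mul_smul_comm, mul_one, smul_mul_assoc, one_mul, smul_smul, smul_smul, mul_comm]
      algebraMap_mem' := by
        intro c
        obtain ⟨d, p, q, hq, hc⟩ := exists_rat_div g ho c
        refine ⟨d, q, bigMonomial f g p [], bigMonomial_mem f g p [], hq, ?_, ?_⟩
        · rw [hevq, ← hc, map_mul, mul_comm]
          rfl
        · rw [hρq, ← hc, mul_comm c, ← smul_smul]
          exact congrArg _ (Algebra.algebraMap_eq_smul_one c) }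
  have hmem : ∀ v : sections (f ≫ g) 1, (rat (f ≫ g) (mem_dom_comp f g ho) (Opens.mem_top _) v.1,
      sectionOp f g a ho α v) ∈ P := by
    intro v
    have h1 := bigMonomial_mem f g (⟨1, SetLike.GradedOne.one_mem⟩ : sections g 0) [v]
    refine ⟨1, coordSection g o, _, h1, ?_, ?_, ?_⟩
    · rw [rat_coordSection, tau_self]; exact one_ne_zero
    · rw [hev, rat_coordSection, tau_self, rat_one]; simp
    · rw [hρ, rat_coordSection, tau_self, rat_one]; simp
  have hinj : ∀ y ∈ P, y.1 = 0 → y.2 = 0 := by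
    rintro y ⟨d, q, z, hz, hq, h1, h2⟩ hy
    rw [hy, mul_zero] at h1
    obtain ⟨s, hs⟩ := bigMap_of_mem_bigPart f g hz
    have h3 : s = 0 := by
      refine eq_zero_of_ratSum (f ≫ g) (mem_dom_comp f g ho) s ?_
      rw [← hs]
      exact h1.symm
    have h4 : z ∈ relationIdeal f g := by
      rw [relationIdeal, RingHom.mem_ker, hs, h3, map_zero]
    have h5 : ρ z = 0 := congrArg Subtype.val (hker h4)
    rw [h5] at h2
    exact (smul_eq_zero_iff_right hq).mp h2
  obtain ⟨Φ, hΦ⟩ := exists_algHom_of_graph _ _ P hmem hinj hgen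
  exact ⟨Φ.toRingHom, fun c => Φ.commutes c, hΦ⟩

end FieldAction

/-! ### Very ampleness -/

section TwistValues

variable {k : Type u} [Field k] {N : ℕ} {X : Scheme.{u}} (h : X ⟶ PSpace k N) {n : ℤ}

/-- The family of functions attached to a section of `𝒪_X(n)`. -/
def twistVal {U : X.Opens} (s : Γ(twist h n, U)) : twistSections h n U := s

/-- The section of `𝒪_X(n)` attached to a family of functions. -/
def ofTwistVal {U : X.Opens} (s : twistSections h n U) : Γ(twist h n, U) := s

lemma twistVal_modRes {U V : X.Opens} (hV : V ≤ U) (s : Γ(twist h n, U)) :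
    (twistVal h (modRes _ hV s)).1 = resFun h hV (twistVal h s).1 := rfl

lemma twistVal_smul {U : X.Opens} (r : Γ(X, U)) (s : Γ(twist h n, U)) :
    (twistVal h (r • s)).1 = r • (twistVal h s).1 := rfl

lemma coordSection_mem (b : Fin (N + 1)) : (coordSection h b).1 ∈ twistSections h 1 ⊤ :=
  (coordSection h b).2

/-- The coordinate section x_b generates 𝒪(1) over its own chart. -/
lemma coord_eq_smul {b : Fin (N + 1)} (s : Γ(twist h 1, dom h b)) :
    s = res (le_inf le_rfl le_rfl) ((twistVal h s).1 b) •
      modRes _ le_top (ofTwistVal h ⟨_, coordSection_mem h b⟩) := by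
  refine Subtype.ext (funext fun c => ?_)
  have h1 := (twistVal h s).2 c b
  have h2 : dom h b ⊓ dom h c ≤ dom h b ⊓ (dom h c ⊓ dom h b) := le_inf inf_le_left (le_inf inf_le_right inf_le_left)
  have h3 := congrArg (res h2) h1
  simp only [map_mul, map_pow, res_res] at h3
  change (twistVal h s).1 c = (res (le_inf le_rfl le_rfl) ((twistVal h s).1 b) •
    (resFun h le_top (coordSection h b).1 : ChartFun h (dom h b))) c
  rw [smul_chartFun, resFun_apply, res_res]
  simp only [coordSection, res_res]
  rw [show (-(1 : ℤ)).toNat = 0 from rfl, show (1 : ℤ).toNat = 1 from rfl, pow_zero, one_mul, pow_one,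
    res_self] at h3
  rw [mul_comm]
  exact h3

lemma modRes_coordSection (b c : Fin (N + 1)) :
    modRes (twist h 1) (le_top : dom h b ≤ ⊤) (ofTwistVal h ⟨_, coordSection_mem h c⟩) =
      transFun h b c • modRes _ le_top (ofTwistVal h ⟨_, coordSection_mem h b⟩) := by
  refine (coord_eq_smul h _).trans ?_
  congr 1
  change res _ (res _ (res _ (transFun h b c))) = _
  rw [res_res, res_res, res_self]

end TwistValues

section VeryAmple

variable {k : Type u} [Field k] {N : ℕ} {X : Scheme.{u}} (h : X ⟶ PSpace k N)

/-- Homogeneous coordinates `y` for a closed immersion `j` which is given by sections of `𝒪_X(1)`. -/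
structure EmbeddingCoordinates {M : ℕ} (j : X ⟶ PSpace k M) where
  /-- the homogeneous coordinates -/
  y : Fin (M + 1) → sections h 1
  /-- the quotients `x_a / y_b` -/
  l : Fin (N + 1) → ∀ b, Γ(X, dom j b)
  scalar_eq : ∀ (U : X.Opens) c, scalar j U c = scalar h U c
  trans_y : ∀ b c a, res inf_le_right (chartVal h a (y c).1) =
    (res inf_le_left (transFun j b c) * res inf_le_right (chartVal h a (y b).1) : Γ(X, dom j b ⊓ dom h a))
  trans_x : ∀ a b c, res inf_le_right (transFun h c a) =
    (res inf_le_left (l a b) * res inf_le_right (chartVal h c (y b).1) : Γ(X, dom j b ⊓ dom h c))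

/-- The y_b are the images of the coordinates of ℙ^M under the isomorphism of line bundles. The
quotients x_a / y_b arise by carrying x_a back and reading it in the trivialisation given by y_b. -/
lemma exists_embeddingCoordinates (hX : IsVeryAmple (h ≫ PSpace.toSpec k N) (twist h 1)) :
    ∃ (M : ℕ) (j : X ⟶ PSpace k M), IsClosedImmersion j ∧ Nonempty (EmbeddingCoordinates h j) := by
  obtain ⟨M, j, hj, hp, ⟨e⟩⟩ := hX
  refine ⟨M, j, hj, ⟨?_⟩⟩
  let x (b : Fin (M + 1)) : Γ(twist j 1, ⊤) := ofTwistVal j ⟨_, coordSection_mem j b⟩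
  let x' (b : Fin (N + 1)) : Γ(twist h 1, ⊤) := ofTwistVal h ⟨_, coordSection_mem h b⟩
  let y (b) := e.hom.app ⊤ (x b)
  have hval (U : X.Opens) (s : Γ(twist h 1, ⊤)) (b : Fin (M + 1)) (a : Fin (N + 1)) :
      (twistVal h (modRes _ (le_top : dom j b ≤ ⊤) s)).1 a =
        res inf_le_right (chartVal h a (twistVal h s).1) := by
    rw [twistVal_modRes, resFun_apply, chartVal, RingHom.comp_apply, res_res]
    rfl
  let ξ (a : Fin (N + 1)) (b : Fin (M + 1)) : Γ(twist j 1, dom j b) :=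
    e.inv.app _ (modRes _ le_top (x' a))
  refine
    { y b := ⟨(twistVal h (y b)).1, (twistVal h (y b)).2⟩
      l a b := res (le_inf le_rfl le_rfl) ((twistVal j (ξ a b)).1 b)
      scalar_eq := ?_
      trans_y := ?_
      trans_x := ?_ }
  · intro U c
    simp only [scalar, hp]
  · intro b c a
    have h1 := congrArg (fun s => (twistVal h (e.hom.app _ s)).1 a) (modRes_coordSection j b c)
    simp only [Scheme.Modules.Hom.app_smul, app_modRes] at h1
    rw [twistVal_smul, smul_chartFun, hval ⊤, hval ⊤] at h1
    exact h1
  · intro a b c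
    have h1 := congrArg (fun s => (twistVal h (e.hom.app _ s)).1 c) (coord_eq_smul j (ξ a b))
    have h2 : e.hom.app _ (ξ a b) = modRes _ le_top (x' a) := by
      rw [← comp_app_apply, Iso.inv_hom_id]
      rfl
    simp only [Scheme.Modules.Hom.app_smul, app_modRes] at h1
    rw [h2, twistVal_smul, smul_chartFun, hval ⊤, hval ⊤] at h1
    refine Eq.trans ?_ h1
    change _ = res inf_le_right (res _ (res _ (transFun h c a)))
    rw [res_res, res_res]

end VeryAmple

lemma IsAffineOpen.exists_point {X : Scheme.{u}} {U : X.Opens} (hU : IsAffineOpen U)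
    (Q : Ideal Γ(X, U)) (hQ : Q.IsPrime) : ∃ x ∈ U, ∀ s : Γ(X, U), x ∈ X.basicOpen s ↔ s ∉ Q := by
  refine ⟨hU.fromSpec ⟨Q, hQ⟩, ?_, fun s => ?_⟩
  · exact hU.range_fromSpec.subset ⟨_, rfl⟩
  · have := congrArg (fun V : (Spec Γ(X, U)).Opens => (⟨Q, hQ⟩ : PrimeSpectrum Γ(X, U)) ∈ V)
      (hU.fromSpec_preimage_basicOpen s)
    exact this.to_iff

section EmbeddingCoordinates

variable {k : Type u} [Field k] {N : ℕ} {X : Scheme.{u}} {h : X ⟶ PSpace k N} {M : ℕ}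
  {j : X ⟶ PSpace k M} (D : EmbeddingCoordinates h j)

-- Over D₊(y_b) one has x_a = (x_a / y_b) y_b, so x_a generates 𝒪_X(1) wherever the quotient is
-- invertible.
include D in
lemma basicOpen_l_le (a : Fin (N + 1)) (b : Fin (M + 1)) : X.basicOpen (D.l a b) ≤ dom h a := by
  intro z hz
  have hzb : z ∈ dom j b := X.basicOpen_le _ hz
  obtain ⟨c, hzc⟩ := exists_mem_dom h z
  have hW : z ∈ dom j b ⊓ dom h c := mem_inf hzb hzc
  have hg {U : X.Opens} (hU : dom j b ⊓ dom h c ≤ U) (s : Γ(X, U)) :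
      X.presheaf.germ _ z hW (res hU s) = X.presheaf.germ U z (hU hW) s :=
    X.presheaf.germ_res_apply (homOfLE hU) _ hW s
  have h1 := congrArg (X.presheaf.germ _ z hW) (D.trans_x a b c)
  have h2 := congrArg (X.presheaf.germ _ z hW) (D.trans_x c b c)
  rw [map_mul, hg, hg, hg] at h1
  rw [transFun_self, map_one, map_one, map_mul, hg, hg] at h2
  have h3 : IsUnit (X.presheaf.germ _ z hzc (transFun h c a)) := by
    rw [h1]
    exact ((X.mem_basicOpen _ z hzb).mp hz).mul (IsUnit.of_mul_eq_one_right _ h2.symm)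
  have h4 := (X.mem_basicOpen (transFun h c a) z hzc).mpr h3
  rw [basicOpen_transFun] at h4
  exact h4.2

-- The functions x_a / y_b and y_b / x_a are mutually inverse on the overlap of the two charts.
include D in
lemma mem_basicOpen_y {a : Fin (N + 1)} {b : Fin (M + 1)} {x : X} (hb : x ∈ dom j b) (ha : x ∈ dom h a) :
    x ∈ X.basicOpen (chartVal h a (D.y b).1) := by
  have hW : x ∈ dom j b ⊓ dom h a := mem_inf hb ha
  have h2 := congrArg (X.presheaf.germ _ x hW) (D.trans_x a b a)
  rw [transFun_self, map_one, map_one, map_mul] at h2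
  refine (X.mem_basicOpen _ x ha).mpr ?_
  have h3 := IsUnit.of_mul_eq_one_right _ h2.symm
  rwa [show X.presheaf.germ _ x hW (res inf_le_right (chartVal h a (D.y b).1)) = _ from
    X.presheaf.germ_res_apply (homOfLE inf_le_right) _ hW _] at h3

variable [IsIntegral X]

include D in
lemma gen_l_mul_gen_y {a : Fin (N + 1)} {b : Fin (M + 1)} (hb : genericPoint X ∈ dom j b)
    (ha : genericPoint X ∈ dom h a) :
    gen _ hb (D.l a b) * gen _ ha (chartVal h a (D.y b).1) = 1 := by
  have h2 := congrArg (gen _ (mem_inf hb ha)) (D.trans_x a b a)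
  rw [transFun_self, map_one, map_one, map_mul, gen_res, gen_res] at h2
  exact h2.symm

include D in
lemma gen_trans_mul_gen_y {a : Fin (N + 1)} {b : Fin (M + 1)} (c : Fin (M + 1))
    (hb : genericPoint X ∈ dom j b) (ha : genericPoint X ∈ dom h a) :
    gen _ hb (transFun j b c) * gen _ ha (chartVal h a (D.y b).1) = gen _ ha (chartVal h a (D.y c).1) := by
  have h2 := congrArg (gen _ (mem_inf hb ha)) (D.trans_y b c a)
  rw [map_mul, gen_res, gen_res, gen_res] at h2
  exact h2.symm

-- Since j is a closed immersion, functions on D₊(y_b) are polynomials in the y_c / y_b, which are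
-- quotients of values of sections; their fractions fill the function field.
include D in
lemma subfield_eq_top [IsClosedImmersion j] {o : Fin (N + 1)} (ho : genericPoint X ∈ dom h o)
    (S : Subfield X.functionField) (hk : ∀ c, scalarGen h c ∈ S)
    (hv : ∀ v : sections h 1, rat h ho (Opens.mem_top _) v.1 ∈ S) : S = ⊤ := by
  obtain ⟨b, hb⟩ := exists_genericPoint_mem_dom j
  have hy (c) : gen _ ho (chartVal h o (D.y c).1) ∈ S := by
    rw [← rat_eq_gen_chartVal]
    exact hv _
  have hy0 : gen _ ho (chartVal h o (D.y b).1) ≠ 0 :=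
    right_ne_zero_of_mul (ne_of_eq_of_ne (gen_l_mul_gen_y D hb ho) one_ne_zero)
  have key (p : Γ(X, dom j b)) : gen _ hb p ∈ S := by
    have hp : p ∈ Subring.closure (Set.range (scalar j (dom j b)) ∪ Set.range (transFun j b)) := by
      rw [closure_dom]; trivial
    have hle : Subring.closure (Set.range (scalar j (dom j b)) ∪ Set.range (transFun j b)) ≤
        S.toSubring.comap (gen _ hb) := by
      rw [Subring.closure_le]
      rintro _ (⟨c, rfl⟩ | ⟨c, rfl⟩)
      · change gen _ hb _ ∈ S
        rw [D.scalar_eq, gen_scalar]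
        exact hk c
      · change gen _ hb _ ∈ S
        rw [eq_div_of_mul_eq hy0 (gen_trans_mul_gen_y D c hb ho)]
        exact div_mem (hy c) (hy b)
    exact hle hp
  rw [eq_top_iff]
  intro x _
  obtain ⟨s, t, ht, hst⟩ := exists_gen_div (isAffineOpen_dom j b) hb x
  rw [eq_div_of_mul_eq ht hst]
  exact div_mem (key s) (key t)

include D in
/-- A subring of the functions on a chart which contains the values of all sections of `𝒪_X(1)`
contains all functions, up to powers of the homogeneous coordinates. -/
lemma exists_pow_mul_mem [IsClosedImmersion j] {a : Fin (N + 1)} (ha : genericPoint X ∈ dom h a)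
    (B : Subring Γ(X, dom h a)) (hk : ∀ c, scalar h _ c ∈ B)
    (hv : ∀ v : sections h 1, chartVal h a v.1 ∈ B) (s : Γ(X, dom h a)) {b : Fin (M + 1)}
    (hb : genericPoint X ∈ dom j b) : ∃ m, chartVal h a (D.y b).1 ^ m * s ∈ B := by
  -- A polynomial in the y_c / y_b becomes a polynomial in the y_c / x_a after multiplication by a
  -- power of y_b / x_a.
  have key (p : Γ(X, dom j b)) : ∃ m, ∃ β ∈ B,
      gen _ ha (chartVal h a (D.y b).1) ^ m * gen _ hb p = gen _ ha β := by
    have hp : p ∈ Subring.closure (Set.range (scalar j (dom j b)) ∪ Set.range (transFun j b)) := by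
      rw [closure_dom]; trivial
    induction hp using Subring.closure_induction with
    | mem p hp =>
      rcases hp with ⟨c, rfl⟩ | ⟨c, rfl⟩
      · exact ⟨0, _, hk c, by rw [D.scalar_eq, gen_scalar, gen_scalar, pow_zero, one_mul]⟩
      · exact ⟨1, _, hv (D.y c), by rw [pow_one, mul_comm, gen_trans_mul_gen_y D c hb ha]⟩
    | zero => exact ⟨0, 0, zero_mem _, by simp⟩
    | one => exact ⟨0, 1, one_mem _, by simp⟩
    | add x y _ _ hx hy =>
      obtain ⟨m, β, hβ, hx⟩ := hx
      obtain ⟨m', β', hβ', hy⟩ := hy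
      refine ⟨m + m', chartVal h a (D.y b).1 ^ m' * β + chartVal h a (D.y b).1 ^ m * β',
        add_mem (mul_mem (pow_mem (hv _) _) hβ) (mul_mem (pow_mem (hv _) _) hβ'), ?_⟩
      rw [map_add, map_add, map_mul, map_mul, ← hx, ← hy, map_pow, map_pow]
      ring
    | neg x _ hx =>
      obtain ⟨m, β, hβ, hx⟩ := hx
      exact ⟨m, -β, neg_mem hβ, by rw [map_neg, map_neg, ← hx, mul_neg]⟩
    | mul x y _ _ hx hy =>
      obtain ⟨m, β, hβ, hx⟩ := hx
      obtain ⟨m', β', hβ', hy⟩ := hy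
      exact ⟨m + m', β * β', mul_mem hβ hβ', by rw [map_mul, map_mul, ← hx, ← hy]; ring⟩
  have hl := gen_l_mul_gen_y D hb ha
  have hη : genericPoint X ∈ X.basicOpen (D.l a b) :=
    (X.mem_basicOpen _ _ hb).mpr (IsUnit.of_mul_eq_one _ hl)
  have := (isAffineOpen_dom j b).isLocalization_basicOpen (D.l a b)
  -- On the locus where x_a / y_b is invertible, s is p divided by a power of x_a / y_b, that is, p
  -- times a power of y_b / x_a.
  obtain ⟨n, p, hp⟩ := IsLocalization.Away.surj (D.l a b) (res (basicOpen_l_le D a b) s)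
  have hp' := congrArg (gen _ hη) hp
  have hal (q : Γ(X, dom j b)) : gen _ hη (algebraMap _ Γ(X, X.basicOpen (D.l a b)) q) = gen _ hb q :=
    gen_res (X.basicOpen_le _) hη q
  rw [map_mul, gen_res, map_pow, hal, hal] at hp'
  obtain ⟨m, β, hβ, hm⟩ := key p
  refine ⟨m, ?_⟩
  have h1 : chartVal h a (D.y b).1 ^ m * s = β * chartVal h a (D.y b).1 ^ n := by
    refine gen_injective ha ?_
    rw [map_mul, map_mul, map_pow, map_pow, ← hm, ← hp']
    calc _ = gen _ ha (chartVal h a (D.y b).1) ^ m * gen _ ha s *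
          (gen _ hb (D.l a b) * gen _ ha (chartVal h a (D.y b).1)) ^ n := by rw [hl, one_pow, mul_one]
      _ = _ := by ring
  rw [h1]
  exact mul_mem hβ (pow_mem (hv _) _)

include D in
/-- A subring of the functions on a chart which contains the values of all sections of `𝒪_X(1)`, and
over which all functions are integral, contains all functions. -/
lemma subring_eq_top [IsClosedImmersion j] {a : Fin (N + 1)} (hU : IsAffineOpen (dom h a))
    (B : Subring Γ(X, dom h a)) (hk : ∀ c, scalar h _ c ∈ B)
    (hv : ∀ v : sections h 1, chartVal h a v.1 ∈ B) (hint : Algebra.IsIntegral B Γ(X, dom h a)) :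
    B = ⊤ := by
  rw [eq_top_iff]
  intro s _
  -- The ideal of denominators of s relative to B; the claim is that 1 belongs to it.
  let I : Ideal B :=
    { carrier := {b | b.1 * s ∈ B}
      add_mem' := fun {x y} hx hy => by
        change (x.1 + y.1) * s ∈ B
        rw [add_mul]; exact add_mem hx hy
      zero_mem' := by
        change (0 : Γ(X, dom h a)) * s ∈ B
        rw [zero_mul]; exact zero_mem _
      smul_mem' := fun c x hx => by
        change (c.1 * x.1) * s ∈ B
        rw [mul_assoc]; exact mul_mem c.2 hx }
  suffices hI : I = ⊤ by
    have h1 : (1 : B) ∈ I := hI ▸ trivial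
    have h2 : (1 : Γ(X, dom h a)) * s ∈ B := h1
    rwa [one_mul] at h2
  by_contra hI
  obtain ⟨P, hP, hIP⟩ := Ideal.exists_le_maximal I hI
  have hinj : RingHom.ker (algebraMap B Γ(X, dom h a)) ≤ P := by
    rw [(RingHom.injective_iff_ker_eq_bot _).mp Subtype.val_injective]
    exact bot_le
  -- By lying over, a maximal ideal of B containing I comes from a point x of the chart. Some y_b
  -- does not vanish at x, yet a power of y_b / x_a lies in I.
  obtain ⟨Q, hQ, hQP⟩ := Ideal.exists_ideal_over_maximal_of_isIntegral P hinj
  obtain ⟨x, hx, hxQ⟩ := IsAffineOpen.exists_point hU Q hQ.isPrime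
  obtain ⟨b, hb⟩ := exists_mem_dom j x
  obtain ⟨m, hm⟩ := exists_pow_mul_mem D (genericPoint_mem hx) B hk hv s (genericPoint_mem hb)
  have h1 : (⟨chartVal h a (D.y b).1, hv _⟩ : B) ^ m ∈ I := hm
  have h2 := hIP h1
  rw [← hQP, Ideal.mem_comap, map_pow] at h2
  exact (hxQ _).mp (mem_basicOpen_y D hb hx) (hQ.isPrime.mem_of_pow_mem m h2)

end EmbeddingCoordinates

/-! ### The lattices in the generic fibre are stable under the functions on `X` -/

lemma isIntegral_subring_of_range {A B : Type*} [CommRing A] [CommRing B] (i : A →+* B) (hi : i.IsIntegral)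
    {S : Subring B} (h : ∀ r, i r ∈ S) : Algebra.IsIntegral S B :=
  ⟨RingHom.IsIntegral.tower_top (i.codRestrict S h) S.subtype hi⟩

section Stabilizer

variable {k : Type u} [Field k] {N : ℕ} {X Y : Scheme.{u}} [IsIntegral X] [IsIntegral Y] (f : X ⟶ Y) [Flat f]
  (g : Y ⟶ PSpace k N) {t : ℕ} (a : Fin t → ℤ) {o : Fin (N + 1)} (ho : genericPoint Y ∈ dom g o)
  (Φ : X.functionField →+* Module.End Y.functionField (Fin t → Y.functionField))

/-- The functions on the preimage of `U` which preserve the sections of `E` over `U`. -/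
def stabilizer {U : Y.Opens} (hU : genericPoint Y ∈ U) : Subring Γ(X, f ⁻¹ᵁ U) where
  carrier := {c | ∀ e : Γ(dissocie g a, U), ∃ e' : Γ(dissocie g a, U),
    coord g a ho hU e' = Φ (gen _ (genericPoint_mem_preimage f hU) c) (coord g a ho hU e)}
  mul_mem' {c d} hc hd e := by
    obtain ⟨e', he'⟩ := hd e
    obtain ⟨e'', he''⟩ := hc e'
    exact ⟨e'', by rw [he'', he', map_mul, map_mul, Module.End.mul_apply]⟩
  one_mem' e := ⟨e, by rw [map_one, map_one, Module.End.one_apply]⟩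
  add_mem' {c d} hc hd e := by
    obtain ⟨e', he'⟩ := hd e
    obtain ⟨e'', he''⟩ := hc e
    exact ⟨e'' + e', by rw [coord_add, he'', he', map_add, map_add, LinearMap.add_apply]⟩
  zero_mem' e := ⟨0, by rw [coord_zero, map_zero, map_zero, LinearMap.zero_apply]⟩
  neg_mem' {c} hc e := by
    obtain ⟨e', he'⟩ := hc e
    exact ⟨(-1 : Γ(Y, U)) • e', by
      rw [coord_smul, he', map_neg, map_neg, map_neg, map_one, LinearMap.neg_apply, neg_smul, one_smul]⟩

variable {f g a ho Φ}

lemma pull_mem_stabilizer (hΦ : ∀ c, Φ (fieldMap f c) = algebraMap _ _ c) {U : Y.Opens}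
    (hU : genericPoint Y ∈ U) (r : Γ(Y, U)) : pull f (le_refl _) r ∈ stabilizer f g a ho Φ hU := fun e =>
  ⟨r • e, by rw [coord_smul, ← fieldMap_gen, hΦ]; rfl⟩

/-- Over the chart b the action of v / x_b is the product defined by α, which takes sections of E to
sections of E. -/
lemma upVal_mem_stabilizer
    {α : tensor ((Scheme.Modules.pushforward f).obj (structureModule X)) (dissocie g a) ⟶ dissocie g a}
    (hΦ : ∀ c, Φ (fieldMap f c) = algebraMap _ _ c) (v : sections (f ≫ g) 1)
    (hv : Φ (rat (f ≫ g) (mem_dom_comp f g ho) (Opens.mem_top _) v.1) = sectionOp f g a ho α v)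
    {b : Fin (N + 1)} (hb : genericPoint Y ∈ dom g b) :
    upVal f g b v.1 ∈ stabilizer f g a ho Φ hb := by
  intro e
  refine ⟨mulSec f α (upVal f g b v.1) e, ?_⟩
  have h1 : rat (f ≫ g) (mem_dom_comp f g ho) (Opens.mem_top _) v.1 =
      fieldMap f (tau g ho b) * gen _ (genericPoint_mem_preimage f hb) (upVal f g b v.1) := by
    rw [fieldMap_tau, rat_eq_chartVal (f ≫ g) (mem_dom_comp f g ho) v.2 (mem_dom_comp f g hb), pow_one]
    rfl
  rw [coord_mulSec_upVal, ← hv, h1, map_mul, hΦ, Module.End.mul_apply, Module.algebraMap_end_apply, smul_smul,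
    inv_mul_cancel₀ (tau_ne_zero g ho hb), one_smul]

/-- The stabilizer contains the functions on the chart of Y, over which those on X are integral
because f is finite, and the values of all sections of 𝒪_X(1). So `subring_eq_top` applies. -/
lemma stabilizer_eq_top [IsFinite f] [IsClosedImmersion g]
    (hX : IsVeryAmple ((f ≫ g) ≫ PSpace.toSpec k N) (twist (f ≫ g) 1))
    {α : tensor ((Scheme.Modules.pushforward f).obj (structureModule X)) (dissocie g a) ⟶ dissocie g a}
    (hΦ : ∀ c, Φ (fieldMap f c) = algebraMap _ _ c)
    (hv : ∀ v : sections (f ≫ g) 1,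
      Φ (rat (f ≫ g) (mem_dom_comp f g ho) (Opens.mem_top _) v.1) = sectionOp f g a ho α v)
    {b : Fin (N + 1)} (hb : genericPoint Y ∈ dom g b) : stabilizer f g a ho Φ hb = ⊤ := by
  obtain ⟨M, j, hj, ⟨D⟩⟩ := exists_embeddingCoordinates (f ≫ g) hX
  have hY := isAffineOpen_dom g b
  refine subring_eq_top D (a := b) (hY.preimage f) (stabilizer f g a ho Φ hb) ?_ ?_ ?_
  · intro c
    have h1 := pull_mem_stabilizer (g := g) (a := a) (ho := ho) hΦ hb (scalar g (dom g b) c)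
    rw [pull_scalar] at h1
    exact h1
  · exact fun v => upVal_mem_stabilizer hΦ v (hv v) hb
  · have h2 := f.isIntegral_app (dom g b) hY
    rw [Scheme.Hom.app_eq_appLE] at h2
    exact isIntegral_subring_of_range _ h2 (pull_mem_stabilizer hΦ hb)

lemma closure_eq_top [IsFinite f] [IsClosedImmersion g]
    (hX : IsVeryAmple ((f ≫ g) ≫ PSpace.toSpec k N) (twist (f ≫ g) 1)) (ho : genericPoint Y ∈ dom g o) :
    Subfield.closure (Set.range (fieldMap f) ∪ Set.range fun v : sections (f ≫ g) 1 =>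
      rat (f ≫ g) (mem_dom_comp f g ho) (Opens.mem_top _) v.1) = ⊤ := by
  obtain ⟨M, j, hj, ⟨D⟩⟩ := exists_embeddingCoordinates (f ≫ g) hX
  refine subfield_eq_top D (mem_dom_comp f g ho) _ (fun c => ?_) fun v => ?_
  · refine Subfield.subset_closure (Or.inl ⟨scalarGen g c, ?_⟩)
    rw [fieldMap_scalarGen]
  · exact Subfield.subset_closure (Or.inr ⟨v, rfl⟩)

end Stabilizer

/-! ### A criterion for coherence. -/

lemma exists_presentation_tilde {R : CommRingCat.{u}} [IsNoetherianRing R] (M : ModuleCat.{u} R)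
    [Module.Finite R M] : ∃ P : (tilde M).Presentation, P.IsFinite := by
  obtain ⟨s, hs⟩ := Module.Finite.fg_top (R := R) (M := M)
  obtain ⟨t, htf, ht⟩ := Submodule.fg_def.mp (IsNoetherian.noetherian
    (LinearMap.ker (Finsupp.linearCombination R ((↑) : ↥(s : Set M) → M))))
  exact ⟨presentationTilde M (s : Set M) hs t ht, ⟨⟨inferInstanceAs (Finite ↥(s : Set M))⟩,
    ⟨htf.to_subtype⟩⟩⟩

/-- Transport of finite presentations along isomorphisms. -/
lemma exists_presentation_of_iso {X : Scheme.{u}} {M N : X.Modules} (e : M ≅ N)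
    (h : ∃ P : SheafOfModules.Presentation.{u} M, P.IsFinite) :
    ∃ P : SheafOfModules.Presentation.{u} N, P.IsFinite := by
  obtain ⟨P, hP⟩ := h
  have he : @IsIso (SheafOfModules.{u} X.ringCatSheaf) _ M N e.hom := (inferInstance : IsIso e.hom)
  exact ⟨@SheafOfModules.Presentation.ofIsIso _ _ _ _ _ _ M N e.hom he P,
    ⟨⟨hP.isFiniteType_generators.finite⟩, ⟨hP.isFiniteType_relations.finite⟩⟩⟩

lemma exists_presentation_of_isIso {R : CommRingCat.{u}} [IsNoetherianRing R] (M : (Spec R).Modules)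
    (hM : IsIso M.fromTildeΓ) [Module.Finite R Γ(M, ⊤)] :
    ∃ P : SheafOfModules.Presentation.{u} M, P.IsFinite := by
  have : Module.Finite R ((modulesSpecToSheaf.obj M).presheaf.obj (.op ⊤)) := ‹Module.Finite R Γ(M, ⊤)›
  exact exists_presentation_of_iso (@asIso _ _ _ _ M.fromTildeΓ hM) (exists_presentation_tilde _)

lemma exists_presentation_restrict {X Y : Scheme.{u}} {M : Y.Modules} (j : X ⟶ Y) [IsOpenImmersion j]
    (h : ∃ P : SheafOfModules.Presentation.{u} M, P.IsFinite) :
    ∃ P : SheafOfModules.Presentation.{u} (M.restrict j), P.IsFinite := by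
  obtain ⟨P, hP⟩ := h
  exact ⟨Scheme.Modules.presentationRestrict j P,
    ⟨⟨hP.isFiniteType_generators.finite⟩, ⟨hP.isFiniteType_relations.finite⟩⟩⟩

/-- The restriction to `U` of the structure sheaf. -/
def unitOverIso {X : Scheme.{u}} (U : X.Opens) :
    SheafOfModules.unit (X.ringCatSheaf.over U) ≅
      (Scheme.Modules.overEquiv U).inverse.obj (SheafOfModules.unit (U : Scheme.{u}).ringCatSheaf) := by
  refine (Scheme.Modules.overEquiv U).unitIso.app _ ≪≫ (Scheme.Modules.overEquiv U).inverse.mapIso ?_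
  exact (Scheme.Modules.overFunctorEquiv U).app (SheafOfModules.unit X.ringCatSheaf) ≪≫
    Scheme.Modules.restrictUnitIso _

/-- Finite presentation is tested on the slice site over U, while presentations are built on Spec
Γ(X, U). They are carried along the isomorphism of U with this spectrum and the equivalence of
modules on U with modules on the slice. -/
lemma exists_presentation_over {X : Scheme.{u}} (M : X.Modules) {U : X.Opens} (hU : IsAffineOpen U)
    (h : ∃ P : SheafOfModules.Presentation.{u} (M.restrict hU.fromSpec), P.IsFinite) :
    ∃ P : SheafOfModules.Presentation.{u} (SheafOfModules.over.{u} M U), P.IsFinite := by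
  have e₁ : (M.restrict hU.fromSpec).restrict hU.isoSpec.hom ≅ M.restrict U.ι :=
    ((Scheme.Modules.restrictFunctorComp hU.isoSpec.hom hU.fromSpec).symm ≪≫
      Scheme.Modules.restrictFunctorCongr (by simp)).app M
  have e₂ := ((Scheme.Modules.overFunctorEquiv U).app M)
  obtain ⟨P, hP⟩ := exists_presentation_of_iso (e₁ ≪≫ e₂.symm) (exists_presentation_restrict hU.isoSpec.hom h)
  let F : SheafOfModules.{u} (U : Scheme.{u}).ringCatSheaf ⥤ SheafOfModules.{u} (X.ringCatSheaf.over U) :=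
    (Scheme.Modules.overEquiv U).inverse
  have hF : Limits.PreservesColimitsOfSize.{u, u} F :=
    (Scheme.Modules.overEquiv U).symm.toAdjunction.leftAdjoint_preservesColimits
  let Q := P.map F (unitOverIso U)
  have e₃ := (Scheme.Modules.overEquiv U).unitIso.app (SheafOfModules.over.{u} M U)
  exact ⟨Q.ofIsIso e₃.inv, ⟨⟨hP.isFiniteType_generators.finite⟩, ⟨hP.isFiniteType_relations.finite⟩⟩⟩


lemma appIso_fromSpec_inv {X : Scheme.{u}} {U : X.Opens} (hU : IsAffineOpen U) (V : (Spec Γ(X, U)).Opens)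
    (hV : hU.fromSpec ''ᵁ V ≤ U) (r : Γ(X, U)) :
    (hU.fromSpec.appIso V).inv ((Spec Γ(X, U)).presheaf.map V.leTop.op ((Scheme.ΓSpecIso Γ(X, U)).inv r)) =
      res hV r := by
  have h1 : (hU.fromSpec.appIso V).hom (res hV r) =
      (Spec Γ(X, U)).presheaf.map V.leTop.op ((Scheme.ΓSpecIso Γ(X, U)).inv r) := by
    rw [Scheme.Hom.appIso_hom']
    simp only [res]
    rw [← CommRingCat.comp_apply, Scheme.Hom.map_appLE, Scheme.Hom.appLE, hU.fromSpec_app_self, Category.assoc,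
      ← Functor.map_comp]
    rfl
  rw [← h1, Iso.hom_inv_id_apply]

lemma modRes_self {X : Scheme.{u}} (M : X.Modules) {U : X.Opens} (h : U ≤ U) (x : Γ(M, U)) : modRes M h x = x := by
  simp [modRes]

section Restrict

variable {X : Scheme.{u}} (M : X.Modules) {U : X.Opens} (hU : IsAffineOpen U)

/-- A section of `M` as a section of the restriction of `M` to `Spec Γ(X, U)`. -/
def toRestrict {V : (Spec Γ(X, U)).Opens} (m : Γ(M, hU.fromSpec ''ᵁ V)) : Γ(M.restrict hU.fromSpec, V) := m

/-- A section of the restriction of `M` to `Spec Γ(X, U)` as a section of `M`. -/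
def ofRestrict {V : (Spec Γ(X, U)).Opens} (m : Γ(M.restrict hU.fromSpec, V)) : Γ(M, hU.fromSpec ''ᵁ V) := m

lemma ofRestrict_smul {V : (Spec Γ(X, U)).Opens} (hV : hU.fromSpec ''ᵁ V ≤ U) (r : Γ(X, U))
    (m : Γ(M.restrict hU.fromSpec, V)) : ofRestrict M hU (r • m) = res hV r • ofRestrict M hU m := by
  rw [← appIso_fromSpec_inv hU V hV]
  rfl

lemma image_le (V : (Spec Γ(X, U)).Opens) : hU.fromSpec ''ᵁ V ≤ U :=
  (hU.fromSpec.image_mono le_top).trans (by simp)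

lemma finite_restrict [Module.Finite Γ(X, U) Γ(M, U)] :
    Module.Finite Γ(X, U) Γ(M.restrict hU.fromSpec, ⊤) := by
  have h1 : hU.fromSpec ''ᵁ ⊤ = U := by simp
  let l : Γ(M, U) →ₗ[Γ(X, U)] Γ(M.restrict hU.fromSpec, ⊤) :=
    { toFun m := toRestrict M hU (modRes M h1.le m)
      map_add' m m' := map_add (modRes M h1.le) m m'
      map_smul' r m := by
        refine (modRes_smul M h1.le r m).trans ?_
        exact (ofRestrict_smul M hU h1.le r (toRestrict M hU (modRes M h1.le m))).symm }
  refine Module.Finite.of_surjective l fun m => ⟨modRes M h1.ge (ofRestrict M hU m), ?_⟩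
  exact (modRes_modRes M h1.ge h1.le _).trans (modRes_self M _ _)

/-- The two hypotheses say that Γ(M, D(s)) is the localisation of Γ(M, U) at s: surjectivity up to
denominators, and a kernel consisting of s-power torsion. -/
lemma isIso_fromTilde_restrict
    (h1 : ∀ (s : Γ(X, U)) (m : Γ(M, X.basicOpen s)), ∃ (n : ℕ) (m' : Γ(M, U)),
      modRes M (X.basicOpen_le s) m' = res (X.basicOpen_le s) s ^ n • m)
    (h2 : ∀ (s : Γ(X, U)) (m : Γ(M, U)), modRes M (X.basicOpen_le s) m = 0 → ∃ n : ℕ, s ^ n • m = 0) :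
    IsIso (M.restrict hU.fromSpec).fromTildeΓ := by
  have hT : hU.fromSpec ''ᵁ ⊤ = U := by simp
  rw [isIso_fromTildeΓ_iff_isLocalizing]
  intro s
  have hs : hU.fromSpec ''ᵁ PrimeSpectrum.basicOpen s = X.basicOpen s := hU.fromSpec_image_basicOpen s
  refine IsLocalizedModule.Away.mk_of_addCommGroup
    (Scheme.Modules.isUnit_algebraMap_end_of_le_basicOpen _ le_rfl) (fun m => ?_) fun m hm => ?_
  · obtain ⟨n, m', h⟩ := h1 s (modRes M hs.ge (ofRestrict M hU m))
    refine ⟨n, toRestrict M hU (modRes M hT.le m'), ?_⟩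
    refine (ofRestrict_smul M hU (image_le hU _) (s ^ n) m).trans ?_
    have h3 := congrArg (modRes M hs.le) h
    rw [modRes_modRes, modRes_smul, modRes_modRes, modRes_self, map_pow, res_res] at h3
    rw [map_pow, ← h3]
    exact (modRes_modRes M hT.le _ m').symm
  · obtain ⟨n, h⟩ := h2 s (modRes M hT.ge (ofRestrict M hU m)) (by
      have h3 := congrArg (modRes M hs.ge) (show modRes M (hU.fromSpec.image_mono le_top) (ofRestrict M hU m) = 0 from hm)
      rw [modRes_modRes, map_zero] at h3
      rw [modRes_modRes]
      exact h3)
    refine ⟨n, ?_⟩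
    have h3 := congrArg (modRes M hT.le) h
    rw [modRes_smul, modRes_modRes, modRes_self, map_zero] at h3
    exact (ofRestrict_smul M hU (image_le hU _) (s ^ n) m).trans h3

end Restrict

/-- On a scheme with a cover by affine open subsets with Noetherian coordinate rings, a sheaf of modules
whose sections are finite over the cover and compatible with localisation is coherent. -/
lemma isCoherent_of_isLocalizing {X : Scheme.{u}} (M : X.Modules) {ι : Type u} (U : ι → X.Opens)
    (hU : ∀ i, IsAffineOpen (U i)) (hcov : ⨆ i, U i = ⊤) (hN : ∀ i, IsNoetherianRing Γ(X, U i))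
    (hfin : ∀ i, Module.Finite Γ(X, U i) Γ(M, U i))
    (h1 : ∀ (i : ι) (s : Γ(X, U i)) (m : Γ(M, X.basicOpen s)), ∃ (n : ℕ) (m' : Γ(M, U i)),
      modRes M (X.basicOpen_le s) m' = res (X.basicOpen_le s) s ^ n • m)
    (h2 : ∀ (i : ι) (s : Γ(X, U i)) (m : Γ(M, U i)), modRes M (X.basicOpen_le s) m = 0 → ∃ n : ℕ, s ^ n • m = 0) :
    IsCoherent M := by
  have h (i : ι) : ∃ P : SheafOfModules.Presentation.{u} (SheafOfModules.over.{u} M (U i)), P.IsFinite := by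
    refine exists_presentation_over M (hU i) ?_
    have := finite_restrict M (hU i)
    exact exists_presentation_of_isIso _ (isIso_fromTilde_restrict M (hU i) (h1 i) (h2 i))
  choose P hP using h
  let σ : SheafOfModules.QuasicoherentData.{u, u} (R := X.ringCatSheaf) M :=
    { I := ι
      X := U
      coversTop := (Opens.coversTop_iff _ U).mpr hcov
      presentation := P }
  have hσ : σ.IsFinitePresentation := SheafOfModules.QuasicoherentData.IsFinitePresentation.mk.{u, u, u, u} hP
  exact SheafOfModules.IsFinitePresentation.mk.{u, u, u} ⟨σ, hσ⟩

/-! ### Clearing denominators at the generic point. -/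

section BasicOpen

variable {X : Scheme.{u}} [IsIntegral X]

lemma exists_pow_mul_gen {U V : X.Opens} (hU : IsAffineOpen U) (T : Γ(X, U)) (hV : V = X.basicOpen T)
    (hg : genericPoint X ∈ V) (hg' : genericPoint X ∈ U) (r : Γ(X, V)) :
    ∃ (n : ℕ) (c : Γ(X, U)), gen U hg' c = gen U hg' T ^ n * gen V hg r := by
  subst hV
  have := hU.isLocalization_basicOpen T
  obtain ⟨⟨c, ⟨_, n, rfl⟩⟩, h⟩ := IsLocalization.surj (Submonoid.powers T) r
  refine ⟨n, c, ?_⟩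
  have h1 := congrArg (gen _ hg) (show r * res (X.basicOpen_le T) (T ^ n) = res (X.basicOpen_le T) c from h)
  rw [map_mul, gen_res, gen_res, map_pow] at h1
  rw [← h1, mul_comm]

lemma mem_basicOpen_of_gen_eq {U V : X.Opens} {s : Γ(X, U)} {t : Γ(X, V)} {x : X} (hU : x ∈ U)
    (ht : x ∈ X.basicOpen t) (h : ∀ hU hV, gen U hU s = gen V hV t) : x ∈ X.basicOpen s := by
  have hV : x ∈ V := X.basicOpen_le t ht
  have h1 : res (inf_le_left : U ⊓ V ≤ U) s = res inf_le_right t := by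
    refine eq_of_gen fun hg => ?_
    rw [gen_res, gen_res]
    exact h _ _
  have h2 : x ∈ X.basicOpen (res (inf_le_right : U ⊓ V ≤ V) t) := by
    refine (X.basicOpen_res t (homOfLE inf_le_right).op).ge ⟨⟨hU, hV⟩, ht⟩
  rw [← h1] at h2
  exact ((X.basicOpen_res s (homOfLE inf_le_left).op).le h2).2

end BasicOpen

/-! ### The lattice of sections of E in the generic fibre. -/

section Lattice

variable {k : Type u} [Field k] {N : ℕ} {Y : Scheme.{u}} [IsIntegral Y]
  (g : Y ⟶ PSpace k N) {t : ℕ} (a : Fin t → ℤ) {o : Fin (N + 1)} (ho : genericPoint Y ∈ dom g o)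

/-- The elements of the generic fibre which extend to sections of `E` over `U`. -/
def IsSection {U : Y.Opens} (hU : genericPoint Y ∈ U) (w : Fin t → Y.functionField) : Prop :=
  ∃ e : Γ(dissocie g a, U), coord g a ho hU e = w

variable {g a ho}

lemma IsSection.add {U : Y.Opens} {hU : genericPoint Y ∈ U} {w w' : Fin t → Y.functionField}
    (h : IsSection g a ho hU w) (h' : IsSection g a ho hU w') : IsSection g a ho hU (w + w') := by
  obtain ⟨e, rfl⟩ := h
  obtain ⟨e', rfl⟩ := h'
  exact ⟨e + e', coord_add ..⟩

lemma IsSection.zero {U : Y.Opens} {hU : genericPoint Y ∈ U} : IsSection g a ho hU 0 := ⟨0, coord_zero ..⟩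

lemma IsSection.smul {U : Y.Opens} {hU : genericPoint Y ∈ U} {w : Fin t → Y.functionField}
    (h : IsSection g a ho hU w) (r : Γ(Y, U)) : IsSection g a ho hU (gen U hU r • w) := by
  obtain ⟨e, rfl⟩ := h
  exact ⟨r • e, coord_smul ..⟩

lemma IsSection.mono {U V : Y.Opens} {hU : genericPoint Y ∈ U} {w : Fin t → Y.functionField}
    (h : IsSection g a ho hU w) (hVU : V ≤ U) (hV : genericPoint Y ∈ V) : IsSection g a ho hV w := by
  obtain ⟨e, rfl⟩ := h
  exact ⟨modRes _ hVU e, coord_modRes ..⟩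

/-- E is free of finite rank over the chart, so denominators can be cleared in each of the t
coordinates and the largest exponent taken. -/
lemma IsSection.exists_pow_smul {b : Fin (N + 1)} (hb : genericPoint Y ∈ dom g b) (hY : IsAffineOpen (dom g b))
    (T : Γ(Y, dom g b)) {V : Y.Opens} (hV : V = Y.basicOpen T) {hg : genericPoint Y ∈ V}
    {w : Fin t → Y.functionField} (h : IsSection g a ho hg w) :
    ∃ n : ℕ, IsSection g a ho hb (gen _ hb T ^ n • w) := by
  have hle : V ≤ dom g b := hV.le.trans (Y.basicOpen_le T)
  obtain h := (exists_coord_iff_of_le g a ho hg hle).mp h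
  choose r hr using h
  choose n c hc using fun j => exists_pow_mul_gen hY T hV hg hb (r j)
  refine ⟨Finset.univ.sup n, (exists_coord_iff_of_le g a ho hb le_rfl).mpr fun j => ?_⟩
  obtain ⟨m, hm⟩ := Nat.exists_eq_add_of_le (Finset.le_sup (f := n) (Finset.mem_univ j))
  refine ⟨T ^ m * c j, ?_⟩
  rw [Pi.smul_apply, smul_eq_mul, hr, hm, map_mul, hc, map_pow, pow_add]
  ring

/-- Elements of the generic fibre which extend to sections of `E` locally on `U` are sections. -/
lemma isSection_of_locally {U : Y.Opens} (hU : genericPoint Y ∈ U) {w : Fin t → Y.functionField}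
    (h : ∀ y ∈ U, ∃ V ≤ U, ∃ hV : genericPoint Y ∈ V, y ∈ V ∧ IsSection g a ho hV w) :
    IsSection g a ho hU w := by
  choose V hVU hV hy e he using h
  obtain ⟨s, hs, -⟩ := TopCat.Sheaf.existsUnique_gluing' ⟨_, (dissocie g a).isSheaf⟩
    (fun y : U => V y y.2) U (fun y => homOfLE (hVU y y.2))
    (fun y hy' => Opens.mem_iSup.mpr ⟨⟨y, hy'⟩, hy y hy'⟩) (fun y => e y y.2) (fun y z => by
      refine coord_injective g a ho (mem_inf (hV y y.2) (hV z z.2)) ?_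
      refine (coord_modRes g a ho inf_le_left _ (e y y.2)).trans ?_
      refine Eq.trans ?_ (coord_modRes g a ho inf_le_right _ (e z z.2)).symm
      exact (he y y.2).trans (he z z.2).symm)
  refine ⟨s, ?_⟩
  rw [← coord_modRes g a ho (hVU _ hU) (hV _ hU) s]
  exact (congrArg _ (hs ⟨_, hU⟩)).trans (he _ hU)

end Lattice

lemma mem_basicOpen_pow {X : Scheme.{u}} {U : X.Opens} {s : Γ(X, U)} {x : X} (hx : x ∈ X.basicOpen s) (n : ℕ) :
    x ∈ X.basicOpen (s ^ n) := by
  induction n with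
  | zero => rw [pow_zero, Scheme.basicOpen_of_isUnit _ isUnit_one]; exact X.basicOpen_le s hx
  | succ n ih => rw [pow_succ, Scheme.basicOpen_mul]; exact ⟨ih, hx⟩

lemma exists_mem_dom_preimage {k : Type u} [Field k] {N : ℕ} {X Y : Scheme.{u}} [IsIntegral Y] (f : X ⟶ Y)
    (g : Y ⟶ PSpace k N) (x : X) : ∃ b, ∃ _ : genericPoint Y ∈ dom g b, f x ∈ dom g b := by
  obtain ⟨b, hb⟩ := exists_mem_dom g (f x)
  exact ⟨b, genericPoint_mem hb, hb⟩

/-! ### Belonging to the lattice near a point of X. -/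

section Near

variable {k : Type u} [Field k] {N : ℕ} {X Y : Scheme.{u}} [IsIntegral X] [IsIntegral Y] (f : X ⟶ Y) [Flat f]
  (g : Y ⟶ PSpace k N) {t : ℕ} (a : Fin t → ℤ) {o : Fin (N + 1)} (ho : genericPoint Y ∈ dom g o)
  (Φ : X.functionField →+* Module.End Y.functionField (Fin t → Y.functionField))

/-- The elements of the generic fibre which belong to the lattice of `E` near the point `x`. -/
def IsNear (x : X) (w : Fin t → Y.functionField) : Prop :=
  ∃ (U : Y.Opens) (hU : genericPoint Y ∈ U) (s : Γ(X, f ⁻¹ᵁ U)), x ∈ X.basicOpen s ∧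
    IsSection g a ho hU (Φ (gen _ (genericPoint_mem_preimage f hU) s) w)

variable {f g a ho Φ}

lemma IsSection.isNear {U : Y.Opens} {hU : genericPoint Y ∈ U} {w : Fin t → Y.functionField}
    (h : IsSection g a ho hU w) {x : X} (hx : f x ∈ U) : IsNear f g a ho Φ x w :=
  ⟨U, hU, 1, by rw [Scheme.basicOpen_of_isUnit _ isUnit_one]; exact hx,
    by rwa [map_one, map_one, Module.End.one_apply]⟩

variable (hΦ : ∀ c, Φ (fieldMap f c) = algebraMap _ _ c)
  (hst : ∀ (b : Fin (N + 1)) (hb : genericPoint Y ∈ dom g b), stabilizer f g a ho Φ hb = ⊤)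

include hst in
lemma IsSection.act {b : Fin (N + 1)} {hb : genericPoint Y ∈ dom g b} {w : Fin t → Y.functionField}
    (h : IsSection g a ho hb w) (c : Γ(X, f ⁻¹ᵁ dom g b)) :
    IsSection g a ho hb (Φ (gen _ (genericPoint_mem_preimage f hb) c) w) := by
  obtain ⟨e, rfl⟩ := h
  have hc : c ∈ stabilizer f g a ho Φ hb := hst b hb ▸ Subring.mem_top c
  exact hc e

/-- The functions which move a given element of the generic fibre into the lattice of `E`. -/
def colon {b : Fin (N + 1)} (hb : genericPoint Y ∈ dom g b) (w : Fin t → Y.functionField) :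
    Ideal Γ(X, f ⁻¹ᵁ dom g b) where
  carrier := {c | IsSection g a ho hb (Φ (gen _ (genericPoint_mem_preimage f hb) c) w)}
  add_mem' {c d} hc hd := by
    have h := hc.add hd
    rwa [← LinearMap.add_apply, ← map_add, ← map_add] at h
  zero_mem' := by
    have h : IsSection g a ho hb 0 := IsSection.zero
    rwa [Set.mem_ofPred_eq, map_zero, map_zero, LinearMap.zero_apply]
  smul_mem' c d hd := by
    have h := IsSection.act hst hd c
    rwa [← Module.End.mul_apply, ← map_mul, ← map_mul] at h

lemma mem_colon {b : Fin (N + 1)} {hb : genericPoint Y ∈ dom g b} {w : Fin t → Y.functionField}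
    {c : Γ(X, f ⁻¹ᵁ dom g b)} : c ∈ colon hst hb w ↔
      IsSection g a ho hb (Φ (gen _ (genericPoint_mem_preimage f hb) c) w) := Iff.rfl

lemma isNear_of_mem_colon {b : Fin (N + 1)} {hb : genericPoint Y ∈ dom g b} {w : Fin t → Y.functionField}
    {c : Γ(X, f ⁻¹ᵁ dom g b)} (hc : c ∈ colon hst hb w) {x : X} (hx : x ∈ X.basicOpen c) :
    IsNear f g a ho Φ x w :=
  ⟨dom g b, hb, c, hx, hc⟩

variable [IsClosedImmersion g] [IsAffineHom f]

-- The witness can be moved to any chart b containing f x. Shrink to a basic open D(T) around f x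
-- inside U: there s = c / T ^ m with c defined on the chart, and T ^ n (s w) is a section over the
-- chart. The function T ^ n c is the new witness; stability of E absorbs the factor T ^ m.
include hΦ in
lemma IsNear.exists_mem_colon {x : X} {w : Fin t → Y.functionField} (h : IsNear f g a ho Φ x w)
    {b : Fin (N + 1)} (hb : genericPoint Y ∈ dom g b) (hx : f x ∈ dom g b) :
    ∃ s ∈ colon hst hb w, x ∈ X.basicOpen s := by
  obtain ⟨U, hU, s, hs, hw⟩ := h
  have hY := isAffineOpen_dom g b
  have hxU : f x ∈ U := X.basicOpen_le s hs
  obtain ⟨T, hTU, hxT⟩ := hY.exists_basicOpen_le ⟨f x, hxU⟩ hx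
  have hle := Y.basicOpen_le T
  have hT : genericPoint Y ∈ Y.basicOpen T := genericPoint_mem hxT
  have hpre : f ⁻¹ᵁ Y.basicOpen T = X.basicOpen (pull f (le_refl (f ⁻¹ᵁ dom g b)) T) := by
    rw [Scheme.preimage_basicOpen, Scheme.Hom.app_eq_appLE]
    rfl
  have hbX := genericPoint_mem_preimage f hb
  obtain ⟨m, c, hc⟩ := exists_pow_mul_gen (hY.preimage f) (pull f (le_refl _) T) hpre
    (genericPoint_mem_preimage f hT) hbX (res (f.preimage_mono hTU) s)
  rw [gen_res] at hc
  obtain ⟨n, hn⟩ := (hw.mono hTU hT).exists_pow_smul hb hY T rfl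
  refine ⟨pull f (le_refl _) T ^ n * c, ?_, ?_⟩
  · rw [mem_colon]
    have h1 := IsSection.act hst hn (pull f (le_refl _) T ^ m)
    have h2 (v : Fin t → Y.functionField) : gen _ hb T ^ n • v = Φ (gen _ hbX (pull f (le_refl _) T) ^ n) v := by
      rw [← fieldMap_gen f hb, ← map_pow (fieldMap f), hΦ, Module.algebraMap_end_apply]
    rw [h2, ← Module.End.mul_apply, ← Module.End.mul_apply, ← map_mul, ← map_mul] at h1
    rw [map_mul, hc, map_pow]
    rw [map_pow (gen _ hbX)] at h1
    convert h1 using 3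
    ring
  · have hxT' : x ∈ X.basicOpen (pull f (le_refl (f ⁻¹ᵁ dom g b)) T) := hpre ▸ hxT
    refine mem_basicOpen_of_gen_eq (t := res (inf_le_left : _ ⊓ f ⁻¹ᵁ U ≤ f ⁻¹ᵁ dom g b) (pull f (le_refl _) T) ^ (n + m) * res inf_le_right s) hx ?_ fun h1 h2 => ?_
    · rw [Scheme.basicOpen_mul]
      refine ⟨mem_basicOpen_pow ?_ _, ?_⟩
      · exact (X.basicOpen_res _ (homOfLE _).op).ge ⟨⟨hx, hxU⟩, hxT'⟩
      · exact (X.basicOpen_res _ (homOfLE _).op).ge ⟨⟨hx, hxU⟩, hs⟩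
    · rw [map_mul, map_mul, hc, map_pow, map_pow, gen_res, gen_res, pow_add]
      ring

include hΦ hst in
lemma IsNear.add {x : X} {w w' : Fin t → Y.functionField} (h : IsNear f g a ho Φ x w)
    (h' : IsNear f g a ho Φ x w') : IsNear f g a ho Φ x (w + w') := by
  obtain ⟨b, hb, hx⟩ := exists_mem_dom_preimage f g x
  obtain ⟨s, hs, hxs⟩ := h.exists_mem_colon hΦ hst hb hx
  obtain ⟨s', hs', hxs'⟩ := h'.exists_mem_colon hΦ hst hb hx
  refine isNear_of_mem_colon hst (c := s * s') (hb := hb) ?_ (by rw [Scheme.basicOpen_mul]; exact ⟨hxs, hxs'⟩)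
  have h1 := IsSection.add ((mem_colon hst).mp (Ideal.mul_mem_right s' _ hs))
    ((mem_colon hst).mp (Ideal.mul_mem_left _ s hs'))
  rwa [← map_add] at h1

omit [IsClosedImmersion g] [IsAffineHom f] in
lemma IsNear.zero (x : X) : IsNear f g a ho Φ x 0 := by
  obtain ⟨b, hb, hx⟩ := exists_mem_dom_preimage f g x
  exact IsSection.isNear (hU := hb) IsSection.zero hx

include hΦ hst in
lemma IsNear.smul {x : X} {w : Fin t → Y.functionField} (h : IsNear f g a ho Φ x w) {V : X.Opens}
    (hV : genericPoint X ∈ V) (hx : x ∈ V) (r : Γ(X, V)) : IsNear f g a ho Φ x (Φ (gen V hV r) w) := by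
  obtain ⟨b, hb, hxb⟩ := exists_mem_dom_preimage f g x
  have hY := (isAffineOpen_dom g b).preimage f
  obtain ⟨s, hs, hxs⟩ := h.exists_mem_colon hΦ hst hb hxb
  obtain ⟨T, hTV, hxT⟩ := hY.exists_basicOpen_le ⟨x, hx⟩ hxb
  have hbX := genericPoint_mem_preimage f hb
  obtain ⟨m, c, hc⟩ := exists_pow_mul_gen hY T rfl (genericPoint_mem hxT) hbX (res hTV r)
  rw [gen_res] at hc
  refine isNear_of_mem_colon hst (c := T ^ m * s) (hb := hb) ?_
    (by rw [Scheme.basicOpen_mul]; exact ⟨mem_basicOpen_pow hxT m, hxs⟩)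
  have h1 := (mem_colon hst).mp (Ideal.mul_mem_left _ c hs)
  rw [mem_colon, ← Module.End.mul_apply, ← map_mul]
  convert h1 using 3
  rw [map_mul, map_mul, map_pow, hc]
  ring

-- The radical of an ideal is the intersection of the primes containing it. A prime containing
-- `colon` but not s would be a point of D(s) at which no function outside the prime moves w into E.
include hΦ in
lemma exists_pow_mem_colon {b : Fin (N + 1)} (hb : genericPoint Y ∈ dom g b) {w : Fin t → Y.functionField}
    (s : Γ(X, f ⁻¹ᵁ dom g b)) (h : ∀ x ∈ X.basicOpen s, IsNear f g a ho Φ x w) :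
    ∃ n : ℕ, s ^ n ∈ colon hst hb w := by
  change s ∈ (colon hst hb w).radical
  rw [Ideal.radical_eq_sInf, Ideal.mem_sInf]
  rintro Q ⟨hQ, hQp⟩
  by_contra hs
  obtain ⟨x, hx, hxs⟩ := IsAffineOpen.exists_point ((isAffineOpen_dom g b).preimage f) Q hQp
  obtain ⟨c, hc, hxc⟩ := (h x ((hxs s).mpr hs)).exists_mem_colon hΦ hst hb hx
  exact (hxs c).mp hxc (hQ hc)

-- This is the inclusion of f_* of the lift in E. It is local at y, and it suffices that some
-- function r on Y with r(y) ≠ 0 has r w in E. Otherwise lying over yields a point x above y at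
-- which every function in `colon` vanishes.
omit [IsAffineHom f] in
include hΦ hst in
lemma isSection_of_isNear [IsFinite f] {U : Y.Opens} (hU : genericPoint Y ∈ U) {w : Fin t → Y.functionField}
    (h : ∀ x, f x ∈ U → IsNear f g a ho Φ x w) : IsSection g a ho hU w := by
  refine isSection_of_locally hU fun y hy => ?_
  obtain ⟨b, hb⟩ := exists_mem_dom g y
  have hη := genericPoint_mem hb
  have hY := isAffineOpen_dom g b
  let i := pull f (le_refl (f ⁻¹ᵁ dom g b))
  have hi : i.IsIntegral := by
    have h2 := f.isIntegral_app (dom g b) hY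
    rwa [Scheme.Hom.app_eq_appLE] at h2
  have hpre (r : Γ(Y, dom g b)) : f ⁻¹ᵁ Y.basicOpen r = X.basicOpen (i r) := by
    rw [Scheme.preimage_basicOpen, Scheme.Hom.app_eq_appLE]
    rfl
  have key : ∃ r ∈ (colon hst hη w).comap i, y ∈ Y.basicOpen r := by
    by_contra! hcon
    let P := (hY.primeIdealOf ⟨y, hb⟩).asIdeal
    have hP (r : Γ(Y, dom g b)) : y ∈ Y.basicOpen r ↔ r ∉ P := by
      have h1 := congrArg (fun V : (Spec Γ(Y, dom g b)).Opens => hY.primeIdealOf ⟨y, hb⟩ ∈ V)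
        (hY.fromSpec_preimage_basicOpen r)
      have h2 : hY.fromSpec (hY.primeIdealOf ⟨y, hb⟩) ∈ Y.basicOpen r ↔ r ∉ P := h1.to_iff
      rwa [hY.fromSpec_primeIdealOf] at h2
    let := i.toAlgebra
    have : Algebra.IsIntegral Γ(Y, dom g b) Γ(X, f ⁻¹ᵁ dom g b) := ⟨hi⟩
    -- This form of lying over produces a prime above P that also contains `colon`, given that the
    -- contraction of `colon` lies in P.
    obtain ⟨Q, hQ, hQp, hQP⟩ := Ideal.exists_ideal_over_prime_of_isIntegral P (colon hst hη w)
      fun r hr => not_not.mp fun hr' => hcon r hr ((hP r).mpr hr')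
    obtain ⟨x, hx, hxs⟩ := IsAffineOpen.exists_point (hY.preimage f) Q hQp
    have hPx (r : Γ(Y, dom g b)) : f x ∈ Y.basicOpen r ↔ y ∈ Y.basicOpen r := by
      rw [hP, ← hQP]
      exact (SetLike.ext_iff.mp (hpre r) x).trans (hxs _)
    obtain ⟨T, hTU, hyT⟩ := hY.exists_basicOpen_le ⟨y, hy⟩ hb
    obtain ⟨c, hc, hxc⟩ := (h x (hTU ((hPx T).mpr hyT))).exists_mem_colon hΦ hst hη hx
    exact (hxs c).mp hxc (hQ hc)
  obtain ⟨r, hr, hyr⟩ := key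
  have hle := Y.basicOpen_le r
  have hg : genericPoint Y ∈ Y.basicOpen r := genericPoint_mem hyr
  refine ⟨Y.basicOpen r ⊓ U, inf_le_right, mem_inf hg hU, ⟨hyr, hy⟩, ?_⟩
  have h1 := ((mem_colon hst).mp hr).mono hle hg
  rw [← fieldMap_gen f hη, hΦ, Module.algebraMap_end_apply] at h1
  -- On D(r) the function r is invertible, so r w in E gives w in E there.
  obtain ⟨v, hv⟩ : ∃ v : Γ(Y, Y.basicOpen r), v * res hle r = 1 :=
    IsUnit.exists_left_inv (Y.toRingedSpace.isUnit_res_basicOpen r)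
  have h2 := (h1.smul v).mono (inf_le_left (b := U)) (mem_inf hg hU)
  rw [smul_smul] at h2
  have h3 : gen _ hg v * gen _ hη r = 1 := by
    have h4 := congrArg (gen _ hg) hv
    rwa [map_mul, gen_res, map_one] at h4
  rwa [h3, one_smul] at h2

end Near

/-! ### The lift of `E` -/

section Lift

variable {k : Type u} [Field k] {N : ℕ} {X Y : Scheme.{u}} [IsIntegral X] [IsIntegral Y] {f : X ⟶ Y} [Flat f]
  {g : Y ⟶ PSpace k N} {t : ℕ} {a : Fin t → ℤ} {o : Fin (N + 1)} {ho : genericPoint Y ∈ dom g o}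
  {Φ : X.functionField →+* Module.End Y.functionField (Fin t → Y.functionField)}
  [IsClosedImmersion g] [IsAffineHom f]
  (hΦ : ∀ c, Φ (fieldMap f c) = algebraMap _ _ c)
  (hst : ∀ (b : Fin (N + 1)) (hb : genericPoint Y ∈ dom g b), stabilizer f g a ho Φ hb = ⊤)

/-- The sections over `V` of the lift of `E`: the elements of the generic fibre, for `V` nonempty, which belong
to the lattice of `E` near each point of `V`. -/
def liftSections (V : X.Opens) : AddSubgroup (PLift (genericPoint X ∈ V) → Fin t → Y.functionField) where
  carrier := {w | ∀ h, ∀ x ∈ V, IsNear f g a ho Φ x (w h)}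
  add_mem' hw hw' h x hx := (hw h x hx).add hΦ hst (hw' h x hx)
  zero_mem' _ x _ := IsNear.zero x
  neg_mem' {w} hw h x hx := by
    have h1 := (hw h x hx).smul hΦ hst h.down hx (-1)
    rwa [map_neg, map_neg, map_one, map_one, LinearMap.neg_apply, Module.End.one_apply] at h1

instance (V : X.Opens) : Module Γ(X, V) (liftSections hΦ hst V) where
  smul r w := ⟨fun h => Φ (gen V h.down r) (w.1 h), fun h x hx => (w.2 h x hx).smul hΦ hst h.down hx r⟩
  one_smul w := Subtype.ext <| funext fun h => by
    change Φ (gen V h.down 1) (w.1 h) = _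
    rw [map_one, map_one, Module.End.one_apply]
  mul_smul r s w := Subtype.ext <| funext fun h => by
    change Φ (gen V h.down (r * s)) (w.1 h) = Φ (gen V h.down r) (Φ (gen V h.down s) (w.1 h))
    rw [map_mul, map_mul, Module.End.mul_apply]
  smul_zero r := Subtype.ext <| funext fun h => map_zero _
  smul_add r w w' := Subtype.ext <| funext fun h => map_add _ _ _
  add_smul r s w := Subtype.ext <| funext fun h => by
    change Φ (gen V h.down (r + s)) (w.1 h) = Φ (gen V h.down r) (w.1 h) + Φ (gen V h.down s) (w.1 h)
    rw [map_add, map_add, LinearMap.add_apply]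
  zero_smul w := Subtype.ext <| funext fun h => by
    change Φ (gen V h.down 0) (w.1 h) = 0
    rw [map_zero, map_zero, LinearMap.zero_apply]

/-- The presheaf of abelian groups underlying the lift of `E`. -/
def liftPresheaf : X.Opensᵒᵖ ⥤ Ab.{u} where
  obj V := AddCommGrpCat.of (liftSections hΦ hst V.unop)
  map i := AddCommGrpCat.ofHom
    { toFun w := ⟨fun h => w.1 ⟨i.unop.le h.down⟩, fun h x hx => w.2 _ x (i.unop.le hx)⟩
      map_zero' := rfl
      map_add' _ _ := rfl }

lemma liftPresheaf_isSheaf : TopCat.Presheaf.IsSheaf (X := X.toTopCat) (liftPresheaf hΦ hst) := by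
  rw [TopCat.Presheaf.isSheaf_iff_isSheaf_comp (forget Ab)]
  apply TopCat.Presheaf.isSheaf_of_isSheafUniqueGluing_types
  intro ι W sf hsf
  have hη {i} {x : X} (hx : x ∈ W i) : genericPoint X ∈ W i := genericPoint_mem hx
  have hw (h : genericPoint X ∈ iSup W) : ∃ w : Fin t → Y.functionField, ∀ i (hi : genericPoint X ∈ W i),
      (sf i).1 ⟨hi⟩ = w := by
    obtain ⟨i, hi⟩ := Opens.mem_iSup.mp h
    refine ⟨(sf i).1 ⟨hi⟩, fun j hj => ?_⟩
    exact congrFun (congrArg Subtype.val (hsf j i)) ⟨mem_inf hj hi⟩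
  choose w hw using hw
  refine ⟨⟨fun h => w h.down, fun h x hx => ?_⟩, fun i => ?_, fun v hv => ?_⟩
  · obtain ⟨i, hi⟩ := Opens.mem_iSup.mp hx
    change IsNear f g a ho Φ x (w h.down)
    rw [← hw h.down i (hη hi)]
    exact (sf i).2 _ x hi
  · exact Subtype.ext (funext fun h => (hw _ i h.down).symm)
  · refine Subtype.ext (funext fun h => ?_)
    obtain ⟨i, hi⟩ := Opens.mem_iSup.mp h.down
    change v.1 h = w h.down
    rw [← hw h.down i hi, ← hv i]
    rfl

/-- The sheaf of modules on `X` which lifts `E`. -/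
def liftModule : X.Modules where
  val :=
    letI (V : X.Opensᵒᵖ) : Module (X.ringCatSheaf.obj.obj V) ((liftPresheaf hΦ hst).obj V) :=
      inferInstanceAs (Module Γ(X, V.unop) (liftSections hΦ hst V.unop))
    .ofPresheaf (liftPresheaf hΦ hst) fun U V i r w => by
      refine Subtype.ext (funext fun h => ?_)
      change Φ (gen U.unop _ (show Γ(X, U.unop) from r)) _ = Φ (gen V.unop h.down (X.presheaf.map i r)) _
      refine congrFun (congrArg DFunLike.coe (congrArg Φ ?_)) _
      exact (gen_res i.unop.le h.down r).symm
  isSheaf := liftPresheaf_isSheaf hΦ hst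

/-- The value at the generic point of a section of the lift. -/
def liftVal {V : X.Opens} (hV : genericPoint X ∈ V) (m : Γ(liftModule hΦ hst, V)) : Fin t → Y.functionField :=
  (show liftSections hΦ hst V from m).1 ⟨hV⟩

/-- The section of the lift with a given value at the generic point. -/
def ofLiftVal {V : X.Opens} (w : Fin t → Y.functionField) (hw : ∀ x ∈ V, IsNear f g a ho Φ x w) :
    Γ(liftModule hΦ hst, V) :=
  (show liftSections hΦ hst V from ⟨fun _ => w, fun _ => hw⟩)

variable {hΦ hst} {V V' : X.Opens} (hV : genericPoint X ∈ V)

lemma liftVal_ofLiftVal (w : Fin t → Y.functionField) (hw : ∀ x ∈ V, IsNear f g a ho Φ x w) :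
    liftVal hΦ hst hV (ofLiftVal hΦ hst w hw) = w := rfl

lemma liftVal_smul (r : Γ(X, V)) (m : Γ(liftModule hΦ hst, V)) :
    liftVal hΦ hst hV (r • m) = Φ (gen V hV r) (liftVal hΦ hst hV m) := rfl

lemma liftVal_modRes (h : V' ≤ V) (hV' : genericPoint X ∈ V') (m : Γ(liftModule hΦ hst, V)) :
    liftVal hΦ hst hV' (modRes _ h m) = liftVal hΦ hst (h hV') m := rfl

lemma liftVal_add (m m' : Γ(liftModule hΦ hst, V)) :
    liftVal hΦ hst hV (m + m') = liftVal hΦ hst hV m + liftVal hΦ hst hV m' := rfl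

lemma isNear_liftVal (m : Γ(liftModule hΦ hst, V)) {x : X} (hx : x ∈ V) :
    IsNear f g a ho Φ x (liftVal hΦ hst hV m) :=
  (show liftSections hΦ hst V from m).2 ⟨hV⟩ x hx

lemma lift_ext {m m' : Γ(liftModule hΦ hst, V)}
    (h : ∀ hV : genericPoint X ∈ V, liftVal hΦ hst hV m = liftVal hΦ hst hV m') : m = m' :=
  Subtype.ext (funext fun hV => h hV.down)

end Lift

/-! ### Noetherian charts, coherence of the lift, and comparison with E. -/

section Noetherian

variable {k : Type u} [Field k] {N : ℕ} {X Y : Scheme.{u}} (f : X ⟶ Y) (g : Y ⟶ PSpace k N)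

lemma isNoetherianRing_dom [IsClosedImmersion g] (b : Fin (N + 1)) : IsNoetherianRing Γ(Y, dom g b) := by
  refine isNoetherianRing_of_surjective (MvPolynomial (Fin (N + 1)) k) Γ(Y, dom g b)
    (MvPolynomial.eval₂Hom (scalar g (dom g b)) (transFun g b)) ?_
  rw [← RingHom.range_eq_top, eq_top_iff, ← closure_dom g b, Subring.closure_le]
  rintro _ (⟨c, rfl⟩ | ⟨c, rfl⟩)
  · exact ⟨MvPolynomial.C c, MvPolynomial.eval₂Hom_C _ _ _⟩
  · exact ⟨MvPolynomial.X c, MvPolynomial.eval₂Hom_X' _ _ _⟩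

lemma isNoetherianRing_preimage_dom [IsClosedImmersion g] [IsFinite f] (b : Fin (N + 1)) :
    IsNoetherianRing Γ(X, f ⁻¹ᵁ dom g b) := by
  have := isNoetherianRing_dom g b
  have hf : (f.app (dom g b)).hom.Finite := IsFinite.finite_app f _ (isAffineOpen_dom g b)
  let : Algebra Γ(Y, dom g b) Γ(X, f ⁻¹ᵁ dom g b) := (f.app (dom g b)).hom.toAlgebra
  have : Module.Finite Γ(Y, dom g b) Γ(X, f ⁻¹ᵁ dom g b) := hf
  exact IsNoetherianRing.of_finite Γ(Y, dom g b) Γ(X, f ⁻¹ᵁ dom g b)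

end Noetherian

section Lift

variable {k : Type u} [Field k] {N : ℕ} {X Y : Scheme.{u}} [IsIntegral X] [IsIntegral Y] {f : X ⟶ Y} [Flat f]
  {g : Y ⟶ PSpace k N} {t : ℕ} {a : Fin t → ℤ} {o : Fin (N + 1)} {ho : genericPoint Y ∈ dom g o}
  {Φ : X.functionField →+* Module.End Y.functionField (Fin t → Y.functionField)}
  [IsClosedImmersion g] [IsFinite f]
  (hΦ : ∀ c, Φ (fieldMap f c) = algebraMap _ _ c)
  (hst : ∀ (b : Fin (N + 1)) (hb : genericPoint Y ∈ dom g b), stabilizer f g a ho Φ hb = ⊤)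

lemma isSection_liftVal {U : Y.Opens} (hU : genericPoint Y ∈ U) (m : Γ(liftModule hΦ hst, f ⁻¹ᵁ U)) :
    IsSection g a ho hU (liftVal hΦ hst (genericPoint_mem_preimage f hU) m) :=
  isSection_of_isNear hΦ hst hU fun _ hx => isNear_liftVal _ m hx

/-- Over the preimage of a chart the sections of the lift are those of E, so the t local generators
x_b ^ (-a_j) e_j already generate them over the functions on Y. -/
lemma finite_liftModule (b : Fin (N + 1)) :
    Module.Finite Γ(X, f ⁻¹ᵁ dom g b) Γ(liftModule hΦ hst, f ⁻¹ᵁ dom g b) := by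
  by_cases hX : genericPoint X ∈ f ⁻¹ᵁ dom g b
  · have hb : genericPoint Y ∈ dom g b := genericPoint_mem_of_preimage f hX
    have hw (j : Fin t) : IsSection g a ho hb (Pi.single j (tau g ho b ^ (-a j))) := by
      refine (exists_coord_iff_of_le g a ho hb le_rfl).mpr fun i => ?_
      by_cases hij : i = j
      · subst hij
        exact ⟨1, by rw [Pi.single_eq_same, map_one, mul_one]⟩
      · exact ⟨0, by rw [Pi.single_eq_of_ne hij, map_zero, mul_zero]⟩
    let m (j : Fin t) : Γ(liftModule hΦ hst, f ⁻¹ᵁ dom g b) := ofLiftVal hΦ hst _ fun x hx => (hw j).isNear hx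
    let val : Γ(liftModule hΦ hst, f ⁻¹ᵁ dom g b) →+ (Fin t → Y.functionField) :=
      AddMonoidHom.mk' (liftVal hΦ hst hX) (liftVal_add hX)
    refine ⟨Submodule.fg_def.mpr ⟨Set.range m, Set.finite_range m, eq_top_iff.mpr fun x _ => ?_⟩⟩
    choose r hr using (exists_coord_iff_of_le g a ho hb le_rfl).mp (isSection_liftVal hΦ hst hb x)
    have hx : x = ∑ j, pull f (le_refl _) (r j) • m j := by
      refine lift_ext fun h => ?_
      change val x = val _
      rw [map_sum]
      have h1 (j : Fin t) : val (pull f (le_refl _) (r j) • m j) =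
          gen _ hb (r j) • Pi.single j (tau g ho b ^ (-a j)) := by
        refine (liftVal_smul hX _ _).trans ?_
        rw [← fieldMap_gen f hb, hΦ]
        rfl
      funext i
      rw [Finset.sum_apply, Finset.sum_eq_single i]
      · rw [h1, Pi.smul_apply, Pi.single_eq_same, smul_eq_mul, mul_comm]
        exact hr i
      · intro j _ hij
        rw [h1, Pi.smul_apply, Pi.single_eq_of_ne hij.symm, smul_zero]
      · simp
    rw [hx]
    exact Submodule.sum_mem _ fun j _ => Submodule.smul_mem _ _ (Submodule.subset_span ⟨j, rfl⟩)
  · have : Subsingleton Γ(liftModule hΦ hst, f ⁻¹ᵁ dom g b) := ⟨fun x y => lift_ext fun h => absurd h hX⟩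
    exact ⟨Submodule.fg_def.mpr ⟨∅, Set.finite_empty, eq_top_iff.mpr fun x _ => by
      rw [Subsingleton.elim x 0]; exact zero_mem _⟩⟩

/-- Extension of sections from D(s), up to a power of s, is `exists_pow_mem_colon`. Restriction to a
nonempty D(s) is injective because sections are determined at the generic point, and an empty D(s)
forces s = 0. -/
lemma isCoherent_liftModule : IsCoherent (liftModule hΦ hst) := by
  refine isCoherent_of_isLocalizing _ (fun b : ULift.{u} (Fin (N + 1)) => f ⁻¹ᵁ dom g b.down)
    (fun b => (isAffineOpen_dom g b.down).preimage f) ?_ (fun b => isNoetherianRing_preimage_dom f g b.down)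
    (fun b => finite_liftModule hΦ hst b.down) ?_ ?_
  · refine eq_top_iff.mpr fun x _ => ?_
    obtain ⟨b, hb⟩ := exists_mem_dom g (f x)
    exact Opens.mem_iSup.mpr ⟨⟨b⟩, hb⟩
  · rintro ⟨b⟩ s m
    by_cases hs : genericPoint X ∈ X.basicOpen s
    · have hX := X.basicOpen_le s hs
      have hb : genericPoint Y ∈ dom g b := genericPoint_mem_of_preimage f hX
      obtain ⟨n, hn⟩ := exists_pow_mem_colon hΦ hst hb s (w := liftVal hΦ hst hs m) fun x hx =>
        isNear_liftVal hs m hx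
      refine ⟨n, ofLiftVal hΦ hst _ fun x hx => ((mem_colon hst).mp hn).isNear hx, lift_ext fun _ => ?_⟩
      rw [liftVal_modRes, liftVal_ofLiftVal, liftVal_smul, ← map_pow, gen_res]
    · exact ⟨0, 0, lift_ext fun h => absurd h hs⟩
  · rintro ⟨b⟩ s m hm
    by_cases hs : genericPoint X ∈ X.basicOpen s
    · refine ⟨0, lift_ext fun h => ?_⟩
      rw [pow_zero, one_smul, ← liftVal_modRes (X.basicOpen_le s) hs m, hm]
      rfl
    · refine ⟨1, lift_ext fun h => ?_⟩
      have h0 : s = 0 := by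
        rw [← basicOpen_eq_bot_iff, eq_bot_iff]
        exact fun x hx => absurd (genericPoint_mem hx) hs
      rw [h0, pow_one, zero_smul]

/-- The section of the lift defined by a section of `E`. -/
def toLiftSections (U : Y.Opens) : Γ(dissocie g a, U) →+ liftSections hΦ hst (f ⁻¹ᵁ U) where
  toFun e := ⟨fun h => coord g a ho (genericPoint_mem_of_preimage f h.down) e, fun _ _ hx =>
    IsSection.isNear ⟨e, rfl⟩ hx⟩
  map_zero' := Subtype.ext (funext fun h => coord_zero g a ho (genericPoint_mem_of_preimage f h.down))
  map_add' e e' := Subtype.ext (funext fun h => coord_add g a ho (genericPoint_mem_of_preimage f h.down) e e')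

/-- The comparison morphism from `E` to the direct image of its lift. -/
def toLift : dissocie g a ⟶ (Scheme.Modules.pushforward f).obj (liftModule hΦ hst) where
  val := PresheafOfModules.homMk (M₁ := (dissocie g a).val)
    (M₂ := ((Scheme.Modules.pushforward f).obj (liftModule hΦ hst)).val)
    { app U := AddCommGrpCat.ofHom (toLiftSections hΦ hst U.unop)
      naturality U V i := by
        ext e
        refine Subtype.ext (funext fun h => ?_)
        exact coord_modRes g a ho i.unop.le (genericPoint_mem_of_preimage f h.down) e }
    (by
      intro U r e
      refine Subtype.ext (funext fun h => ?_)
      refine (coord_smul g a ho (genericPoint_mem_of_preimage f h.down) (show Γ(Y, U.unop) from r) e).trans ?_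
      have h1 := fieldMap_gen f (genericPoint_mem_of_preimage f h.down) (show Γ(Y, U.unop) from r)
      have h2 := hΦ (gen _ (genericPoint_mem_of_preimage f h.down) (show Γ(Y, U.unop) from r))
      rw [h1] at h2
      refine (congrFun (congrArg DFunLike.coe h2) _).symm.trans ?_
      have h3 : pull f (le_refl _) (show Γ(Y, U.unop) from r) = (f.app U.unop).hom (show Γ(Y, U.unop) from r) := by
        rw [Scheme.Hom.app_eq_appLE]
        rfl
      exact congrArg (fun z => Φ (gen (f ⁻¹ᵁ U.unop) h.down z)
        (coord g a ho (genericPoint_mem_of_preimage f h.down) e)) h3)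

/-- Over an open subset containing the generic point both sides are the same subset of K(Y)^t, by
`isSection_liftVal`; over an empty one both vanish. -/
lemma isIso_toLift : IsIso (toLift hΦ hst) := by
  rw [Scheme.Modules.Hom.isIso_iff_isIso_app]
  intro U
  rw [ConcreteCategory.isIso_iff_bijective]
  change Function.Bijective (toLiftSections hΦ hst U)
  by_cases hU : genericPoint Y ∈ U
  · refine ⟨fun e e' h => ?_, fun m => ?_⟩
    · exact coord_injective g a ho hU
        (congrFun (congrArg Subtype.val h) ⟨genericPoint_mem_preimage f hU⟩)
    · obtain ⟨e, he⟩ := isSection_liftVal hΦ hst hU m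
      exact ⟨e, Subtype.ext (funext fun h => he)⟩
  · refine ⟨fun e e' _ => ?_, fun m => ⟨0, Subtype.ext (funext fun h => ?_)⟩⟩
    · refine component_ext g a fun j => Subtype.ext (funext fun b => eq_of_gen fun h => absurd h.1 hU)
    · exact absurd (genericPoint_mem_of_preimage f h.down) hU

lemma lifts_dissocie (hΦ : ∀ c, Φ (fieldMap f c) = algebraMap _ _ c)
    (hst : ∀ (b : Fin (N + 1)) (hb : genericPoint Y ∈ dom g b), stabilizer f g a ho Φ hb = ⊤) :
    Lifts f (dissocie g a) :=
  have := isIso_toLift hΦ hst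
  ⟨liftModule hΦ hst, isCoherent_liftModule hΦ hst, ⟨(asIso (toLift hΦ hst)).symm⟩⟩

end Lift


/-! ### Assembly of the lifting theorem. -/

section Final

variable {k : Type u} [Field k] {N : ℕ} {X Y : Scheme.{u}} [IsIntegral X] [IsIntegral Y]

/-- The lifting theorem, with the bound in terms of any degree in which the relations are generated. -/
lemma lifts_of_restrictionLifts (f : X ⟶ Y) [IsFinite f] [Flat f] (g : Y ⟶ PSpace k N) [IsClosedImmersion g]
    (hX : IsVeryAmple ((f ≫ g) ≫ PSpace.toSpec k N) (twist (f ≫ g) 1)) {t : ℕ} (a : Fin t → ℤ) {m n : ℕ}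
    (hm : GeneratedInDegreeLE f g m) (hn : max 2 m + spread a ≤ n) {Z : Scheme.{u}} (ι : Z ⟶ Y)
    (hZ : IsSeparating g ι n) (h : RestrictionLifts f ι (dissocie g a)) : Lifts f (dissocie g a) := by
  obtain ⟨F, φ, α, -, hα⟩ := h
  obtain ⟨o, ho⟩ := exists_genericPoint_mem_dom g
  obtain ⟨Φ, hΦ, hv⟩ := exists_fieldAction ho (closure_eq_top hX ho) hα hm hn hZ
  exact lifts_dissocie hΦ fun b hb => stabilizer_eq_top hX hΦ hv hb

end Final

end FiniteFlatLift

end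

theorem mainTheorem6 {k : Type u} [Field k] [IsAlgClosed k] [CharZero k]
    {X Y : Scheme.{u}} [IsIntegral X] [IsIntegral Y]
    (f : X ⟶ Y) [IsFinite f] [Flat f]
    {N : ℕ} (g : Y ⟶ PSpace k N) [IsClosedImmersion g]
    (hX : IsVeryAmple ((f ≫ g) ≫ PSpace.toSpec k N) (twist (f ≫ g) 1))
    (hR : IsIntegrallyClosed (SectionRing g))
    {t : ℕ} (a : Fin t → ℤ) :
    ∃ nX n : ℕ, IsLeast {d | GeneratedInDegreeLE f g d} nX ∧
      n = max 2 nX + spread a ∧ 0 < n ∧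
      ∀ (Z : Scheme.{u}) (ι : Z ⟶ Y) [IsClosedImmersion ι], IsSeparating g ι n →
        RestrictionLifts f ι (dissocie g a) → Lifts f (dissocie g a) := by
  obtain ⟨m, hm⟩ := exists_isLeast_generatedInDegreeLE f g
  exact ⟨m, max 2 m + spread a, hm, rfl, by omega, fun Z ι _ hZ h =>
    lifts_of_restrictionLifts f g hX a hm.1 le_rfl ι hZ h⟩
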